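/- **Setting.** Let $n\ge 0$ and let $\lambda$ be a partition with $|\lambda|=n$, identified with its Young diagram in English notation; the content of the box $\square$ in row $r$ and column $s$ is $c(\square)=s-r$. All algebras are over $\mathbb{Q}(q,t)$. *Tableaux.* Order the formal products $jq^b$ ($1\le j\le n$, $b\ge 0$) by $jq^m<kq^\ell$ iff $m>\ell$, or $m=\ell$ and $j<k$. $\mathrm{PSYT}(\lambda)$ is the set of labellings $\tau$ of the boxes of $\lambda$ by such products, strictly increasing along rows and columns, in which each $1\le j\le n$ occurs in exactly one box. $\mathrm{SYT}(\lambda)\subset\mathrm{PSYT}(\lambda)$ is the set of standard Young tableaux (all exponents $b$ equal to $0$). If $\tau(\square)=iq^b$, put $w_\tau(i)=b$ and $c_\tau(i)=c(\square)$. For $1\le i\le n-1$, $s_i(\tau)$ is the labelling obtained by exchanging $i$ and $i+1$ and leaving the exponent in each box unchanged; it is defined if the result is in $\mathrm{PSYT}(\lambda)$. $\Psi(\tau)$ is obtained by replacing each label $kq^a$ with $k\ge2$ by $(k-1)q^a$, and $1q^a$ by $nq^{a+1}$. Let $<$ be the order generated by $\tau<\Psi(\tau)$, by $\tau<s_i(\tau)$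 if $w_\tau(i)<w_\tau(i+1)$, and by $\tau<s_i(\tau)$ if $w_\tau(i)=w_\tau(i+1)$, $c_\tau(i)-c_\tau(i+1)>1$. *Algebras.* $\mathcal{H}_n$ is generated by $T_1,\dots,T_{n-1}$ with $(T_i-1)(T_i+t)=0$, $T_iT_{i+1}T_i=T_{i+1}T_iT_{i+1}$, and $T_iT_j=T_jT_i$ for $|i-j|>1$. $\mathcal{A}_n$ is generated by $T_1,\dots,T_{n-1},\theta_1,\dots,\theta_n$ with the relations of $\mathcal{H}_n$, $\theta_i\theta_j=\theta_j\theta_i$, $\theta_{i+1}=tT_i^{-1}\theta_iT_i^{-1}$, and $T_i\theta_j=\theta_jT_i$ for $j\notin\{i,i+1\}$; for $n\ge 1$ put $\pi_n=t^{n-1}\theta_1T_1^{-1}\cdots T_{n-1}^{-1}$. $\mathcal{D}_n$ is generated by $T_i,\theta_i$ and $X_1,\dots,X_n$ with the relations of $\mathcal{A}_n$, $X_iX_j=X_jX_i$, $X_{i+1}=tT_i^{-1}X_iT_i^{-1}$, $T_iX_j=X_jT_i$ for $j\notin\{i,i+1\}$, $\pi_nX_i=X_{i+1}\pi_n$ for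 $1\le i\le n-1$, and $\pi_nX_n=qX_1\pi_n$. In $\mathcal{H}_n$ put $\overline\theta_1=1$, $\overline\theta_{i+1}=tT_i^{-1}\overline\theta_iT_i^{-1}$ and $\overline\varphi_i=(tT_i^{-1})\overline\theta_i-\overline\theta_i(tT_i^{-1})$; there is an algebra map $\rho_n:\mathcal{A}_n\to\mathcal{H}_n$ with $T_i\mapsto T_i$, $\theta_i\mapsto\overline\theta_i$. *Modules.* Let $\lambda$ also denote the $\mathcal{H}_n$-module generated by the $\tau\in\mathrm{SYT}(\lambda)$ with relations $\overline\theta_i(\tau)=t^{c_\tau(i)}\tau$; $\overline\varphi_i(\tau)=(t^{c_\tau(i)}-t^{c_\tau(i+1)})s_i(\tau)$ if $s_i(\tau)>\tau$; $T_i(\tau)=\tau$ if $i,i+1$ lie in the same row of $\tau$; and $T_i(\tau)=-t\tau$ if they lie in the same column. Let $V_\lambda=\mathrm{Ind}_{\mathcal{A}_n}^{\mathcal{D}_n}\rho_n^*(\lambda)=\mathcal{D}_n\otimes_{\mathcal{A}_n}\rho_n^*(\lambda)$. **Proposition.** There is a $\mathbb{Q}(q,t)$-basis $\{F_\tau:\tau\in\mathrm{PSYT}(\lambda)\}$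 of $V_\lambda$ such that: 1. $\theta_i(F_\tau)=q^{w_\tau(i)}t^{c_\tau(i)}F_\tau$ for all $\tau\in\mathrm{PSYT}(\lambda)$, $1\le i\le n$, and distinct $\tau$ have distinct weights $(q^{w_\tau(i)}t^{c_\tau(i)})_{1\le i\le n}$; 2. $F_\tau=1\otimes\tau$ for $\tau\in\mathrm{SYT}(\lambda)$; 3. if $s_i(\tau)>\tau$, then $$\left(tT_i^{-1}+\frac{(t-1)q^{w_\tau(i+1)}t^{c_\tau(i+1)}}{q^{w_\tau(i)}t^{c_\tau(i)}-q^{w_\tau(i+1)}t^{c_\tau(i+1)}}\right)F_\tau=F_{s_i(\tau)};$$ 4. if $n\ge1$, then $\pi_n$ acts invertibly on $V_\lambda$, and $F_{\Psi(\tau)}=q^{w_\tau(1)}X_n\pi_n^{-1}F_\tau$ for all $\tau\in\mathrm{PSYT}(\lambda)$. -/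

import Mathlib

namespace VVMac

noncomputable section

/-! ### The base field `ℚ(q,t)` -/

/-- The field `ℚ(q,t)` of rational functions in two independent variables. -/
def K : Type := FractionRing (MvPolynomial (Fin 2) ℚ)

instance : Field K := inferInstanceAs (Field (FractionRing (MvPolynomial (Fin 2) ℚ)))

instance : Algebra (MvPolynomial (Fin 2) ℚ) K :=
  inferInstanceAs (Algebra (MvPolynomial (Fin 2) ℚ) (FractionRing (MvPolynomial (Fin 2) ℚ)))

instance : IsFractionRing (MvPolynomial (Fin 2) ℚ) K :=
  inferInstanceAs (IsFractionRing (MvPolynomial (Fin 2) ℚ) (FractionRing (MvPolynomial (Fin 2) ℚ)))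

def q : K := algebraMap (MvPolynomial (Fin 2) ℚ) K (MvPolynomial.X 0)

def t : K := algebraMap (MvPolynomial (Fin 2) ℚ) K (MvPolynomial.X 1)

theorem t_ne_zero : t ≠ 0 := by
  unfold t
  rw [Ne, IsFractionRing.to_map_eq_zero_iff]
  exact MvPolynomial.X_ne_zero 1

/-! ### Tableaux

Indices are zero-based: `k : Fin n` stands for the label `k + 1`, and `i : Fin (n - 1)` stands
for the index `i + 1` of a simple transposition. `lo i` and `hi i` are `i` and `i + 1` in `Fin n`. -/

def lo {n : ℕ} (i : Fin (n - 1)) : Fin n := ⟨i.1, by omega⟩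

def hi {n : ℕ} (i : Fin (n - 1)) : Fin n := ⟨i.1 + 1, by omega⟩

/-- The pair `(j, m)` is the formal product `j q^m`; `j q^m < k q^l` if `m > l`, or `m = l` and
`j < k`. -/
def LabelLt {n : ℕ} (x y : Fin n × ℕ) : Prop := y.2 < x.2 ∨ (x.2 = y.2 ∧ x.1 < y.1)

/-- Non-negative periodic standard Young tableaux of shape `μ`. A cell is `(row, column)`. -/
@[ext] structure PSYT (n : ℕ) (μ : YoungDiagram) where
  label : μ.cells → Fin n × ℕ
  bij : Function.Bijective (fun b => (label b).1)
  row_lt : ∀ b b' : μ.cells, b.1.1 = b'.1.1 → b.1.2 < b'.1.2 → LabelLt (label b) (label b')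
  col_lt : ∀ b b' : μ.cells, b.1.2 = b'.1.2 → b.1.1 < b'.1.1 → LabelLt (label b) (label b')

/-- Standard Young tableaux of shape `μ`. -/
@[ext] structure SYT (n : ℕ) (μ : YoungDiagram) where
  label : μ.cells → Fin n
  bij : Function.Bijective label
  row_lt : ∀ b b' : μ.cells, b.1.1 = b'.1.1 → b.1.2 < b'.1.2 → label b < label b'
  col_lt : ∀ b b' : μ.cells, b.1.2 = b'.1.2 → b.1.1 < b'.1.1 → label b < label b'

/-- The inclusion of standard into periodic standard tableaux, `j ↦ j q^0`. -/
def SYT.toPSYT {n : ℕ} {μ : YoungDiagram} (τ : SYT n μ) : PSYT n μ where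
  label b := (τ.label b, 0)
  bij := τ.bij
  row_lt b b' h h' := Or.inr ⟨rfl, τ.row_lt b b' h h'⟩
  col_lt b b' h h' := Or.inr ⟨rfl, τ.col_lt b b' h h'⟩

/-- The content of a cell: column minus row. -/
def content (b : ℕ × ℕ) : ℤ := (b.2 : ℤ) - (b.1 : ℤ)

namespace PSYT

variable {n : ℕ} {μ : YoungDiagram}

/-- The cell whose label is `i q^b` for some `b`. -/
def box (τ : PSYT n μ) (i : Fin n) : μ.cells := (Equiv.ofBijective _ τ.bij).symm i

/-- `w_τ(i) = b` when `i q^b` is a label of `τ`. -/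
def w (τ : PSYT n μ) (i : Fin n) : ℕ := (τ.label (τ.box i)).2

/-- `c_τ(i)` is the content of the cell labelled `i q^b`. -/
def c (τ : PSYT n μ) (i : Fin n) : ℤ := content (τ.box i).1

/-- `q^{w_τ(i)} t^{c_τ(i)}` -/
def weight (τ : PSYT n μ) (i : Fin n) : K := q ^ τ.w i * t ^ τ.c i

/-- `IsSwap i τ σ` says that `s_i(τ)` is defined (lies in `PSYT`) and equals `σ`. -/
def IsSwap (i : Fin (n - 1)) (τ σ : PSYT n μ) : Prop :=
  ∀ b, σ.label b = (Equiv.swap (lo i) (hi i) (τ.label b).1, (τ.label b).2)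

/-- The effect of `Ψ` on labels: `k q^a ↦ (k-1) q^a` if `k ≥ 2` and `1 q^a ↦ n q^{a+1}`. -/
def shiftLabel (x : Fin n × ℕ) : Fin n × ℕ :=
  if x.1.1 = 0 then (⟨n - 1, by have := x.1.2; omega⟩, x.2 + 1)
  else (⟨x.1.1 - 1, by have := x.1.2; omega⟩, x.2)

theorem shiftLabel_lt {x y : Fin n × ℕ} (h : LabelLt x y) :
    LabelLt (shiftLabel x) (shiftLabel y) := by
  obtain ⟨⟨a, ha⟩, m⟩ := x
  obtain ⟨⟨b, hb⟩, l⟩ := y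
  unfold LabelLt shiftLabel at *
  simp only [Fin.lt_def] at *
  split_ifs <;> simp only [] <;> omega

theorem shiftLabel_fst_inj {x y : Fin n × ℕ} (h : (shiftLabel x).1 = (shiftLabel y).1) :
    x.1 = y.1 := by
  obtain ⟨⟨a, ha⟩, m⟩ := x
  obtain ⟨⟨b, hb⟩, l⟩ := y
  unfold shiftLabel at h
  simp only [Fin.mk.injEq] at *
  split_ifs at h <;> simp only [Fin.mk.injEq] at h <;> omega

def Psi (τ : PSYT n μ) : PSYT n μ where
  label b := shiftLabel (τ.label b)
  bij := by
    have hinj : Function.Injective (fun b => (shiftLabel (τ.label b)).1) :=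
      fun b b' h => τ.bij.1 (shiftLabel_fst_inj h)
    exact (Fintype.bijective_iff_injective_and_card _).2
      ⟨hinj, Fintype.card_of_bijective τ.bij⟩
  row_lt b b' h h' := shiftLabel_lt (τ.row_lt b b' h h')
  col_lt b b' h h' := shiftLabel_lt (τ.col_lt b b' h h')

/-- The cover relations: `Cover τ σ` makes `σ` larger than `τ`. -/
inductive Cover : PSYT n μ → PSYT n μ → Prop
  | psi (τ : PSYT n μ) : Cover τ τ.Psi
  | swap_of_lt (i : Fin (n - 1)) (τ σ : PSYT n μ) (h : IsSwap i τ σ)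
      (hw : τ.w (lo i) < τ.w (hi i)) : Cover τ σ
  | swap_of_eq (i : Fin (n - 1)) (τ σ : PSYT n μ) (h : IsSwap i τ σ)
      (hw : τ.w (lo i) = τ.w (hi i)) (hc : 1 < τ.c (lo i) - τ.c (hi i)) : Cover τ σ

/-- The strict order `τ < σ` generated by the cover relations. -/
def Lt (τ σ : PSYT n μ) : Prop := Relation.TransGen Cover τ σ

end PSYT

/-! ### The algebras -/

section Relations

variable {n : ℕ} {A : Type} [Ring A] [Algebra K A]

/-- `t T_i⁻¹`; by the quadratic relation `(T_i - 1)(T_i + t) = 0` it is `T_i + t - 1`. -/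
def tTinv (T : Fin (n - 1) → A) (i : Fin (n - 1)) : A := T i + algebraMap K A (t - 1)

/-- `T_i⁻¹` -/
def Tinv (T : Fin (n - 1) → A) (i : Fin (n - 1)) : A := t⁻¹ • tTinv T i

/-- The defining relations of the finite Hecke algebra. -/
inductive HeckeRel (T : Fin (n - 1) → A) : A → A → Prop
  | quad (i : Fin (n - 1)) : HeckeRel T ((T i - 1) * (T i + algebraMap K A t)) 0
  | braid (i j : Fin (n - 1)) (h : i.1 + 1 = j.1) :
      HeckeRel T (T i * T j * T i) (T j * T i * T j)
  | comm (i j : Fin (n - 1)) (h : i.1 + 1 < j.1 ∨ j.1 + 1 < i.1) :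
      HeckeRel T (T i * T j) (T j * T i)

/-- The defining relations of the positive affine Hecke algebra. -/
inductive AffineRel (T : Fin (n - 1) → A) (θ : Fin n → A) : A → A → Prop
  | hecke {a b : A} (h : HeckeRel T a b) : AffineRel T θ a b
  | theta_comm (i j : Fin n) : AffineRel T θ (θ i * θ j) (θ j * θ i)
  | theta_succ (i : Fin (n - 1)) :
      AffineRel T θ (θ (hi i)) (t • (Tinv T i * θ (lo i) * Tinv T i))
  | T_theta (i : Fin (n - 1)) (j : Fin n) (h : j ≠ lo i) (h' : j ≠ hi i) :
      AffineRel T θ (T i * θ j) (θ j * T i)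

/-- `π_n = t^{n-1} θ_1 T_1⁻¹ ⋯ T_{n-1}⁻¹` -/
def piElt (T : Fin (n - 1) → A) (θ : Fin n → A) (hn : 0 < n) : A :=
  t ^ (n - 1) • (θ ⟨0, hn⟩ * (List.ofFn (Tinv T)).prod)

/-- The defining relations of the positive double affine Hecke algebra. -/
inductive DahaRel (T : Fin (n - 1) → A) (θ X : Fin n → A) : A → A → Prop
  | affine {a b : A} (h : AffineRel T θ a b) : DahaRel T θ X a b
  | X_comm (i j : Fin n) : DahaRel T θ X (X i * X j) (X j * X i)
  | X_succ (i : Fin (n - 1)) :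
      DahaRel T θ X (X (hi i)) (t • (Tinv T i * X (lo i) * Tinv T i))
  | T_X (i : Fin (n - 1)) (j : Fin n) (h : j ≠ lo i) (h' : j ≠ hi i) :
      DahaRel T θ X (T i * X j) (X j * T i)
  | pi_X (hn : 0 < n) (i : Fin (n - 1)) :
      DahaRel T θ X (piElt T θ hn * X (lo i)) (X (hi i) * piElt T θ hn)
  | pi_X_last (hn : 0 < n) :
      DahaRel T θ X (piElt T θ hn * X ⟨n - 1, by omega⟩) (q • (X ⟨0, hn⟩ * piElt T θ hn))

/-- Auxiliary recursion for `thetaBar` on natural numbers (the value `0` outside the range is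
never used). -/
def thetaBarAux (T : Fin (n - 1) → A) : ℕ → A
  | 0 => 1
  | k + 1 => if h : k < n - 1 then t • (Tinv T ⟨k, h⟩ * thetaBarAux T k * Tinv T ⟨k, h⟩) else 0

/-- `θ̄_1 = 1` and `θ̄_{i+1} = t T_i⁻¹ θ̄_i T_i⁻¹`. -/
def thetaBar (T : Fin (n - 1) → A) (i : Fin n) : A := thetaBarAux T i.1

/-- `φ̄_i = (t T_i⁻¹) θ̄_i - θ̄_i (t T_i⁻¹)` -/
def phiBar (T : Fin (n - 1) → A) (i : Fin (n - 1)) : A :=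
  tTinv T i * thetaBar T (lo i) - thetaBar T (lo i) * tTinv T i

/-- A family satisfies the Hecke relations. -/
def SatHecke (T : Fin (n - 1) → A) : Prop := ∀ a b, HeckeRel T a b → a = b

variable {T : Fin (n - 1) → A}

theorem T_mul_tTinv (hT : SatHecke T) (i : Fin (n - 1)) : T i * tTinv T i = t • 1 := by
  have h := hT _ _ (HeckeRel.quad i)
  rw [sub_mul, one_mul, mul_add] at h
  rw [tTinv, map_sub, map_one, mul_add, mul_sub, mul_one, Algebra.smul_def, mul_one]
  rw [← sub_eq_zero, ← h]
  abel

theorem tTinv_mul_T (hT : SatHecke T) (i : Fin (n - 1)) : tTinv T i * T i = t • 1 := by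
  rw [← T_mul_tTinv hT i, tTinv, add_mul, mul_add, Algebra.commutes]

theorem T_mul_Tinv (hT : SatHecke T) (i : Fin (n - 1)) : T i * Tinv T i = 1 := by
  rw [Tinv, mul_smul_comm, T_mul_tTinv hT, smul_smul, inv_mul_cancel₀ t_ne_zero, one_smul]

theorem Tinv_mul_T (hT : SatHecke T) (i : Fin (n - 1)) : Tinv T i * T i = 1 := by
  rw [Tinv, smul_mul_assoc, tTinv_mul_T hT, smul_smul, inv_mul_cancel₀ t_ne_zero, one_smul]

theorem commute_Tinv {a : A} {i : Fin (n - 1)} (h : Commute a (T i)) : Commute a (Tinv T i) :=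
  Commute.smul_right (h.add_right (Algebra.commutes _ a).symm) _

theorem thetaBarAux_succ (k : ℕ) (h : k < n - 1) :
    thetaBarAux T (k + 1) = t • (Tinv T ⟨k, h⟩ * thetaBarAux T k * Tinv T ⟨k, h⟩) := by
  rw [thetaBarAux, dif_pos h]

theorem commute_thetaBarAux {a : A} (k : ℕ) (h : ∀ i : Fin (n - 1), i.1 < k → Commute a (T i)) :
    Commute a (thetaBarAux T k) := by
  induction k with
  | zero => exact Commute.one_right a
  | succ k ih =>
    rw [thetaBarAux]
    split_ifs with hk
    · have h1 := commute_Tinv (h ⟨k, hk⟩ (Nat.lt_succ_self k))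
      exact ((h1.mul_right (ih fun i hi => h i (by omega))).mul_right h1).smul_right _
    · exact Commute.zero_right a

theorem commute_T_T (hT : SatHecke T) (i j : Fin (n - 1)) (h : i.1 + 1 < j.1 ∨ j.1 + 1 < i.1) :
    Commute (T i) (T j) := hT _ _ (HeckeRel.comm i j h)

/-- `T_i T_{j}⁻¹ T_i⁻¹ = T_j⁻¹ T_i⁻¹ T_j` for `|i - j| = 1`. -/
theorem braid_inv (hT : SatHecke T) (i j : Fin (n - 1)) (h : i.1 + 1 = j.1) :
    T i * (Tinv T j * Tinv T i) = Tinv T j * Tinv T i * T j ∧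
      Tinv T i * Tinv T j * T i = T j * (Tinv T i * Tinv T j) := by
  have hb := hT _ _ (HeckeRel.braid i j h)
  have i1 := T_mul_Tinv hT i
  have i2 := Tinv_mul_T hT i
  have j1 := T_mul_Tinv hT j
  have j2 := Tinv_mul_T hT j
  generalize Tinv T i = a' at *
  generalize Tinv T j = b' at *
  generalize T i = a at *
  generalize T j = b at *
  constructor
  · calc a * (b' * a') = (b' * (a' * a) * b) * a * (b' * a') := by
          rw [i2, mul_one, j2, one_mul]
      _ = b' * a' * (a * b * a) * (b' * a') := by simp only [mul_assoc]
      _ = b' * a' * b * (a * (b * b') * a') := by rw [hb]; simp only [mul_assoc]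
      _ = b' * a' * b := by rw [j1, mul_one, i1, mul_one]
  · calc a' * b' * a = a' * b' * a * (b * (a * a') * b') := by rw [i1, mul_one, j1, mul_one]
      _ = a' * b' * (a * b * a) * (a' * b') := by simp only [mul_assoc]
      _ = a' * (b' * b) * a * b * (a' * b') := by rw [hb]; simp only [mul_assoc]
      _ = b * (a' * b') := by rw [j2, mul_one, i2, one_mul]

theorem commute_T_thetaBarAux (hT : SatHecke T) (i : Fin (n - 1)) (k : ℕ) (h : k ≠ i.1)
    (h' : k ≠ i.1 + 1) : Commute (T i) (thetaBarAux T k) := by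
  rcases lt_or_gt_of_ne h with hk | hk
  · exact commute_thetaBarAux k fun j hj => commute_T_T hT i j (Or.inr (by omega))
  · obtain ⟨d, rfl⟩ : ∃ d, k = i.1 + 2 + d := ⟨k - i.1 - 2, by omega⟩
    clear h h' hk
    induction d with
    | zero =>
      by_cases hj : i.1 + 1 < n - 1
      · have hi : i.1 < n - 1 := i.2
        obtain ⟨e1, e2⟩ := braid_inv hT i ⟨i.1 + 1, hj⟩ rfl
        have hc : Commute (T ⟨i.1 + 1, hj⟩) (thetaBarAux T i.1) :=
          commute_thetaBarAux _ fun j hj' => commute_T_T hT _ _ (Or.inr (by simpa using hj'))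
        change Commute (T i) (thetaBarAux T (i.1 + 1 + 1))
        rw [thetaBarAux_succ _ hj, thetaBarAux_succ _ hi]
        simp only [mul_smul_comm, smul_mul_assoc]
        refine Commute.smul_right (Commute.smul_right ?_ _) _
        generalize Tinv T ⟨i.1 + 1, hj⟩ = b' at *
        change Commute (T i) (b' * (Tinv T i * thetaBarAux T i.1 * Tinv T i) * b')
        generalize Tinv T i = a' at *
        generalize T ⟨i.1 + 1, hj⟩ = b at *
        generalize thetaBarAux T i.1 = x at *
        generalize T i = a at *
        change a * (b' * (a' * x * a') * b') = b' * (a' * x * a') * b' * a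
        calc a * (b' * (a' * x * a') * b') = a * (b' * a') * x * (a' * b') := by
              simp only [mul_assoc]
          _ = b' * a' * (b * x) * (a' * b') := by rw [e1]; simp only [mul_assoc]
          _ = b' * a' * x * (b * (a' * b')) := by rw [hc.eq]; simp only [mul_assoc]
          _ = b' * (a' * x * a') * b' * a := by rw [← e2]; simp only [mul_assoc]
      · change Commute (T i) (thetaBarAux T (i.1 + 1 + 1))
        rw [thetaBarAux, dif_neg hj]
        exact Commute.zero_right _
    | succ d ih =>
      change Commute (T i) (thetaBarAux T (i.1 + 2 + d + 1))
      rw [thetaBarAux]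
      split_ifs with hk
      · have h1 := commute_Tinv
          (commute_T_T hT i ⟨i.1 + 2 + d, hk⟩ (Or.inl (by simp only []; omega)))
        exact ((h1.mul_right ih).mul_right h1).smul_right _
      · exact Commute.zero_right _

theorem commute_thetaBar (hT : SatHecke T) (i j : Fin n) :
    Commute (thetaBar T i) (thetaBar T j) := by
  rcases lt_trichotomy i.1 j.1 with h | h | h
  · exact (commute_thetaBarAux _ fun k hk =>
      (commute_T_thetaBarAux hT k j.1 (by omega) (by omega)).symm).symm
  · rw [Fin.ext h]
  · exact commute_thetaBarAux _ fun k hk =>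
      (commute_T_thetaBarAux hT k i.1 (by omega) (by omega)).symm

/-- The elements `θ̄_i` satisfy the relations of the affine Hecke algebra. -/
theorem affineRel_thetaBar (hT : SatHecke T) {a b : A} (h : AffineRel T (thetaBar T) a b) :
    a = b := by
  cases h with
  | hecke h => exact hT _ _ h
  | theta_comm i j => exact commute_thetaBar hT i j
  | theta_succ i => exact thetaBarAux_succ i.1 i.2
  | T_theta i j h h' =>
    exact commute_T_thetaBarAux hT i j.1 (fun e => h (Fin.ext e)) (fun e => h' (Fin.ext e))

end Relations

section Map

variable {n : ℕ} {A B : Type} [Ring A] [Algebra K A] [Ring B] [Algebra K B]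

theorem map_tTinv (f : A →ₐ[K] B) (T : Fin (n - 1) → A) (i : Fin (n - 1)) :
    f (tTinv T i) = tTinv (fun j => f (T j)) i := by
  simp only [tTinv, map_add, AlgHom.commutes]

theorem map_Tinv (f : A →ₐ[K] B) (T : Fin (n - 1) → A) (i : Fin (n - 1)) :
    f (Tinv T i) = Tinv (fun j => f (T j)) i := by
  simp only [Tinv, map_smul, map_tTinv]

theorem HeckeRel.map (f : A →ₐ[K] B) {T : Fin (n - 1) → A} {a b : A} (h : HeckeRel T a b) :
    HeckeRel (fun j => f (T j)) (f a) (f b) := by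
  cases h with
  | quad i =>
    simpa only [map_mul, map_sub, map_add, map_one, map_zero, AlgHom.commutes] using
      HeckeRel.quad (T := fun j => f (T j)) i
  | braid i j h => simpa only [map_mul] using HeckeRel.braid (T := fun j => f (T j)) i j h
  | comm i j h => simpa only [map_mul] using HeckeRel.comm (T := fun j => f (T j)) i j h

theorem AffineRel.map (f : A →ₐ[K] B) {T : Fin (n - 1) → A} {θ : Fin n → A} {a b : A}
    (h : AffineRel T θ a b) :
    AffineRel (fun j => f (T j)) (fun j => f (θ j)) (f a) (f b) := by
  cases h with
  | hecke h => exact AffineRel.hecke (h.map f)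
  | theta_comm i j =>
    simpa only [map_mul] using AffineRel.theta_comm (T := fun j => f (T j)) (θ := fun j => f (θ j)) i j
  | theta_succ i =>
    simpa only [map_mul, map_smul, map_Tinv] using
      AffineRel.theta_succ (T := fun j => f (T j)) (θ := fun j => f (θ j)) i
  | T_theta i j h h' =>
    simpa only [map_mul] using
      AffineRel.T_theta (T := fun j => f (T j)) (θ := fun j => f (θ j)) i j h h'

end Map

inductive AffineGen (n : ℕ) : Type
  | T (i : Fin (n - 1))
  | θ (i : Fin n)

inductive DahaGen (n : ℕ) : Type
  | T (i : Fin (n - 1))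
  | θ (i : Fin n)
  | X (i : Fin n)

/-- The `K`-algebra generated by `G` subject to the relations `r`. -/
def Presented (G : Type) (r : FreeAlgebra K G → FreeAlgebra K G → Prop) : Type := RingQuot r

namespace Presented

variable {G : Type} (r : FreeAlgebra K G → FreeAlgebra K G → Prop)

instance : Ring (Presented G r) := inferInstanceAs (Ring (RingQuot r))

instance : Algebra K (Presented G r) := inferInstanceAs (Algebra K (RingQuot r))

/-- The canonical projection from the free algebra. -/
def mk : FreeAlgebra K G →ₐ[K] Presented G r := RingQuot.mkAlgHom K r

/-- The class of a generator. -/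
def gen (g : G) : Presented G r := mk r (FreeAlgebra.ι K g)

variable {r}

theorem mk_rel {a b : FreeAlgebra K G} (h : r a b) : mk r a = mk r b := RingQuot.mkAlgHom_rel K h

variable {A : Type} [Ring A] [Algebra K A]

/-- The universal property. -/
def lift (f : G → A)
    (hf : ∀ a b, r a b → FreeAlgebra.lift K f a = FreeAlgebra.lift K f b) :
    Presented G r →ₐ[K] A :=
  RingQuot.liftAlgHom K ⟨FreeAlgebra.lift K f, fun {a b} h => hf a b h⟩

theorem lift_gen (f : G → A)
    (hf : ∀ a b, r a b → FreeAlgebra.lift K f a = FreeAlgebra.lift K f b) (g : G) :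
    lift f hf (gen r g) = f g :=
  (RingQuot.liftAlgHom_mkAlgHom_apply K (FreeAlgebra.lift K f) (fun {a b} h => hf a b h)
    (FreeAlgebra.ι K g)).trans (FreeAlgebra.lift_ι_apply f g)

end Presented

/-- The finite Hecke algebra. -/
abbrev Hecke (n : ℕ) : Type :=
  Presented (Fin (n - 1)) (HeckeRel (n := n) (FreeAlgebra.ι K))

/-- The positive affine Hecke algebra. -/
abbrev Affine (n : ℕ) : Type :=
  Presented (AffineGen n) (AffineRel (n := n) (fun i => FreeAlgebra.ι K (AffineGen.T i))
    (fun i => FreeAlgebra.ι K (AffineGen.θ i)))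

/-- The positive double affine Hecke algebra. -/
abbrev Daha (n : ℕ) : Type :=
  Presented (DahaGen n) (DahaRel (n := n) (fun i => FreeAlgebra.ι K (DahaGen.T i))
    (fun i => FreeAlgebra.ι K (DahaGen.θ i)) (fun i => FreeAlgebra.ι K (DahaGen.X i)))

def Hecke.T {n : ℕ} (i : Fin (n - 1)) : Hecke n := Presented.gen _ i

def Affine.T {n : ℕ} (i : Fin (n - 1)) : Affine n := Presented.gen _ (AffineGen.T i)

def Affine.θ {n : ℕ} (i : Fin n) : Affine n := Presented.gen _ (AffineGen.θ i)

def Daha.T {n : ℕ} (i : Fin (n - 1)) : Daha n := Presented.gen _ (DahaGen.T i)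

def Daha.θ {n : ℕ} (i : Fin n) : Daha n := Presented.gen _ (DahaGen.θ i)

def Daha.X {n : ℕ} (i : Fin n) : Daha n := Presented.gen _ (DahaGen.X i)

/-- The element `π_n` of the double affine Hecke algebra. -/
def Daha.pi {n : ℕ} (hn : 0 < n) : Daha n := piElt Daha.T Daha.θ hn

/-- The element `t T_i⁻¹` of the double affine Hecke algebra. -/
def Daha.tTinv {n : ℕ} (i : Fin (n - 1)) : Daha n := VVMac.tTinv Daha.T i

theorem AffineRel.mk_daha {n : ℕ} {a b : FreeAlgebra K (DahaGen n)}
    (h : AffineRel (n := n) (fun i => FreeAlgebra.ι K (DahaGen.T i))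
      (fun i => FreeAlgebra.ι K (DahaGen.θ i)) a b) :
    (Presented.mk _ a : Daha n) = Presented.mk _ b :=
  Presented.mk_rel (DahaRel.affine h)

theorem satHecke_T (n : ℕ) : SatHecke (Hecke.T (n := n)) := by
  have key : ∀ a b, HeckeRel (n := n) (FreeAlgebra.ι K) a b →
      (Presented.mk _ a : Hecke n) = Presented.mk _ b := fun a b h => Presented.mk_rel h
  intro a b h
  cases h with
  | quad i =>
    have := key _ _ (HeckeRel.quad i)
    simp only [map_mul, map_sub, map_add, map_one, map_zero, AlgHom.commutes] at this
    exact this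
  | braid i j h =>
    have := key _ _ (HeckeRel.braid i j h)
    simp only [map_mul] at this
    exact this
  | comm i j h =>
    have := key _ _ (HeckeRel.comm i j h)
    simp only [map_mul] at this
    exact this

/-- `ρ_n : T_i ↦ T_i, θ_i ↦ θ̄_i` -/
def rho (n : ℕ) : Affine n →ₐ[K] Hecke n :=
  Presented.lift (fun g => match g with
    | AffineGen.T i => Hecke.T i
    | AffineGen.θ i => thetaBar Hecke.T i) (by
      intro a b h
      have h' := h.map (FreeAlgebra.lift K (fun g => match g with
        | AffineGen.T i => (Hecke.T i : Hecke n)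
        | AffineGen.θ i => thetaBar Hecke.T i))
      simp only [FreeAlgebra.lift_ι_apply] at h'
      exact affineRel_thetaBar (satHecke_T n) h')

/-- The canonical homomorphism from the affine to the double affine Hecke algebra. -/
def affineToDaha (n : ℕ) : Affine n →ₐ[K] Daha n :=
  Presented.lift (fun g => match g with
    | AffineGen.T i => Daha.T i
    | AffineGen.θ i => Daha.θ i) (by
      intro a b h
      have h' := h.map (FreeAlgebra.lift K (fun g => match g with
        | AffineGen.T i => FreeAlgebra.ι K (DahaGen.T (n := n) i)
        | AffineGen.θ i => FreeAlgebra.ι K (DahaGen.θ i)))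
      simp only [FreeAlgebra.lift_ι_apply] at h'
      have h2 := h'.mk_daha
      have e : ∀ x : FreeAlgebra K (AffineGen n),
          (Presented.mk _ (FreeAlgebra.lift K (fun g => match g with
            | AffineGen.T i => FreeAlgebra.ι K (DahaGen.T (n := n) i)
            | AffineGen.θ i => FreeAlgebra.ι K (DahaGen.θ i)) x) : Daha n) =
          FreeAlgebra.lift K (fun g => match g with
            | AffineGen.T i => (Daha.T i : Daha n)
            | AffineGen.θ i => Daha.θ i) x := by
        intro x
        rw [← AlgHom.comp_apply]
        refine DFunLike.congr_fun (FreeAlgebra.hom_ext ?_) x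
        funext g
        cases g <;>
          simp only [Function.comp_apply, AlgHom.comp_apply, FreeAlgebra.lift_ι_apply] <;> rfl
      rw [e, e] at h2
      exact h2)

theorem rho_T {n : ℕ} (i : Fin (n - 1)) : rho n (Affine.T i) = Hecke.T i :=
  Presented.lift_gen _ _ _

theorem rho_θ {n : ℕ} (i : Fin n) : rho n (Affine.θ i) = thetaBar Hecke.T i :=
  Presented.lift_gen _ _ _

theorem affineToDaha_T {n : ℕ} (i : Fin (n - 1)) : affineToDaha n (Affine.T i) = Daha.T i :=
  Presented.lift_gen _ _ _

theorem affineToDaha_θ {n : ℕ} (i : Fin n) : affineToDaha n (Affine.θ i) = Daha.θ i :=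
  Presented.lift_gen _ _ _

/-! ### The modules -/

section Specht

variable (n : ℕ) (μ : YoungDiagram)

variable {n μ} in
/-- The generator of the free Hecke module on `SYT(μ)` given by `τ`. -/
def basisVec (τ : SYT n μ) : SYT n μ →₀ Hecke n := Finsupp.single τ 1

/-- The relations of the Hecke module attached to `μ`, in the free module on `SYT(μ)`; every
listed element is set to zero. -/
inductive SpechtRel : (SYT n μ →₀ Hecke n) → Prop
  | theta (i : Fin n) (τ : SYT n μ) :
      SpechtRel (thetaBar Hecke.T i • basisVec τ
        - (t ^ τ.toPSYT.c i) • basisVec τ)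
  | phi (i : Fin (n - 1)) (τ σ : SYT n μ) (h : PSYT.IsSwap i τ.toPSYT σ.toPSYT)
      (hlt : PSYT.Lt τ.toPSYT σ.toPSYT) :
      SpechtRel (phiBar Hecke.T i • basisVec τ
        - (t ^ τ.toPSYT.c (lo i) - t ^ τ.toPSYT.c (hi i)) • basisVec σ)
  | row (i : Fin (n - 1)) (τ : SYT n μ)
      (h : (τ.toPSYT.box (lo i)).1.1 = (τ.toPSYT.box (hi i)).1.1) :
      SpechtRel (Hecke.T i • basisVec τ - basisVec τ)
  | col (i : Fin (n - 1)) (τ : SYT n μ)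
      (h : (τ.toPSYT.box (lo i)).1.2 = (τ.toPSYT.box (hi i)).1.2) :
      SpechtRel (Hecke.T i • basisVec τ + t • basisVec τ)

/-- The Hecke module `μ`: generated by `SYT(μ)` subject to `SpechtRel`. -/
abbrev Specht : Type :=
  (SYT n μ →₀ Hecke n) ⧸ Submodule.span (Hecke n) {x | SpechtRel n μ x}

/-- The class of a standard tableau in `Specht`. -/
def Specht.of {n : ℕ} {μ : YoungDiagram} (τ : SYT n μ) : Specht n μ :=
  Submodule.Quotient.mk (basisVec τ)

end Specht

section Induction

variable {A H B : Type} [Ring A] [Algebra K A] [Ring H] [Algebra K H] [Ring B] [Algebra K B]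

/-- For algebra maps `f : A → B` and `g : A → H` and an `H`-module `M`, this is
`B ⊗_A g^*(M) = Ind_A^B g^*(M)`, as the quotient of `B ⊗_K M` by the `B`-submodule generated by
the elements `b f(a) ⊗ m - b ⊗ g(a) m`. -/
abbrev IndPullback (f : A →ₐ[K] B) (g : A →ₐ[K] H) (M : Type) [AddCommGroup M] [Module K M]
    [Module H M] [IsScalarTower K H M] : Type :=
  TensorProduct K B M ⧸ Submodule.span B
    {x : TensorProduct K B M | ∃ (b : B) (a : A) (m : M),
      x = TensorProduct.tmul K (b * f a) m - TensorProduct.tmul K b (g a • m)}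

end Induction

/-- `V_μ = Ind (ρ_n^* μ)`, a module over the double affine Hecke algebra. -/
abbrev V (n : ℕ) (μ : YoungDiagram) : Type :=
  IndPullback (affineToDaha n) (rho n) (Specht n μ)

/-- The vector `1 ⊗ τ` of `V_μ`. -/
def oneTmul {n : ℕ} {μ : YoungDiagram} (τ : SYT n μ) : V n μ :=
  Submodule.Quotient.mk (TensorProduct.tmul K (1 : Daha n) (Specht.of τ))

end

end VVMac

/-! The induced module is compared with an explicit model: the vector space with basis `PSYT n μ`,
on which the double affine Hecke algebra acts by seminormal formulas. There θ_k is diagonal with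
eigenvalue q^{w(k)} t^{c(k)}. T_i acts on the pair τ, s_i(τ) by a 2×2 matrix of trace 1 - t and
determinant -t whose diagonal entries are forced by the θ-weights; the off-diagonal entries are
normalized so that the entry along an ascent τ < s_i(τ) is 1. An operator Y sends τ to q^{-w(1)}
Ψ(τ) and is to become X_n π_n⁻¹. In the model all the asserted formulas hold by construction, so the
content of the theorem is that the model is a module and that it is isomorphic to V.

The model is a module. The affine relations reduce to identities between rational functions of two
or three weights (`seminormal_braid`, `Model.T_θ_T`), valid because the weights involved are
distinct. The X-relations are not checked on vectors: any Y which rotates the θ's and the T's and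
satisfies T_{n-1} Y² = Y² T_1 yields X_n = Y π and, by descending recursion, X_1, …, X_{n-1}, and
all remaining relations follow formally (`ShiftData.dahaRel`).

The model is V. On the span of standard tableaux the model satisfies the relations of the Hecke
module, and θ_k acts there as θ̄_k (`Model.thetaBarAux_apply`), so the universal property of
induction gives an equivariant map Φ from V to the model. Filter V by degree in the X's. The step of
degree d is spanned by the monomials X^s ⊗ τ with |s| ≤ d and τ standard (`V.exists_mem_filt` shows
that these exhaust V), and such pairs inject into the periodic tableaux of total exponent at most d
(`SYT.inflate`). Conversely every basis vector of total exponent at most d is the image of an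
element of that step (`Model.vec_mem_map`). Counting dimensions makes Φ bijective; no prior
knowledge of the dimension of the Hecke module, nor a PBW theorem, enters. -/

namespace VVMac

noncomputable section

/-! ### Affine Hecke relations and the rotation element π -/

section LocalAlgebra

variable {A : Type} [Ring A] [Algebra K A]

/-- Affine Hecke generators indexed by natural numbers: `T k`, with inverse `R k`, for `k < N`,
and `θ k` for `k ≤ N`. -/
structure AffineData (A : Type) [Ring A] [Algebra K A] (N : ℕ) where
  T : ℕ → A
  R : ℕ → A
  θ : ℕ → A
  T_R : ∀ k < N, T k * R k = 1
  R_T : ∀ k < N, R k * T k = 1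
  braid : ∀ k, k + 1 < N → T k * T (k + 1) * T k = T (k + 1) * T k * T (k + 1)
  comm : ∀ j k, j + 1 < k → k < N → Commute (T j) (T k)
  theta_comm : ∀ j k, j ≤ N → k ≤ N → Commute (θ j) (θ k)
  theta_succ : ∀ k < N, θ (k + 1) = t • (R k * θ k * R k)
  T_theta : ∀ k j, k < N → j ≤ N → j ≠ k → j ≠ k + 1 → Commute (T k) (θ j)

theorem Commute.of_inverse {A : Type} [Ring A] {a r s : A} (h : Commute a s) (h₁ : s * r = 1) (h₂ : r * s = 1) :
    Commute a r := by
  have : (⟨s, r, h₁, h₂⟩ : Aˣ)⁻¹.val = r := rfl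
  rw [← this]
  exact (show Commute a (⟨s, r, h₁, h₂⟩ : Aˣ).val from h).units_inv_right

namespace AffineData

variable {N : ℕ} (D : AffineData A N)

theorem comm_R {a : A} {k : ℕ} (hk : k < N) (h : Commute a (D.T k)) : Commute a (D.R k) :=
  Commute.of_inverse h (D.T_R k hk) (D.R_T k hk)

/-- `R_a R_{a+1} ⋯ R_{a+m-1}` -/
def seg (a : ℕ) : ℕ → A
  | 0 => 1
  | m + 1 => seg a m * D.R (a + m)

/-- `T_k T_{k+1} ⋯ T_{k+m-1}` -/
def segT (a : ℕ) : ℕ → A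
  | 0 => 1
  | m + 1 => D.T a * segT (a + 1) m

theorem seg_succ' (a m : ℕ) : D.seg a (m + 1) = D.R a * D.seg (a + 1) m := by
  induction m with
  | zero => simp [seg]
  | succ m ih =>
    rw [seg, ih, seg, mul_assoc]
    congr 3
    omega

theorem commute_seg {x : A} (a m : ℕ) (h : ∀ k, a ≤ k → k < a + m → Commute x (D.R k)) :
    Commute x (D.seg a m) := by
  induction m with
  | zero => exact Commute.one_right x
  | succ m ih =>
    exact (ih fun k h1 h2 => h k h1 (by omega)).mul_right (h _ (by omega) (by omega))

theorem T_succ_R_R (i : ℕ) (hi : i + 1 < N) :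
    D.T (i + 1) * D.R i * D.R (i + 1) = D.R i * D.R (i + 1) * D.T i := by
  have hb := D.braid i hi
  have h1 := D.T_R i (by omega)
  have h2 := D.R_T i (by omega)
  have h3 := D.T_R (i + 1) hi
  have h4 := D.R_T (i + 1) hi
  generalize D.T (i + 1) = b at *
  generalize D.R (i + 1) = b' at *
  generalize D.T i = a at *
  generalize D.R i = a' at *
  calc b * a' * b' = a' * b' * (b * a * b) * (a' * b') := by
        rw [← mul_assoc (a' * b'), ← mul_assoc (a' * b'), mul_assoc a' b' b, h4, mul_one, h2, one_mul,
          mul_assoc]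
    _ = a' * b' * a * (b * (a * a') * b') := by rw [← hb]; simp only [mul_assoc]
    _ = a' * b' * a := by rw [h1, mul_one, h3, mul_one]

/-- Only the two neighbouring factors R_i R_{i+1} fail to commute past; there the braid relation
lowers the index of T by one, and all other factors commute with whichever T is passing. -/
theorem T_seg (a m i : ℕ) (ha : a ≤ i) (hi : i + 1 < a + m) (hm : a + m ≤ N) :
    D.T (i + 1) * D.seg a m = D.seg a m * D.T i := by
  induction m with
  | zero => omega
  | succ m ih =>
    rcases Nat.lt_or_ge (i + 1) (a + m) with h | h
    · have hc : Commute (D.T i) (D.R (a + m)) :=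
        D.comm_R (by omega) (D.comm _ _ (by omega) (by omega))
      rw [seg, ← mul_assoc, ih h (by omega), mul_assoc, hc.eq, mul_assoc]
    · obtain ⟨m, rfl⟩ : ∃ m', m = m' + 1 := ⟨m - 1, by omega⟩
      obtain rfl : i = a + m := by omega
      have hc : Commute (D.T (a + m + 1)) (D.seg a m) :=
        D.commute_seg a m fun k h1 h2 => D.comm_R (by omega) (D.comm _ _ (by omega) (by omega)).symm
      rw [seg, seg, ← mul_assoc, ← mul_assoc, hc.eq]
      simp only [mul_assoc]
      congr 1
      simpa only [mul_assoc, add_assoc] using D.T_succ_R_R (a + m) (by omega)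

/-- `π = t^N θ_0 R_0 ⋯ R_{N-1}` -/
def pi : A := t ^ N • (D.θ 0 * D.seg 0 N)

theorem T_theta_succ (k : ℕ) (hk : k < N) : D.T k * D.θ (k + 1) = t • (D.θ k * D.R k) := by
  rw [D.theta_succ k hk, mul_smul_comm, ← mul_assoc, ← mul_assoc, D.T_R k hk, one_mul]

/-- T_{i+1} commutes with θ_0, so `T_seg` lifts to π: conjugation by π rotates the Dynkin diagram by
one step. -/
theorem pi_T (i : ℕ) (hi : i + 1 < N) : D.pi * D.T i = D.T (i + 1) * D.pi := by
  have h := D.T_theta (i + 1) 0 hi (by omega) (by omega) (by omega)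
  rw [pi, smul_mul_assoc, mul_smul_comm, mul_assoc, ← D.T_seg 0 N i (by omega) (by omega) (by omega),
    ← mul_assoc, ← mul_assoc, h.eq]

theorem pi_seg (a m : ℕ) (h : a + m < N) : D.pi * D.seg a m = D.seg (a + 1) m * D.pi := by
  induction m with
  | zero => simp [seg]
  | succ m ih =>
    have e : D.pi * D.R (a + m) = D.R (a + m + 1) * D.pi := by
      calc D.pi * D.R (a + m) = D.R (a + m + 1) * (D.T (a + m + 1) * D.pi) * D.R (a + m) := by
            rw [← mul_assoc, D.R_T _ (by omega), one_mul]
        _ = D.R (a + m + 1) * D.pi := by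
            rw [← D.pi_T _ (by omega), mul_assoc, mul_assoc, D.T_R _ (by omega), mul_one]
    rw [seg, ← mul_assoc, ih (by omega), mul_assoc, e, seg, mul_assoc, show a + 1 + m = a + m + 1 by omega]

/-- `π θ_0 = T_0 θ_0 R_0 π` -/
theorem pi_theta_zero (hN : 0 < N) : D.pi * D.θ 0 = D.T 0 * D.θ 0 * D.R 0 * D.pi := by
  obtain ⟨M, rfl⟩ : ∃ M, N = M + 1 := ⟨N - 1, by omega⟩
  have hc : Commute (D.θ 0) (D.seg 1 M) := D.commute_seg 1 M fun k h1 h2 =>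
    D.comm_R (by omega) (D.T_theta _ _ (by omega) (by omega) (by omega) (by omega)).symm
  have h01 := D.theta_comm 0 1 (by omega) (by omega)
  have hs := D.theta_succ 0 (by omega)
  have h1 := D.T_R 0 (by omega)
  have h2 := D.R_T 0 (by omega)
  rw [pi, seg_succ', smul_mul_assoc, mul_smul_comm, mul_assoc, mul_assoc, ← hc.eq]
  congr 1
  simp only [zero_add] at *
  -- This is the commutation of θ_0 with θ_1 = t R_0 θ_0 R_0, with θ_1 eliminated.
  have key : D.θ 0 * D.R 0 * D.θ 0 = D.T 0 * D.θ 0 * D.R 0 * D.θ 0 * D.R 0 := by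
    have e1 : D.θ 1 * D.T 0 = t • (D.R 0 * D.θ 0) := by
      rw [hs, smul_mul_assoc, mul_assoc, h2, mul_one]
    have e2 := D.T_theta_succ 0 (by omega)
    have e3 : D.R 0 * D.θ 0 * D.R 0 = t⁻¹ • D.θ 1 := by
      rw [hs, smul_smul, inv_mul_cancel₀ t_ne_zero, one_smul]
    calc D.θ 0 * D.R 0 * D.θ 0 = t⁻¹ • ((t • (D.θ 0 * D.R 0)) * D.θ 0) := by
          rw [smul_mul_assoc, smul_smul, inv_mul_cancel₀ t_ne_zero, one_smul]
      _ = t⁻¹ • (D.T 0 * (D.θ 1 * D.θ 0)) := by rw [← e2, mul_assoc]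
      _ = D.T 0 * D.θ 0 * (D.R 0 * D.θ 0 * D.R 0) := by
          rw [← h01.eq, e3, mul_smul_comm, mul_assoc]
      _ = _ := by simp only [mul_assoc]
  calc _ = (D.θ 0 * D.R 0 * D.θ 0) * D.seg 1 M := by simp only [mul_assoc]
    _ = _ := by rw [key]; simp only [mul_assoc]

/-- `π² T_{N-1} = T_0 π²` -/
theorem pi_pi_T (M : ℕ) (hM : N = M + 1) : D.pi * D.pi * D.T M = D.T 0 * D.pi * D.pi := by
  subst hM
  -- T_M cancels the last factor of π. Moving the other π through the shortened product raises its
  -- indices, and `pi_theta_zero` supplies the T_0 that closes the cycle.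
  have e1 : D.pi * D.T M = t ^ (M + 1) • (D.θ 0 * D.seg 0 M) := by
    rw [pi, smul_mul_assoc, seg, zero_add, mul_assoc, mul_assoc, D.R_T M (by omega), mul_one]
  have e2 : D.pi = t ^ (M + 1) • (D.θ 0 * D.R 0 * D.seg 1 M) := by
    rw [pi, seg_succ', mul_assoc]
  calc D.pi * D.pi * D.T M = t ^ (M + 1) • (D.pi * D.θ 0 * D.seg 0 M) := by
        rw [mul_assoc, e1, mul_smul_comm, mul_assoc]
    _ = t ^ (M + 1) • (D.T 0 * D.θ 0 * D.R 0 * (D.seg 1 M * D.pi)) := by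
        rw [D.pi_theta_zero (by omega), ← D.pi_seg 0 M (by omega), mul_assoc]
    _ = D.T 0 * (t ^ (M + 1) • (D.θ 0 * D.R 0 * D.seg 1 M)) * D.pi := by
        simp only [mul_smul_comm, smul_mul_assoc, mul_assoc]
    _ = _ := by rw [← e2]

/-- Each T_k θ_{k+1} turns into t θ_k R_k, so the product telescopes. For k = 0 and m = N the
right-hand side is π, which gives the second expression T_0 ⋯ T_{N-1} θ_N for it. -/
theorem segT_theta (k m : ℕ) (h : k + m ≤ N) :
    D.segT k m * D.θ (k + m) = t ^ m • (D.θ k * D.seg k m) := by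
  induction m generalizing k with
  | zero => simp [seg, segT]
  | succ m ih =>
    have := ih (k + 1) (by omega)
    rw [show k + (m + 1) = k + 1 + m by omega, segT, mul_assoc, this, mul_smul_comm, ← mul_assoc,
      D.T_theta_succ k (by omega), smul_mul_assoc, smul_smul, seg_succ', pow_succ, mul_assoc]

end AffineData

/-! ### The elements X_k built from a shift operator Y -/

/-- A lift of `q^{-w} Ψ`. -/
structure ShiftData {N : ℕ} (D : AffineData A N) where
  Y : A
  Y_theta : ∀ k < N, Y * D.θ (k + 1) = D.θ k * Y
  theta_Y : D.θ N * Y = q • (Y * D.θ 0)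
  Y_T : ∀ k, k + 1 < N → Y * D.T (k + 1) = D.T k * Y
  T_Y_Y : ∀ M, N = M + 1 → D.T M * (Y * Y) = Y * Y * D.T 0
  theta_unit : IsUnit (D.θ 0)

namespace ShiftData

variable {N : ℕ} {D : AffineData A N} (E : ShiftData D)

/-- `XX m = X_{N-m}` -/
def XX : ℕ → A
  | 0 => E.Y * D.pi
  | m + 1 => t⁻¹ • (D.T (N - (m + 1)) * XX m * D.T (N - (m + 1)))

/-- The elements `X_k`, `k ≤ N`, with `X_N = Y π` and `X_k = t⁻¹ T_k X_{k+1} T_k`. -/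
def X (k : ℕ) : A := E.XX (N - k)

theorem X_last : E.X N = E.Y * D.pi := by
  rw [X, Nat.sub_self, XX]

theorem X_eq (k : ℕ) (hk : k < N) : E.X k = t⁻¹ • (D.T k * E.X (k + 1) * D.T k) := by
  rw [X, X, show N - k = N - (k + 1) + 1 by omega, XX, show N - (N - (k + 1) + 1) = k by omega]

/-- Downward induction along the `X_k`. -/
theorem down_induction {P : ℕ → Prop} (h0 : P N) (h : ∀ k < N, P (k + 1) → P k) (k : ℕ)
    (hk : k ≤ N) : P k := by
  induction hk using Nat.decreasingInduction with
  | self => exact h0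
  | of_succ k hk ih => exact h k hk ih

theorem Y_seg (a m : ℕ) (h : a + 1 + m ≤ N) : E.Y * D.seg (a + 1) m = D.seg a m * E.Y := by
  induction m with
  | zero => simp [AffineData.seg]
  | succ m ih =>
    have e : E.Y * D.R (a + m + 1) = D.R (a + m) * E.Y := by
      calc E.Y * D.R (a + m + 1) = D.R (a + m) * (D.T (a + m) * E.Y) * D.R (a + m + 1) := by
            rw [← mul_assoc, D.R_T _ (by omega), one_mul]
        _ = D.R (a + m) * E.Y := by
            rw [← E.Y_T _ (by omega), mul_assoc, mul_assoc, D.T_R _ (by omega), mul_one]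
    rw [AffineData.seg, ← mul_assoc, ih (by omega), AffineData.seg, mul_assoc, mul_assoc, ← e,
      show a + 1 + m = a + m + 1 by omega]

/-- π raises the index of T_i by one and Y lowers it again. -/
theorem commute_T_X_last (i : ℕ) (hi : i + 1 < N) : Commute (D.T i) (E.X N) := by
  rw [X_last]
  change D.T i * (E.Y * D.pi) = E.Y * D.pi * D.T i
  rw [mul_assoc, D.pi_T i hi, ← mul_assoc, ← mul_assoc, E.Y_T i hi]

theorem commute_T_X_of_lt (i k : ℕ) (hk : k ≤ N) (h : i + 1 < k) : Commute (D.T i) (E.X k) := by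
  revert h
  refine down_induction (P := fun k => i + 1 < k → Commute (D.T i) (E.X k))
    (fun h => E.commute_T_X_last i h) (fun k hk ih h => ?_) k hk
  have h1 : Commute (D.T i) (D.T k) := D.comm _ _ h hk
  rw [E.X_eq k hk]
  exact ((h1.mul_right (ih (by omega))).mul_right h1).smul_right _

theorem commute_T_X_of_gt (i k : ℕ) (hi : i < N) (h : k < i) : Commute (D.T i) (E.X k) := by
  have hk : k ≤ N := by omega
  revert h
  refine down_induction (P := fun k => k < i → Commute (D.T i) (E.X k))
    (fun h => by omega) (fun k hk ih h => ?_) k hk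
  rcases Nat.lt_or_ge (k + 1) i with h' | h'
  · have h1 : Commute (D.T i) (D.T k) := (D.comm _ _ h' hi).symm
    rw [E.X_eq k hk]
    exact ((h1.mul_right (ih (by omega))).mul_right h1).smul_right _
  -- For i = k + 1 the element T_{k+1} does not commute with T_k; unfolding X_k twice, the braid
  -- relation turns it into T_k, which commutes with X_{k+2} and is turned back on the other side.
  · obtain rfl : i = k + 1 := by omega
    have hc := E.commute_T_X_of_lt k (k + 2) (by omega) (by omega)
    have hb := D.braid k hi
    rw [E.X_eq k hk, E.X_eq (k + 1) hi]
    simp only [mul_smul_comm, smul_mul_assoc]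
    refine Commute.smul_right (Commute.smul_right ?_ _) _
    change D.T (k + 1) * _ = _ * D.T (k + 1)
    generalize D.T (k + 1) = b at *
    generalize D.T k = a at *
    generalize E.X (k + 1 + 1) = x at *
    calc b * (a * (b * x * b) * a) = (b * a * b) * x * (b * a) := by simp only [mul_assoc]
      _ = a * b * (a * x) * (b * a) := by rw [← hb]; simp only [mul_assoc]
      _ = a * b * x * (a * b * a) := by rw [hc.eq]; simp only [mul_assoc]
      _ = _ := by rw [hb]; simp only [mul_assoc]

/-- `π T_{N-1} Y = t Y R_0 π` -/
theorem pi_T_Y (M : ℕ) (hM : N = M + 1) :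
    D.pi * D.T M * E.Y = t • (E.Y * D.R 0 * D.pi) := by
  subst hM
  have e1 : D.pi * D.T M = t ^ (M + 1) • (D.θ 0 * D.seg 0 M) := by
    rw [AffineData.pi, smul_mul_assoc, AffineData.seg, zero_add, mul_assoc, mul_assoc,
      D.R_T M (by omega), mul_one]
  have e2 : D.pi = t ^ (M + 1) • (D.θ 0 * D.R 0 * D.seg 1 M) := by
    rw [AffineData.pi, D.seg_succ', mul_assoc]
  have hs := D.theta_succ 0 (by omega)
  rw [zero_add] at hs
  calc D.pi * D.T M * E.Y = t ^ (M + 1) • (D.θ 0 * (D.seg 0 M * E.Y)) := by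
        rw [e1, smul_mul_assoc, mul_assoc]
    -- Pulling Y to the left raises all indices, and the resulting θ_1 = t R_0 θ_0 R_0 reassembles
    -- π.
    _ = t ^ (M + 1) • (E.Y * D.θ 1 * D.seg 1 M) := by
        rw [← E.Y_seg 0 M (by omega), ← mul_assoc, ← E.Y_theta 0 (by omega)]
    _ = t • (E.Y * D.R 0 * t ^ (M + 1) • (D.θ 0 * D.R 0 * D.seg 1 M)) := by
        rw [hs]
        simp only [mul_smul_comm, smul_mul_assoc, mul_assoc, smul_comm t]
    _ = _ := by rw [← e2]

/-- The recursion for X_{N-1} involves T_{N-1}, which π alone does not rotate to another T. Instead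
`pi_T_Y` extracts R_0 and `pi_pi_T` extracts T_0, and the two cancel. -/
theorem pi_X_last_pred (M : ℕ) (hM : N = M + 1) : D.pi * E.X M = E.X N * D.pi := by
  have h := E.pi_T_Y M hM
  have h2 := D.pi_pi_T M hM
  have h3 := D.R_T 0 (by omega)
  rw [E.X_eq M (by omega), ← hM, X_last]
  calc D.pi * t⁻¹ • (D.T M * (E.Y * D.pi) * D.T M)
      = t⁻¹ • ((D.pi * D.T M * E.Y) * (D.pi * D.T M)) := by
        simp only [mul_smul_comm, mul_assoc]
    _ = E.Y * D.R 0 * (D.pi * D.pi * D.T M) := by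
        rw [h, smul_mul_assoc, smul_smul, inv_mul_cancel₀ t_ne_zero, one_smul]
        simp only [mul_assoc]
    _ = E.Y * (D.R 0 * D.T 0) * (D.pi * D.pi) := by rw [h2]; simp only [mul_assoc]
    _ = _ := by rw [h3, mul_one]; simp only [mul_assoc]

theorem pi_X (k : ℕ) (hk : k < N) : D.pi * E.X k = E.X (k + 1) * D.pi := by
  suffices h : ∀ k ≤ N, k < N → D.pi * E.X k = E.X (k + 1) * D.pi from h k hk.le hk
  intro k hk
  refine down_induction (P := fun k => k < N → D.pi * E.X k = E.X (k + 1) * D.pi)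
    (fun h => by omega) (fun k hk ih _ => ?_) k hk
  rcases Nat.lt_or_ge (k + 1) N with h | h
  · have h1 := D.pi_T k h
    calc D.pi * E.X k = t⁻¹ • (D.pi * D.T k * E.X (k + 1) * D.T k) := by
          rw [E.X_eq k hk]; simp only [mul_smul_comm, mul_assoc]
      _ = t⁻¹ • (D.T (k + 1) * (D.pi * E.X (k + 1)) * D.T k) := by
          rw [h1]; simp only [mul_assoc]
      _ = t⁻¹ • (D.T (k + 1) * E.X (k + 1 + 1) * (D.pi * D.T k)) := by
          rw [ih h]; simp only [mul_assoc]
      _ = _ := by rw [h1, E.X_eq (k + 1) h]; simp only [smul_mul_assoc, mul_assoc]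
  · obtain rfl : N = k + 1 := by omega
    exact E.pi_X_last_pred k rfl

/-- In the step X_k = t⁻¹ T_k X_{k+1} T_k, the right-hand T_k cancels the last factor R_k of the
segment while the left-hand one lengthens the product of T's. -/
theorem X_formula (k : ℕ) (hk : k ≤ N) :
    E.X k = t ^ k • (D.segT k (N - k) * E.Y * D.θ 0 * D.seg 0 k) := by
  refine down_induction
    (P := fun k => E.X k = t ^ k • (D.segT k (N - k) * E.Y * D.θ 0 * D.seg 0 k))
    ?_ (fun k hk ih => ?_) k hk
  · rw [X_last, Nat.sub_self, AffineData.segT, one_mul, AffineData.pi, mul_smul_comm, mul_assoc]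
  · rw [E.X_eq k hk, ih, show N - k = N - (k + 1) + 1 by omega, AffineData.segT, AffineData.seg,
      zero_add]
    simp only [mul_smul_comm, smul_mul_assoc, mul_assoc, D.R_T k hk, mul_one, smul_smul]
    congr 1
    rw [pow_succ, mul_comm, mul_assoc, mul_inv_cancel₀ t_ne_zero, mul_one]

theorem X_zero : E.X 0 = D.segT 0 N * E.Y * D.θ 0 := by
  simpa [AffineData.seg] using E.X_formula 0 (Nat.zero_le _)

/-- Write the first π as T_0 ⋯ T_{N-1} θ_N and move θ_N through Y; this is where q enters, and the
result is X_0 by `X_zero`. -/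
theorem pi_X_last : D.pi * E.X N = q • (E.X 0 * D.pi) := by
  have h := D.segT_theta 0 N (by omega)
  rw [zero_add] at h
  rw [X_zero, X_last, ← smul_mul_assoc, ← mul_assoc, mul_assoc (D.segT 0 N), ← mul_smul_comm,
    ← E.theta_Y, ← mul_assoc, h, AffineData.pi]

theorem isUnit_pi (E : ShiftData D) : IsUnit D.pi := by
  have h : ∀ m ≤ N, IsUnit (D.seg 0 m) := by
    intro m
    induction m with
    | zero => intro _; exact isUnit_one
    | succ m ih =>
      intro hm
      refine (ih (by omega)).mul ?_
      rw [zero_add]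
      exact ⟨⟨D.R m, D.T m, D.R_T m (by omega), D.T_R m (by omega)⟩, rfl⟩
  rw [AffineData.pi]
  exact (E.theta_unit.mul (h N le_rfl)).smul (Units.mk0 _ (pow_ne_zero N t_ne_zero))

/-- For k < N - 1 the commutation propagates down the recursion because T_k commutes with X_N. For k
= N - 1 it amounts to the relation `T_Y_Y`. -/
theorem commute_X_last (k : ℕ) (hk : k < N) : Commute (E.X k) (E.X N) := by
  suffices h : ∀ k ≤ N, k < N → Commute (E.X k) (E.X N) from h k hk.le hk
  intro k hk
  refine down_induction (P := fun k => k < N → Commute (E.X k) (E.X N))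
    (fun h => by omega) (fun k hk ih _ => ?_) k hk
  rcases Nat.lt_or_ge (k + 1) N with h | h
  · have h1 := E.commute_T_X_last k h
    rw [E.X_eq k hk]
    exact ((h1.mul_left (ih h)).mul_left h1).smul_left _
  · obtain rfl : N = k + 1 := by omega
    have h1 := E.pi_T_Y k rfl
    have h2 := E.T_Y_Y k rfl
    change E.X k * E.X (k + 1) = E.X (k + 1) * E.X k
    have e1 : E.X (k + 1) * E.X k = E.Y * E.Y * D.pi * D.pi := by
      conv_lhs => rw [X_last, mul_assoc, E.pi_X k hk, X_last]
      simp only [mul_assoc]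
    rw [e1, E.X_eq k hk, X_last]
    calc t⁻¹ • (D.T k * (E.Y * D.pi) * D.T k) * (E.Y * D.pi)
        = t⁻¹ • (D.T k * E.Y * (D.pi * D.T k * E.Y) * D.pi) := by
          simp only [smul_mul_assoc, mul_assoc]
      _ = D.T k * (E.Y * E.Y) * D.R 0 * D.pi * D.pi := by
          rw [h1, mul_smul_comm, smul_mul_assoc, smul_smul, inv_mul_cancel₀ t_ne_zero, one_smul]
          simp only [mul_assoc]
      _ = _ := by rw [h2, mul_assoc (E.Y * E.Y), D.T_R 0 (by omega), mul_one]

/-- Conjugation by the invertible element π raises both indices, so the claim reduces to the case in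
which the larger index is N. -/
theorem commute_X_of_lt (j k : ℕ) (hk : k ≤ N) (h : j < k) : Commute (E.X j) (E.X k) := by
  revert j
  refine down_induction (P := fun k => ∀ j < k, Commute (E.X j) (E.X k))
    (fun j h => E.commute_X_last j h) (fun k hk ih j h => ?_) k hk
  have h1 := ih (j + 1) (by omega)
  have h2 := E.pi_X k hk
  have h3 := E.pi_X j (by omega)
  refine E.isUnit_pi.mul_left_cancel ?_
  rw [← mul_assoc, h3, mul_assoc, h2, ← mul_assoc, h1.eq, mul_assoc, ← h3, ← mul_assoc, ← h2,
    mul_assoc]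

end ShiftData

end LocalAlgebra

/-! ### Transport of relations along homomorphisms, and maps out of presented algebras -/

section Transfer

variable {n : ℕ} {A B : Type} [Ring A] [Algebra K A] [Ring B] [Algebra K B]

theorem map_piElt (f : A →ₐ[K] B) (T : Fin (n - 1) → A) (θ : Fin n → A) (hn : 0 < n) :
    f (piElt T θ hn) = piElt (fun j => f (T j)) (fun j => f (θ j)) hn := by
  simp only [piElt, map_smul, map_mul, map_list_prod, List.map_ofFn]
  congr 4
  funext i
  exact map_Tinv f T i

theorem DahaRel.map (f : A →ₐ[K] B) {T : Fin (n - 1) → A} {θ X : Fin n → A} {a b : A}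
    (h : DahaRel T θ X a b) :
    DahaRel (fun j => f (T j)) (fun j => f (θ j)) (fun j => f (X j)) (f a) (f b) := by
  cases h with
  | affine h => exact DahaRel.affine (h.map f)
  | X_comm i j =>
    simpa only [map_mul] using DahaRel.X_comm (T := fun j => f (T j)) (θ := fun j => f (θ j))
      (X := fun j => f (X j)) i j
  | X_succ i =>
    simpa only [map_mul, map_smul, map_Tinv] using
      DahaRel.X_succ (T := fun j => f (T j)) (θ := fun j => f (θ j)) (X := fun j => f (X j)) i
  | T_X i j h h' =>
    simpa only [map_mul] using
      DahaRel.T_X (T := fun j => f (T j)) (θ := fun j => f (θ j)) (X := fun j => f (X j)) i j h h'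
  | pi_X hn i =>
    simpa only [map_mul, map_piElt] using
      DahaRel.pi_X (T := fun j => f (T j)) (θ := fun j => f (θ j)) (X := fun j => f (X j)) hn i
  | pi_X_last hn =>
    simpa only [map_mul, map_smul, map_piElt] using
      DahaRel.pi_X_last (T := fun j => f (T j)) (θ := fun j => f (θ j)) (X := fun j => f (X j)) hn

/-- With f the projection from a free algebra, this turns defining relations between words into
equations between the classes of the generators. -/
theorem HeckeRel.eq_of_map (f : A →ₐ[K] B) {T : Fin (n - 1) → A}
    (H : ∀ a b, HeckeRel T a b → f a = f b) {a b : B}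
    (h : HeckeRel (fun j => f (T j)) a b) : a = b := by
  cases h with
  | quad i =>
    simpa only [map_mul, map_sub, map_add, map_one, map_zero, AlgHom.commutes] using
      H _ _ (HeckeRel.quad i)
  | braid i j h => simpa only [map_mul] using H _ _ (HeckeRel.braid i j h)
  | comm i j h => simpa only [map_mul] using H _ _ (HeckeRel.comm i j h)

theorem AffineRel.eq_of_map (f : A →ₐ[K] B) {T : Fin (n - 1) → A} {θ : Fin n → A}
    (H : ∀ a b, AffineRel T θ a b → f a = f b) {a b : B}
    (h : AffineRel (fun j => f (T j)) (fun j => f (θ j)) a b) : a = b := by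
  cases h with
  | hecke h => exact h.eq_of_map f fun a b h => H a b (.hecke h)
  | theta_comm i j => simpa only [map_mul] using H _ _ (AffineRel.theta_comm i j)
  | theta_succ i => simpa only [map_mul, map_smul, map_Tinv] using H _ _ (AffineRel.theta_succ i)
  | T_theta i j h h' => simpa only [map_mul] using H _ _ (AffineRel.T_theta i j h h')

theorem DahaRel.eq_of_map (f : A →ₐ[K] B) {T : Fin (n - 1) → A} {θ X : Fin n → A}
    (H : ∀ a b, DahaRel T θ X a b → f a = f b) {a b : B}
    (h : DahaRel (fun j => f (T j)) (fun j => f (θ j)) (fun j => f (X j)) a b) : a = b := by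
  cases h with
  | affine h => exact h.eq_of_map f fun a b h => H a b (.affine h)
  | X_comm i j => simpa only [map_mul] using H _ _ (DahaRel.X_comm i j)
  | X_succ i => simpa only [map_mul, map_smul, map_Tinv] using H _ _ (DahaRel.X_succ i)
  | T_X i j h h' => simpa only [map_mul] using H _ _ (DahaRel.T_X i j h h')
  | pi_X hn i => simpa only [map_mul, map_piElt] using H _ _ (DahaRel.pi_X hn i)
  | pi_X_last hn => simpa only [map_mul, map_smul, map_piElt] using H _ _ (DahaRel.pi_X_last hn)

theorem Daha.rel {n : ℕ} {a b : Daha n} (h : DahaRel Daha.T Daha.θ Daha.X a b) : a = b :=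
  DahaRel.eq_of_map (Presented.mk _) (fun _ _ h => Presented.mk_rel h) h

theorem Daha.affineRel {n : ℕ} {a b : Daha n} (h : AffineRel Daha.T Daha.θ a b) : a = b :=
  Daha.rel (.affine h)

theorem Daha.satHecke (n : ℕ) : SatHecke (Daha.T (n := n)) := fun _ _ h => Daha.affineRel (.hecke h)

/-- Homomorphisms out of the double affine Hecke algebra. -/
def Daha.lift (T : Fin (n - 1) → A) (θ X : Fin n → A) (H : ∀ a b, DahaRel T θ X a b → a = b) :
    Daha n →ₐ[K] A :=
  Presented.lift (fun g => match g with
    | DahaGen.T i => T i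
    | DahaGen.θ i => θ i
    | DahaGen.X i => X i) (by
      intro a b h
      have h' := h.map (FreeAlgebra.lift K (fun g => match g with
        | DahaGen.T i => T i
        | DahaGen.θ i => θ i
        | DahaGen.X i => X i))
      simp only [FreeAlgebra.lift_ι_apply] at h'
      exact H _ _ h')

variable {T : Fin (n - 1) → A} {θ X : Fin n → A} (H : ∀ a b, DahaRel T θ X a b → a = b)

theorem Daha.lift_T (i : Fin (n - 1)) : Daha.lift T θ X H (Daha.T i) = T i :=
  Presented.lift_gen _ _ _

theorem Daha.lift_θ (i : Fin n) : Daha.lift T θ X H (Daha.θ i) = θ i :=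
  Presented.lift_gen _ _ _

theorem Daha.lift_X (i : Fin n) : Daha.lift T θ X H (Daha.X i) = X i :=
  Presented.lift_gen _ _ _

/-- Homomorphisms out of the finite Hecke algebra. -/
def Hecke.lift (T : Fin (n - 1) → A) (H : SatHecke T) : Hecke n →ₐ[K] A :=
  Presented.lift T (by
    intro a b h
    have h' := h.map (FreeAlgebra.lift K T)
    simp only [FreeAlgebra.lift_ι_apply] at h'
    exact H _ _ h')

theorem Hecke.lift_T (H : SatHecke T) (i : Fin (n - 1)) : Hecke.lift T H (Hecke.T i) = T i :=
  Presented.lift_gen _ _ _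

/-- Induction principle for presented algebras. -/
theorem Presented.induction {G : Type} {r : FreeAlgebra K G → FreeAlgebra K G → Prop}
    {C : Presented G r → Prop} (halg : ∀ k, C (algebraMap K _ k)) (hgen : ∀ g, C (Presented.gen r g))
    (hmul : ∀ a b, C a → C b → C (a * b)) (hadd : ∀ a b, C a → C b → C (a + b))
    (x : Presented G r) : C x := by
  obtain ⟨x, rfl⟩ := RingQuot.mkAlgHom_surjective K r x
  change C (Presented.mk r x)
  induction x using FreeAlgebra.induction with
  | grade0 k => simpa using halg k
  | grade1 g => exact hgen g
  | mul a b ha hb => rw [map_mul]; exact hmul _ _ ha hb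
  | add a b ha hb => rw [map_add]; exact hadd _ _ ha hb

end Transfer

/-! ### From indices in `Fin n` to indices in `ℕ` -/

section Index

variable {n : ℕ} {A : Type} [Ring A] [Algebra K A]

/-- Extension of a family by zero. -/
def natExt {A : Type} [Ring A] {m : ℕ} (f : Fin m → A) (k : ℕ) : A := if h : k < m then f ⟨k, h⟩ else 0

theorem natExt_of_lt {A : Type} [Ring A] {m : ℕ} (f : Fin m → A) (k : ℕ) (h : k < m) : natExt f k = f ⟨k, h⟩ :=
  dif_pos h

/-- The relations of the affine Hecke algebra with indices in `ℕ`. -/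
def AffineData.ofFin (hn : 0 < n) (T : Fin (n - 1) → A) (θ : Fin n → A)
    (H : ∀ a b, AffineRel T θ a b → a = b) : AffineData A (n - 1) where
  T := natExt T
  R := natExt (Tinv T)
  θ := natExt θ
  T_R k h := by
    rw [natExt_of_lt _ k h, natExt_of_lt _ k h, T_mul_Tinv fun a b h => H a b (.hecke h)]
  R_T k h := by
    rw [natExt_of_lt _ k h, natExt_of_lt _ k h, Tinv_mul_T fun a b h => H a b (.hecke h)]
  braid k h := by
    rw [natExt_of_lt _ k (by omega), natExt_of_lt _ (k + 1) h]
    exact H _ _ (.hecke (.braid _ _ rfl))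
  comm j k h hk := by
    rw [natExt_of_lt _ k hk, natExt_of_lt _ j (by omega)]
    exact H _ _ (.hecke (.comm _ _ (.inl h)))
  theta_comm j k hj hk := by
    rw [natExt_of_lt _ k (by omega), natExt_of_lt _ j (by omega)]
    exact H _ _ (.theta_comm _ _)
  theta_succ k h := by
    rw [natExt_of_lt (Tinv T) k h, natExt_of_lt θ (k + 1) (by omega), natExt_of_lt θ k (by omega)]
    exact H _ _ (.theta_succ ⟨k, h⟩)
  T_theta k j hk hj h h' := by
    rw [natExt_of_lt _ k hk, natExt_of_lt _ j (by omega)]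
    refine H _ _ (.T_theta ⟨k, hk⟩ ⟨j, by omega⟩ (fun e => h ?_) (fun e => h' ?_))
    · exact congrArg Fin.val e
    · exact congrArg Fin.val e

theorem seg_eq_prod {N : ℕ} (D : AffineData A N) (a m : ℕ) :
    D.seg a m = (List.ofFn fun i : Fin m => D.R (a + i.1)).prod := by
  induction m generalizing a with
  | zero => simp [AffineData.seg]
  | succ m ih =>
    rw [D.seg_succ', ih, List.ofFn_succ, List.prod_cons]
    congr 3
    funext i
    simp only [Fin.val_succ, add_assoc, add_comm 1]

theorem AffineData.pi_ofFin (hn : 0 < n) (T : Fin (n - 1) → A) (θ : Fin n → A)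
    (H : ∀ a b, AffineRel T θ a b → a = b) :
    (AffineData.ofFin hn T θ H).pi = piElt T θ hn := by
  rw [AffineData.pi, piElt, seg_eq_prod]
  congr 2
  · exact natExt_of_lt θ 0 hn
  · congr 2
    funext i
    rw [zero_add]
    exact natExt_of_lt _ i.1 i.2

/-- The relations of the double affine Hecke algebra, given the affine ones and a lift of the
cyclic shift. -/
theorem ShiftData.dahaRel (hn : 0 < n) (T : Fin (n - 1) → A) (θ : Fin n → A)
    (H : ∀ a b, AffineRel T θ a b → a = b) (E : ShiftData (AffineData.ofFin hn T θ H)) {a b : A}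
    (h : DahaRel T θ (fun k => E.X k.1) a b) : a = b := by
  have hT : ∀ k (h : k < n - 1), (AffineData.ofFin hn T θ H).T k = T ⟨k, h⟩ :=
    fun k h => natExt_of_lt _ k h
  have hR : ∀ k (h : k < n - 1), (AffineData.ofFin hn T θ H).R k = Tinv T ⟨k, h⟩ :=
    fun k h => natExt_of_lt _ k h
  have hpi := AffineData.pi_ofFin hn T θ H
  cases h with
  | affine h => exact H _ _ h
  | X_comm i j =>
    rcases lt_trichotomy i.1 j.1 with h | h | h
    · exact E.commute_X_of_lt i.1 j.1 (by omega) h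
    · rw [h]
    · exact (E.commute_X_of_lt j.1 i.1 (by omega) h).symm
  | X_succ i =>
    have h1 := E.X_eq i.1 i.2
    have h2 := (AffineData.ofFin hn T θ H).T_R i.1 i.2
    have h3 := (AffineData.ofFin hn T θ H).R_T i.1 i.2
    change E.X (i.1 + 1) = t • (Tinv T i * E.X i.1 * Tinv T i)
    rw [← hR i.1 i.2, h1, mul_smul_comm, smul_mul_assoc, smul_smul, mul_inv_cancel₀ t_ne_zero,
      one_smul]
    simp only [mul_assoc]
    rw [h2, mul_one, ← mul_assoc, h3, one_mul]
  | T_X i j h h' =>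
    rw [← hT i.1 i.2]
    have h1 : j.1 ≠ i.1 := fun e => h (Fin.ext e)
    have h2 : j.1 ≠ i.1 + 1 := fun e => h' (Fin.ext e)
    rcases lt_or_gt_of_ne h1 with h | h
    · exact E.commute_T_X_of_gt i.1 j.1 i.2 h
    · exact E.commute_T_X_of_lt i.1 j.1 (by omega) (by omega)
  | pi_X _ i =>
    rw [← hpi]
    exact E.pi_X i.1 i.2
  | pi_X_last _ =>
    rw [← hpi]
    exact E.pi_X_last

end Index

/-! ### Weights and seminormal coefficients -/

section Scalars

theorem q_pow_mul_t_pow (a b : ℕ) :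
    q ^ a * t ^ b = algebraMap (MvPolynomial (Fin 2) ℚ) K
      (MvPolynomial.monomial (Finsupp.single 0 a + Finsupp.single 1 b) 1) := by
  rw [q, t, ← map_pow, ← map_pow, ← map_mul]
  congr 1
  rw [MvPolynomial.X_pow_eq_monomial, MvPolynomial.X_pow_eq_monomial, MvPolynomial.monomial_mul,
    one_mul]

theorem q_ne_zero : q ≠ 0 := by
  unfold q
  rw [Ne, IsFractionRing.to_map_eq_zero_iff]
  exact MvPolynomial.X_ne_zero 0

/-- The weight `q^w t^c`. -/
def wt (u : ℕ × ℤ) : K := q ^ u.1 * t ^ u.2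

theorem wt_ne_zero (u : ℕ × ℤ) : wt u ≠ 0 :=
  mul_ne_zero (pow_ne_zero _ q_ne_zero) (zpow_ne_zero _ t_ne_zero)

theorem wt_injective : Function.Injective wt := by
  rintro ⟨a, c⟩ ⟨b, d⟩ h
  -- Multiplying by t^m with m = |c| + |d| makes both exponents of t nonnegative, so that monomials
  -- in the polynomial ring can be compared.
  obtain ⟨m, c', d', hc, hd⟩ : ∃ m c' d' : ℕ, c + m = c' ∧ d + m = d' :=
    ⟨c.natAbs + d.natAbs, (c + (c.natAbs + d.natAbs : ℕ)).toNat,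
      (d + (c.natAbs + d.natAbs : ℕ)).toNat, by omega, by omega⟩
  have h2 : q ^ a * t ^ c' = q ^ b * t ^ d' := by
    have e : ∀ (a : ℕ) (c : ℤ) (c' : ℕ), c + m = c' → q ^ a * t ^ c' = wt (a, c) * t ^ m := by
      intro a c c' h
      rw [← zpow_natCast t c', ← h, zpow_add₀ t_ne_zero, zpow_natCast, wt, mul_assoc]
    rw [e a c c' hc, e b d d' hd, h]
  rw [q_pow_mul_t_pow, q_pow_mul_t_pow] at h2
  have h3 := IsFractionRing.injective (MvPolynomial (Fin 2) ℚ) K h2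
  have h4 := MvPolynomial.monomial_left_injective (R := ℚ) one_ne_zero h3
  have h5 := DFunLike.congr_fun h4 0
  have h6 := DFunLike.congr_fun h4 1
  simp at h5 h6
  ext
  · exact h5
  · simp only; omega

theorem wt_succ_snd (w : ℕ) (c : ℤ) : wt (w, c + 1) = t * wt (w, c) := by
  simp only [wt, zpow_add₀ t_ne_zero, zpow_one]
  ring

theorem wt_succ_fst (w : ℕ) (c : ℤ) : wt (w + 1, c) = q * wt (w, c) := by
  simp only [wt, pow_succ]
  ring

theorem t_ne_one : t ≠ 1 := by
  intro h
  have : wt (0, 1) = wt (0, 0) := by simp [wt, h]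
  simpa using wt_injective this

/-- `u` precedes `v` and the two can be interchanged. -/
def Up (u v : ℕ × ℤ) : Prop := u.1 < v.1 ∨ (u.1 = v.1 ∧ 1 < u.2 - v.2)

theorem Up.not_symm {u v : ℕ × ℤ} (h : Up u v) : ¬ Up v u := by
  unfold Up at *
  omega

open Classical in
/-- The off-diagonal coefficient of `T_i`. -/
def offCoeff (u v : ℕ × ℤ) : K :=
  if Up u v then 1
  else if Up v u then (t * wt u - wt v) * (wt u - t * wt v) / (wt u - wt v) ^ 2
  else 0

/-- The diagonal coefficient of `T_i`. -/
def diagCoeff (u v : ℕ × ℤ) : K := (1 - t) * wt u / (wt u - wt v)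

theorem offCoeff_of_up {u v : ℕ × ℤ} (h : Up u v) : offCoeff u v = 1 := if_pos h

theorem offCoeff_of_not {u v : ℕ × ℤ} (h : ¬ Up u v) (h' : ¬ Up v u) : offCoeff u v = 0 := by
  rw [offCoeff, if_neg h, if_neg h']

theorem eq_or_succ_of_not_up {u v : ℕ × ℤ} (h : ¬ Up u v) (h' : ¬ Up v u) :
    u = v ∨ v = (u.1, u.2 + 1) ∨ u = (v.1, v.2 + 1) := by
  unfold Up at *
  simp only [Prod.ext_iff]
  omega

/-- The relations see the off-diagonal entries only through this product, which is independent of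
the choice of normalization. When u and v cannot be interchanged, their weights differ by a factor t
and the right-hand side vanishes by itself. -/
theorem offCoeff_mul {u v : ℕ × ℤ} (h : u ≠ v) :
    offCoeff u v * offCoeff v u =
      (t * wt u - wt v) * (wt u - t * wt v) / (wt u - wt v) ^ 2 := by
  by_cases h1 : Up u v
  · rw [offCoeff_of_up h1, offCoeff, if_neg h1.not_symm, if_pos h1, one_mul]
    rw [← neg_sub (wt u) (wt v), neg_sq]
    ring
  · by_cases h2 : Up v u
    · rw [offCoeff_of_up h2, offCoeff, if_neg h1, if_pos h2, mul_one]
    · rw [offCoeff_of_not h1 h2, zero_mul]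
      rcases eq_or_succ_of_not_up h1 h2 with h' | h' | h'
      · exact absurd h' h
      · rw [h', wt_succ_snd]; simp
      · rw [h', wt_succ_snd]; simp

/-- The trace of T_i on a pair of exchanged vectors: the eigenvalues are 1 and -t. -/
theorem diagCoeff_add {u v : ℕ × ℤ} (h : u ≠ v) : diagCoeff u v + diagCoeff v u = 1 - t := by
  have h1 : wt u - wt v ≠ 0 := sub_ne_zero.2 fun e => h (wt_injective e)
  have h2 : wt v - wt u ≠ 0 := sub_ne_zero.2 fun e => h (wt_injective e).symm
  rw [diagCoeff, diagCoeff]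
  field_simp
  ring

/-- The determinant of the same 2×2 matrix is -t; together with the trace this is the quadratic
relation. -/
theorem diagCoeff_mul_sub {u v : ℕ × ℤ} (h : u ≠ v) :
    diagCoeff u v * diagCoeff v u + t = offCoeff u v * offCoeff v u := by
  have h1 : wt u - wt v ≠ 0 := sub_ne_zero.2 fun e => h (wt_injective e)
  have h2 : wt v - wt u ≠ 0 := sub_ne_zero.2 fun e => h (wt_injective e).symm
  rw [offCoeff_mul h, diagCoeff, diagCoeff]
  field_simp
  ring

end Scalars

/-! ### The braid relation for three distinct weights -/

section LocalBraid

variable {M : Type} [AddCommGroup M] [Module K M]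

/-- The braid relation for operators in seminormal form. -/
theorem seminormal_braid (S T : M →ₗ[K] M) (X Y Z : ℕ × ℤ) (hXY : X ≠ Y) (hXZ : X ≠ Z)
    (hYZ : Y ≠ Z) (v : (ℕ × ℤ) → (ℕ × ℤ) → (ℕ × ℤ) → M)
    (hS : ∀ X Y Z, S (v X Y Z) = diagCoeff X Y • v X Y Z + offCoeff X Y • v Y X Z)
    (hT : ∀ X Y Z, T (v X Y Z) = diagCoeff Y Z • v X Y Z + offCoeff Y Z • v X Z Y) :
    S (T (S (v X Y Z))) = T (S (T (v X Y Z))) := by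
  have e1 := offCoeff_mul hXY
  have e2 := offCoeff_mul hXZ
  have e3 := offCoeff_mul hYZ
  have h1 : wt X - wt Y ≠ 0 := sub_ne_zero.2 fun e => hXY (wt_injective e)
  have h2 : wt X - wt Z ≠ 0 := sub_ne_zero.2 fun e => hXZ (wt_injective e)
  have h3 : wt Y - wt Z ≠ 0 := sub_ne_zero.2 fun e => hYZ (wt_injective e)
  have h4 : diagCoeff Y X = (t - 1) * wt Y / (wt X - wt Y) := by
    rw [diagCoeff, ← neg_sub (wt X), div_neg, ← neg_div]; ring
  have h5 : diagCoeff Z X = (t - 1) * wt Z / (wt X - wt Z) := by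
    rw [diagCoeff, ← neg_sub (wt X), div_neg, ← neg_div]; ring
  have h6 : diagCoeff Z Y = (t - 1) * wt Z / (wt Y - wt Z) := by
    rw [diagCoeff, ← neg_sub (wt Y), div_neg, ← neg_div]; ring
  simp only [hS, hT, map_add, map_smul, smul_add, smul_smul]
  -- The identities c0, c1, c2 compare the coefficients of v X Y Z, v Y X Z and v X Z Y. The
  -- coefficients of the other three permutations agree termwise.
  have c0 : diagCoeff X Y * (diagCoeff Y Z * diagCoeff X Y) +
      offCoeff X Y * (diagCoeff X Z * offCoeff Y X) =
      diagCoeff Y Z * (diagCoeff X Y * diagCoeff Y Z) +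
      offCoeff Y Z * (diagCoeff X Z * offCoeff Z Y) := by
    rw [show offCoeff X Y * (diagCoeff X Z * offCoeff Y X) =
        diagCoeff X Z * (offCoeff X Y * offCoeff Y X) by ring,
      show offCoeff Y Z * (diagCoeff X Z * offCoeff Z Y) =
        diagCoeff X Z * (offCoeff Y Z * offCoeff Z Y) by ring, e1, e3]
    simp only [diagCoeff]
    field_simp
    ring
  have c1 : diagCoeff X Y * diagCoeff Y Z + diagCoeff Y X * diagCoeff X Z =
      diagCoeff Y Z * diagCoeff X Z := by
    rw [h4]
    simp only [diagCoeff]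
    field_simp
    ring
  have c2 : diagCoeff X Y * diagCoeff X Z = diagCoeff Y Z * diagCoeff X Y +
      diagCoeff Z Y * diagCoeff X Z := by
    rw [h6]
    simp only [diagCoeff]
    field_simp
    ring
  linear_combination (norm := module) c0 • v X Y Z + (offCoeff X Y * c1) • v Y X Z +
    (offCoeff Y Z * c2) • v X Z Y

end LocalBraid

/-! ### Combinatorics of periodic standard tableaux -/

theorem lo_val {n : ℕ} (i : Fin (n - 1)) : (lo i).1 = i.1 := rfl

theorem hi_val {n : ℕ} (i : Fin (n - 1)) : (hi i).1 = i.1 + 1 := rfl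

namespace PSYT

variable {n : ℕ} {μ : YoungDiagram}

theorem box_label (τ : PSYT n μ) (b : μ.cells) : τ.box (τ.label b).1 = b :=
  (Equiv.ofBijective _ τ.bij).symm_apply_apply b

theorem label_box_fst (τ : PSYT n μ) (i : Fin n) : (τ.label (τ.box i)).1 = i :=
  (Equiv.ofBijective _ τ.bij).apply_symm_apply i

theorem label_box (τ : PSYT n μ) (i : Fin n) : τ.label (τ.box i) = (i, τ.w i) :=
  Prod.ext (τ.label_box_fst i) rfl

theorem w_label (τ : PSYT n μ) (b : μ.cells) : τ.w (τ.label b).1 = (τ.label b).2 := by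
  rw [w, box_label]

theorem box_eq_of_label (τ : PSYT n μ) {b : μ.cells} {i : Fin n} {m : ℕ} (h : τ.label b = (i, m)) :
    τ.box i = b ∧ τ.w i = m := by
  have h1 := τ.box_label b
  have h2 := τ.w_label b
  rw [h] at h1 h2
  exact ⟨h1, h2⟩

/-- The weight exponents `i ↦ (w_τ(i), c_τ(i))`. -/
def W (τ : PSYT n μ) (i : Fin n) : ℕ × ℤ := (τ.w i, τ.c i)

theorem mid_mem {b : μ.cells} (r s : ℕ) (hr : r ≤ b.1.1) (hs : s ≤ b.1.2) :
    (r, s) ∈ μ.cells :=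
  μ.up_left_mem hr hs ((YoungDiagram.mem_cells _).1 b.2)

theorem _root_.VVMac.LabelLt.trans {x y z : Fin n × ℕ} (h : LabelLt x y) (h' : LabelLt y z) :
    LabelLt x z := by
  simp only [LabelLt, Fin.lt_def] at *
  omega

theorem _root_.VVMac.LabelLt.irrefl {x : Fin n × ℕ} : ¬ LabelLt x x := by
  simp only [LabelLt, Fin.lt_def]
  omega

/-- Labels increase strictly from north-west to south-east. -/
theorem label_lt (τ : PSYT n μ) {b b' : μ.cells} (h1 : b.1.1 ≤ b'.1.1) (h2 : b.1.2 ≤ b'.1.2)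
    (h : b ≠ b') : LabelLt (τ.label b) (τ.label b') := by
  let m : μ.cells := ⟨(b.1.1, b'.1.2), mid_mem (b := b') _ _ h1 le_rfl⟩
  rcases h1.eq_or_lt with e1 | l1
  · rcases h2.eq_or_lt with e2 | l2
    · exact absurd (Subtype.ext (Prod.ext e1 e2)) h
    · exact τ.row_lt _ _ e1 l2
  · rcases h2.eq_or_lt with e2 | l2
    · exact τ.col_lt _ _ e2 l1
    · exact (τ.row_lt b m rfl l2).trans (τ.col_lt m b' rfl l1)

/-- Relative position of the boxes of `i` and `i + 1` when their exponents agree. -/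
theorem consecutive_cases (τ : PSYT n μ) (i : Fin (n - 1)) (hw : τ.w (lo i) = τ.w (hi i)) :
    ((τ.box (hi i)).1.1 = (τ.box (lo i)).1.1 ∧ (τ.box (hi i)).1.2 = (τ.box (lo i)).1.2 + 1) ∨
    ((τ.box (hi i)).1.2 = (τ.box (lo i)).1.2 ∧ (τ.box (hi i)).1.1 = (τ.box (lo i)).1.1 + 1) ∨
    ((τ.box (lo i)).1.1 < (τ.box (hi i)).1.1 ∧ (τ.box (hi i)).1.2 < (τ.box (lo i)).1.2) ∨
    ((τ.box (hi i)).1.1 < (τ.box (lo i)).1.1 ∧ (τ.box (lo i)).1.2 < (τ.box (hi i)).1.2) := by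
  have hl := τ.label_box (lo i)
  have hh := τ.label_box (hi i)
  have hne : τ.box (lo i) ≠ τ.box (hi i) := by
    intro e
    rw [e, hh] at hl
    simp [lo, hi] at hl
  generalize τ.box (lo i) = b at *
  generalize τ.box (hi i) = b' at *
  -- The cell of i + 1 cannot lie weakly north-west of the cell of i.
  have key : ¬ (b'.1.1 ≤ b.1.1 ∧ b'.1.2 ≤ b.1.2) := by
    rintro ⟨h1, h2⟩
    have := τ.label_lt h1 h2 hne.symm
    rw [hl, hh] at this
    simp only [LabelLt, Fin.lt_def, lo_val, hi_val] at this
    omega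
  -- With equal exponents no label lies strictly between those of i and i + 1, so no cell can be
  -- squeezed between their boxes.
  have key2 : ∀ m : μ.cells, LabelLt (τ.label b) (τ.label m) → LabelLt (τ.label m) (τ.label b') →
      False := by
    intro m h1 h2
    rw [hl] at h1
    rw [hh] at h2
    simp only [LabelLt, Fin.lt_def, lo_val, hi_val] at h1 h2
    omega
  by_contra hcon
  have hle : b.1.1 ≤ b'.1.1 ∧ b.1.2 ≤ b'.1.2 := by omega
  obtain ⟨h1, h2⟩ := hle
  rcases h1.eq_or_lt with e1 | l1
  · let m : μ.cells := ⟨(b.1.1, b.1.2 + 1), mid_mem (b := b') _ _ h1 (by omega)⟩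
    exact key2 m (τ.row_lt _ _ rfl (Nat.lt_succ_self _))
      (τ.row_lt m b' e1 (by simp only [m]; omega))
  · rcases h2.eq_or_lt with e2 | l2
    · let m : μ.cells := ⟨(b.1.1 + 1, b.1.2), mid_mem (b := b') _ _ (by omega) h2⟩
      exact key2 m (τ.col_lt _ _ rfl (Nat.lt_succ_self _))
        (τ.col_lt m b' e2 (by simp only [m]; omega))
    · let m : μ.cells := ⟨(b.1.1, b'.1.2), mid_mem (b := b') _ _ h1 le_rfl⟩
      exact key2 m (τ.row_lt b m rfl l2) (τ.col_lt m b' rfl l1)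

theorem W_lo_ne_hi (τ : PSYT n μ) (i : Fin (n - 1)) : τ.W (lo i) ≠ τ.W (hi i) := by
  intro h
  simp only [W, Prod.mk.injEq, c, content] at h
  have := τ.consecutive_cases i h.1
  omega

/-- Two boxes with equal content lie on one diagonal. If the exponents agree too, the other two
corners of the rectangle they span must both carry the one label in between, which is impossible.
Together with `W_lo_ne_hi` this makes the three weights in the braid relation distinct. -/
theorem W_ne_of_add_two (τ : PSYT n μ) {i j : Fin n} (hij : i.1 + 2 = j.1) : τ.W i ≠ τ.W j := by
  intro h
  simp only [W, Prod.mk.injEq, c, content] at h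
  obtain ⟨hw, hc⟩ := h
  have hl := τ.label_box i
  have hh := τ.label_box j
  have hne : τ.box i ≠ τ.box j := by
    intro e
    rw [e, hh] at hl
    simp only [Prod.mk.injEq, Fin.ext_iff] at hl
    omega
  generalize τ.box i = b at *
  generalize τ.box j = b' at *
  have hlt : b.1.1 < b'.1.1 ∧ b.1.2 < b'.1.2 := by
    by_contra hcon
    have := τ.label_lt (b := b') (b' := b) (by omega) (by omega) hne.symm
    rw [hl, hh] at this
    simp only [LabelLt, Fin.lt_def] at this
    omega
  obtain ⟨h1, h2⟩ := hlt
  have key2 : ∀ m : μ.cells, LabelLt (τ.label b) (τ.label m) → LabelLt (τ.label m) (τ.label b') →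
      (τ.label m).1.1 = i.1 + 1 := by
    intro m h1 h2
    rw [hl] at h1
    rw [hh] at h2
    simp only [LabelLt, Fin.lt_def] at h1 h2
    omega
  let m : μ.cells := ⟨(b.1.1, b'.1.2), mid_mem (b := b') _ _ h1.le le_rfl⟩
  let m' : μ.cells := ⟨(b'.1.1, b.1.2), mid_mem (b := b') _ _ le_rfl h2.le⟩
  have e1 := key2 m (τ.row_lt b m rfl h2) (τ.col_lt m b' rfl h1)
  have e2 := key2 m' (τ.col_lt b m' rfl h1) (τ.row_lt m' b' rfl h2)
  have e3 : m = m' := τ.bij.1 (Fin.ext (e1.trans e2.symm))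
  simp only [m, m', Subtype.mk.injEq, Prod.mk.injEq] at e3
  omega

theorem up_or_adjacent (τ : PSYT n μ) (i : Fin (n - 1)) :
    Up (τ.W (lo i)) (τ.W (hi i)) ∨ Up (τ.W (hi i)) (τ.W (lo i)) ∨ τ.w (lo i) = τ.w (hi i) ∧
    (((τ.box (hi i)).1.1 = (τ.box (lo i)).1.1 ∧ (τ.box (hi i)).1.2 = (τ.box (lo i)).1.2 + 1) ∨
    ((τ.box (hi i)).1.2 = (τ.box (lo i)).1.2 ∧ (τ.box (hi i)).1.1 = (τ.box (lo i)).1.1 + 1)) := by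
  rcases eq_or_ne (τ.w (lo i)) (τ.w (hi i)) with h | h
  · have := τ.consecutive_cases i h
    simp only [Up, W, c, content]
    omega
  · simp only [Up, W]
    omega

/-- Exchanging i and i + 1 can reverse a comparison only between these two labels, and only when
their exponents agree. -/
theorem swap_labelLt {i : Fin (n - 1)} {x y : Fin n × ℕ} (h : LabelLt x y)
    (h' : ¬ (x.1 = lo i ∧ y.1 = hi i ∧ x.2 = y.2)) :
    LabelLt (Equiv.swap (lo i) (hi i) x.1, x.2) (Equiv.swap (lo i) (hi i) y.1, y.2) := by
  obtain ⟨a, m⟩ := x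
  obtain ⟨b, l⟩ := y
  simp only [LabelLt, Equiv.swap_apply_def] at *
  split_ifs <;> simp only [Fin.lt_def, Fin.ext_iff, lo, hi] at * <;> omega

/-- `s_i(τ)` -/
def swap (τ : PSYT n μ) (i : Fin (n - 1))
    (h : Up (τ.W (lo i)) (τ.W (hi i)) ∨ Up (τ.W (hi i)) (τ.W (lo i))) : PSYT n μ where
  label b := (Equiv.swap (lo i) (hi i) (τ.label b).1, (τ.label b).2)
  bij := (Equiv.swap (lo i) (hi i)).bijective.comp τ.bij
  row_lt b b' e l := by
    refine swap_labelLt (τ.row_lt b b' e l) ?_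
    rintro ⟨h1, h2, h3⟩
    obtain ⟨h4, h5⟩ := τ.box_eq_of_label (Prod.ext h1 rfl : τ.label b = (lo i, _))
    obtain ⟨h6, h7⟩ := τ.box_eq_of_label (Prod.ext h2 rfl : τ.label b' = (hi i, _))
    have h8 := τ.consecutive_cases i (h5.trans (h3.trans h7.symm))
    have h9 := h5.trans (h3.trans h7.symm)
    simp only [Up, W, c, content, h4, h6] at h
    rw [h4, h6] at h8
    omega
  col_lt b b' e l := by
    refine swap_labelLt (τ.col_lt b b' e l) ?_
    rintro ⟨h1, h2, h3⟩
    obtain ⟨h4, h5⟩ := τ.box_eq_of_label (Prod.ext h1 rfl : τ.label b = (lo i, _))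
    obtain ⟨h6, h7⟩ := τ.box_eq_of_label (Prod.ext h2 rfl : τ.label b' = (hi i, _))
    have h8 := τ.consecutive_cases i (h5.trans (h3.trans h7.symm))
    have h9 := h5.trans (h3.trans h7.symm)
    simp only [Up, W, c, content, h4, h6] at h
    rw [h4, h6] at h8
    omega

theorem isSwap_swap (τ : PSYT n μ) (i : Fin (n - 1))
    (h : Up (τ.W (lo i)) (τ.W (hi i)) ∨ Up (τ.W (hi i)) (τ.W (lo i))) :
    IsSwap i τ (τ.swap i h) := fun _ => rfl

theorem IsSwap.box {i : Fin (n - 1)} {τ σ : PSYT n μ} (h : IsSwap i τ σ) (k : Fin n) :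
    σ.box k = τ.box (Equiv.swap (lo i) (hi i) k) ∧
      σ.w k = τ.w (Equiv.swap (lo i) (hi i) k) := by
  refine σ.box_eq_of_label ?_
  rw [h, label_box, Equiv.swap_apply_self]

theorem IsSwap.W {i : Fin (n - 1)} {τ σ : PSYT n μ} (h : IsSwap i τ σ) :
    σ.W = τ.W ∘ Equiv.swap (lo i) (hi i) := by
  funext k
  simp only [PSYT.W, c, Function.comp_apply, (h.box k).1, (h.box k).2]

/-- In horizontally or vertically adjacent boxes with equal exponents, the exchange would break
strict increase. -/
theorem IsSwap.up {i : Fin (n - 1)} {τ σ : PSYT n μ} (h : IsSwap i τ σ) :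
    Up (τ.W (lo i)) (τ.W (hi i)) ∨ Up (τ.W (hi i)) (τ.W (lo i)) := by
  rcases τ.up_or_adjacent i with h1 | h1 | ⟨h1, h2⟩
  · exact .inl h1
  · exact .inr h1
  · exfalso
    have hl := h (τ.box (lo i))
    have hh := h (τ.box (hi i))
    rw [label_box, Equiv.swap_apply_left] at hl
    rw [label_box, Equiv.swap_apply_right] at hh
    rcases h2 with h2 | h2
    · have := σ.row_lt (τ.box (lo i)) (τ.box (hi i)) h2.1.symm (by omega)
      rw [hl, hh] at this
      simp only [LabelLt, Fin.lt_def, lo_val, hi_val] at this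
      omega
    · have := σ.col_lt (τ.box (lo i)) (τ.box (hi i)) h2.1.symm (by omega)
      rw [hl, hh] at this
      simp only [LabelLt, Fin.lt_def, lo_val, hi_val] at this
      omega

/-- The weight exponents determine the tableau. -/
theorem W_injective : Function.Injective (W : PSYT n μ → Fin n → ℕ × ℤ) := by
  intro τ σ h
  have hw : τ.w = σ.w := funext fun i => congrArg Prod.fst (congrFun h i)
  have hc : τ.c = σ.c := funext fun i => congrArg Prod.snd (congrFun h i)
  let r : Fin n → Fin n → Prop := fun i j => LabelLt (i, τ.w i) (j, τ.w j)
  have : IsTrans (Fin n) r := ⟨fun _ _ _ => LabelLt.trans⟩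
  have : Std.Irrefl r := ⟨fun _ => LabelLt.irrefl⟩
  -- Boxes are compared by induction along the order of the labels, which is common to both tableaux
  -- because their exponents agree.
  have wf : WellFounded r := Finite.wellFounded_of_trans_of_irrefl r
  have key : ∀ i, τ.box i = σ.box i := by
    intro i
    induction i using wf.induction with
    | h i ih =>
      by_contra hne
      have hci := congrFun hc i
      simp only [c, content] at hci
      have hne' : (τ.box i).1.1 ≠ (σ.box i).1.1 := by
        intro e
        exact hne (Subtype.ext (Prod.ext e (by omega)))
      -- Both boxes of i lie on the same diagonal. The other tableau carries a smaller label in the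
      -- north-western one; by induction the owner of that label sits there in both tableaux, so it
      -- equals i, a contradiction.
      rcases lt_or_gt_of_ne hne' with l | l
      · have h1 := σ.label_lt (b := τ.box i) (b' := σ.box i) (by omega) (by omega) hne
        obtain ⟨h2, h3⟩ := σ.box_eq_of_label (Prod.eta (σ.label (τ.box i))).symm
        have h4 := ih (σ.label (τ.box i)).1 (by
          simp only [r, hw, h3, Prod.mk.eta]
          rwa [σ.label_box] at h1)
        rw [h2] at h4
        have h5 := congrArg (fun b => (τ.label b).1) h4
        simp only [label_box_fst] at h5
        rw [h5] at h2
        exact hne h2.symm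
      · have h1 := τ.label_lt (b := σ.box i) (b' := τ.box i) (by omega) (by omega) (Ne.symm hne)
        obtain ⟨h2, h3⟩ := τ.box_eq_of_label (Prod.eta (τ.label (σ.box i))).symm
        have h4 := ih (τ.label (σ.box i)).1 (by
          simp only [r, h3, Prod.mk.eta]
          rwa [τ.label_box] at h1)
        rw [h2] at h4
        have h5 := congrArg (fun b => (σ.label b).1) h4
        simp only [label_box_fst] at h5
        rw [← h5] at h2
        exact hne h2
  ext1
  funext b
  have h1 := key (τ.label b).1
  rw [box_label] at h1
  have h2 := σ.label_box (τ.label b).1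
  rw [← h1, ← hw, w_label] at h2
  exact h2.symm

/-- The effect of `Ψ` on weight exponents. -/
def shiftW (u : Fin n → ℕ × ℤ) (k : Fin n) : ℕ × ℤ :=
  if h : k.1 + 1 < n then u ⟨k.1 + 1, h⟩
  else ((u ⟨0, k.pos⟩).1 + 1, (u ⟨0, k.pos⟩).2)

theorem W_Psi (τ : PSYT n μ) : τ.Psi.W = shiftW τ.W := by
  funext k
  have key : ∀ i, τ.Psi.label (τ.box i) = shiftLabel (i, τ.w i) := by
    intro i
    change shiftLabel (τ.label (τ.box i)) = _
    rw [label_box]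
  rw [shiftW]
  split_ifs with h
  · have e : τ.Psi.label (τ.box ⟨k.1 + 1, h⟩) = (k, τ.w ⟨k.1 + 1, h⟩) := by
      rw [key, shiftLabel]
      simp
    obtain ⟨h1, h2⟩ := τ.Psi.box_eq_of_label e
    simp only [W, c, h1, h2]
  · have e : τ.Psi.label (τ.box ⟨0, k.pos⟩) = (k, τ.w ⟨0, k.pos⟩ + 1) := by
      rw [key, shiftLabel]
      simp only [if_true, Prod.mk.injEq, and_true, Fin.ext_iff]
      omega
    obtain ⟨h1, h2⟩ := τ.Psi.box_eq_of_label e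
    simp only [W, c, h1, h2]

/-- The inverse of `shiftLabel`. -/
def unshiftLabel (x : Fin n × ℕ) : Fin n × ℕ :=
  if h : x.1.1 + 1 < n then (⟨x.1.1 + 1, h⟩, x.2) else (⟨0, x.1.pos⟩, x.2 - 1)

/-- Positivity of the last exponent makes the truncated subtraction in `unshiftLabel` exact, so that
it inverts `shiftLabel` on the labels of τ. -/
theorem exists_Psi_eq (τ : PSYT n μ) (hn : 0 < n) (h : 0 < τ.w ⟨n - 1, by omega⟩) :
    ∃ σ : PSYT n μ, σ.Psi = τ := by
  have hlast : ∀ b, ¬ (τ.label b).1.1 + 1 < n → 0 < (τ.label b).2 := by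
    intro b hb
    rw [← w_label]
    convert h using 2
    simp only [Fin.ext_iff]
    omega
  have hlt : ∀ b b', LabelLt (τ.label b) (τ.label b') →
      LabelLt (unshiftLabel (τ.label b)) (unshiftLabel (τ.label b')) := by
    intro b b' hl
    have h1 := hlast b
    have h2 := hlast b'
    generalize τ.label b = x at *
    generalize τ.label b' = y at *
    simp only [LabelLt, unshiftLabel, Fin.lt_def] at *
    split_ifs <;> simp only <;> omega
  have hinv : ∀ b, shiftLabel (unshiftLabel (τ.label b)) = τ.label b := by
    intro b
    have h1 := hlast b
    generalize τ.label b = x at *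
    unfold unshiftLabel
    split_ifs with h2
    · simp [shiftLabel]
    · have := h1 h2
      simp only [shiftLabel, if_true]
      ext
      · simp only; omega
      · simp only; omega
  refine ⟨⟨fun b => unshiftLabel (τ.label b), ?_, fun b b' e l => hlt _ _ (τ.row_lt b b' e l),
    fun b b' e l => hlt _ _ (τ.col_lt b b' e l)⟩, ?_⟩
  · rw [Fintype.bijective_iff_injective_and_card]
    refine ⟨fun b b' e => τ.bij.1 ?_, Fintype.card_of_bijective τ.bij⟩
    have key : ∀ x y : Fin n × ℕ, (unshiftLabel x).1 = (unshiftLabel y).1 → x.1 = y.1 := by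
      intro x y e
      unfold unshiftLabel at e
      split_ifs at e <;> simp only [Fin.ext_iff] at * <;> omega
    exact key _ _ e
  · ext1
    funext b
    exact hinv b

/-- The total exponent. -/
def deg (τ : PSYT n μ) : ℕ := ∑ i, τ.w i

theorem IsSwap.deg {i : Fin (n - 1)} {τ σ : PSYT n μ} (h : IsSwap i τ σ) : σ.deg = τ.deg := by
  simp only [PSYT.deg, (h.box _).2]
  exact Equiv.sum_comp (Equiv.swap (lo i) (hi i)) τ.w

theorem deg_Psi (hn : 0 < n) (τ : PSYT n μ) : τ.Psi.deg = τ.deg + 1 := by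
  obtain ⟨m, rfl⟩ : ∃ m, n = m + 1 := ⟨n - 1, by omega⟩
  have h : ∀ k, τ.Psi.w k = (shiftW τ.W k).1 := fun k => by rw [← W_Psi]; rfl
  rw [deg, deg, Fin.sum_univ_castSucc, Fin.sum_univ_succ]
  have h1 : ∀ k : Fin m, τ.Psi.w k.castSucc = τ.w k.succ := by
    intro k
    rw [h, shiftW, dif_pos (by simp)]
    rfl
  have h2 : τ.Psi.w (Fin.last m) = τ.w 0 + 1 := by
    rw [h, shiftW, dif_neg (by simp)]
    rfl
  rw [h2, Finset.sum_congr rfl fun k _ => h1 k]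
  omega

theorem sum_swap {i : Fin (n - 1)} (f : Fin n → ℤ) :
    ∑ k : Fin n, (k.1 : ℤ) * f (Equiv.swap (lo i) (hi i) k) =
      ∑ k : Fin n, (k.1 : ℤ) * f k + (f (lo i) - f (hi i)) := by
  have hne : lo i ≠ hi i := by simp [lo, hi]
  rw [← sub_eq_iff_eq_add', ← Finset.sum_sub_distrib,
    Finset.sum_eq_add (lo i) (hi i) hne]
  · simp only [Equiv.swap_apply_left, Equiv.swap_apply_right, lo, hi]
    push_cast
    ring
  · intro k _ hk
    rw [Equiv.swap_apply_of_ne_of_ne hk.1 hk.2, sub_self]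
  · simp
  · simp

/-- A strictly monotone invariant for the order on tableaux. -/
def rank (τ : PSYT n μ) : ℤ ×ₗ ℤ ×ₗ ℤ :=
  toLex ((τ.deg : ℤ), toLex (-∑ k : Fin n, (k.1 : ℤ) * τ.w k, ∑ k : Fin n, (k.1 : ℤ) * τ.c k))

/-- Ψ raises the total exponent. A swap preserves it and changes ∑ k f(k) by f(i) - f(i+1): for f =
w this is negative along covers of the first kind and zero along those of the second, where it is
positive for f = c. -/
theorem Cover.rank_lt {τ σ : PSYT n μ} (hn : 0 < n) (h : Cover τ σ) : τ.rank < σ.rank := by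
  have hs : ∀ i, IsSwap i τ σ → ∑ k : Fin n, (k.1 : ℤ) * σ.w k =
      ∑ k : Fin n, (k.1 : ℤ) * τ.w k + (τ.w (lo i) - τ.w (hi i)) ∧
      ∑ k : Fin n, (k.1 : ℤ) * σ.c k =
      ∑ k : Fin n, (k.1 : ℤ) * τ.c k + (τ.c (lo i) - τ.c (hi i)) := by
    intro i h
    rw [← sum_swap (fun k => (τ.w k : ℤ)), ← sum_swap]
    simp only [PSYT.c, (h.box _).1, (h.box _).2, and_self]
  simp only [rank, Prod.Lex.toLex_lt_toLex]
  cases h with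
  | psi => left; simp [deg_Psi hn]
  | swap_of_lt i _ _ h hw =>
    obtain ⟨h1, h2⟩ := hs i h
    right
    refine ⟨by rw [h.deg], .inl ?_⟩
    rw [h1]
    omega
  | swap_of_eq i _ _ h hw hc =>
    obtain ⟨h1, h2⟩ := hs i h
    right
    refine ⟨by rw [h.deg], .inr ⟨?_, ?_⟩⟩
    · rw [h1]
      omega
    · rw [h2]
      omega

theorem Lt.rank_lt {τ σ : PSYT n μ} (hn : 0 < n) (h : Lt τ σ) : τ.rank < σ.rank := by
  induction h with
  | single h => exact h.rank_lt hn
  | tail _ h ih => exact ih.trans (h.rank_lt hn)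

theorem IsSwap.symm {i : Fin (n - 1)} {τ σ : PSYT n μ} (h : IsSwap i τ σ) : IsSwap i σ τ := by
  intro b
  rw [h b]
  simp

theorem IsSwap.lt {i : Fin (n - 1)} {τ σ : PSYT n μ} (h : IsSwap i τ σ)
    (hup : Up (τ.W (lo i)) (τ.W (hi i))) : Lt τ σ := by
  rcases hup with h1 | ⟨h1, h2⟩
  · exact .single (.swap_of_lt i _ _ h h1)
  · exact .single (.swap_of_eq i _ _ h h1 h2)

/-- Were the pair descending, the reverse swap would give σ < τ, against the strictly increasing
rank. Hence the generated order gives back the local condition that normalizes the coefficients of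
T_i. -/
theorem IsSwap.up_of_lt {i : Fin (n - 1)} {τ σ : PSYT n μ} (h : IsSwap i τ σ) (hlt : Lt τ σ) :
    Up (τ.W (lo i)) (τ.W (hi i)) := by
  refine h.up.resolve_right fun h1 => ?_
  have hn : 0 < n := by have := i.2; omega
  have h2 : Lt σ τ := by
    refine h.symm.lt ?_
    rw [h.W]
    simpa using h1
  exact lt_asymm (hlt.rank_lt hn) (h2.rank_lt hn)

end PSYT

/-! ### Standard tableaux and inflation -/

section SYT

variable {n : ℕ} {μ : YoungDiagram}

theorem SYT.w_toPSYT (τ : SYT n μ) (i : Fin n) : τ.toPSYT.w i = 0 := rfl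

theorem PSYT.exists_toPSYT_eq (τ : PSYT n μ) (h : ∀ i, τ.w i = 0) :
    ∃ σ : SYT n μ, σ.toPSYT = τ := by
  have h0 : ∀ b, (τ.label b).2 = 0 := fun b => by rw [← τ.w_label, h]
  have hlt : ∀ b b', LabelLt (τ.label b) (τ.label b') → (τ.label b).1 < (τ.label b').1 := by
    intro b b' hl
    simpa [LabelLt, h0] using hl
  refine ⟨⟨fun b => (τ.label b).1, τ.bij, fun b b' e l => hlt _ _ (τ.row_lt b b' e l),
    fun b b' e l => hlt _ _ (τ.col_lt b b' e l)⟩, ?_⟩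
  ext1
  funext b
  exact Prod.ext rfl (h0 b).symm

/-- The smallest label occupies the corner (0, 0), since any other cell has the corner to its
north-west. -/
theorem SYT.c_zero (τ : SYT n μ) (hn : 0 < n) : τ.toPSYT.c ⟨0, hn⟩ = 0 := by
  by_contra hc
  set b := τ.toPSYT.box ⟨0, hn⟩ with hb
  let o : μ.cells := ⟨(0, 0), PSYT.mid_mem (b := b) _ _ (Nat.zero_le _) (Nat.zero_le _)⟩
  have hne : o ≠ b := by
    intro e
    apply hc
    rw [PSYT.c, ← hb, ← e]
    rfl
  have h1 := τ.toPSYT.label_lt (b := o) (b' := b) (Nat.zero_le _) (Nat.zero_le _) hne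
  rw [hb, PSYT.label_box, SYT.w_toPSYT] at h1
  rcases h1 with h1 | h1
  · exact absurd h1 (Nat.not_lt_zero _)
  · exact absurd h1.2 (Nat.not_lt_zero _)

/-- The periodic tableau with given exponents and given standardization. -/
def SYT.inflate (τ : SYT n μ) (w : Fin n → ℕ) : PSYT n μ :=
  -- Sorting by decreasing exponent, with ties broken by index, lists the labels j q^{w(j)} in
  -- increasing order; the entries of τ are then replaced by the labels of the same position in this
  -- list.
  let σ := Tuple.sort (fun j => OrderDual.toDual (w j))
  have hlt : ∀ i j, i < j → LabelLt (σ i, w (σ i)) (σ j, w (σ j)) := by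
    intro i j hij
    have h1 := Tuple.monotone_sort (fun j => OrderDual.toDual (w j)) hij.le
    simp only [Function.comp_apply, OrderDual.toDual_le_toDual] at h1
    rcases h1.lt_or_eq with h | h
    · exact .inl h
    · exact .inr ⟨h.symm, (Tuple.eq_sort_iff.1 rfl).2 i j hij (congrArg OrderDual.toDual h.symm)⟩
  { label := fun b => (σ (τ.label b), w (σ (τ.label b)))
    bij := σ.bijective.comp τ.bij
    row_lt := fun b b' e l => hlt _ _ (τ.row_lt b b' e l)
    col_lt := fun b b' e l => hlt _ _ (τ.col_lt b b' e l) }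

theorem SYT.w_inflate (τ : SYT n μ) (w : Fin n → ℕ) : (τ.inflate w).w = w := by
  funext i
  have h := (τ.inflate w).label_box_fst i
  change w _ = w i
  exact congrArg w h

theorem SYT.inflate_injective {τ σ : SYT n μ} {w w' : Fin n → ℕ}
    (h : τ.inflate w = σ.inflate w') : w = w' ∧ τ = σ := by
  have hw : w = w' := by rw [← τ.w_inflate w, h, w_inflate]
  subst hw
  refine ⟨rfl, ?_⟩
  ext1
  funext b
  have := congrArg (fun x : PSYT n μ => (x.label b).1) h
  exact (Tuple.sort (fun j => OrderDual.toDual (w j))).injective this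

end SYT

section Scalars

theorem wt_mul_diagCoeff {u v : ℕ × ℤ} (h : u ≠ v) :
    wt v * diagCoeff u v + wt u * diagCoeff v u = 0 := by
  have h1 : wt u - wt v ≠ 0 := sub_ne_zero.2 fun e => h (wt_injective e)
  have h2 : wt v - wt u ≠ 0 := sub_ne_zero.2 fun e => h (wt_injective e).symm
  rw [diagCoeff, diagCoeff]
  field_simp
  ring

/-- Raising both exponents multiplies both weights by q, which cancels. This is what makes Y²
intertwine the first and the last T. -/
theorem diagCoeff_shift (u v : ℕ × ℤ) :
    diagCoeff (u.1 + 1, u.2) (v.1 + 1, v.2) = diagCoeff u v := by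
  rw [diagCoeff, diagCoeff, wt_succ_fst, wt_succ_fst, ← mul_sub, mul_left_comm,
    mul_div_mul_left _ _ q_ne_zero]

open Classical in
theorem offCoeff_shift (u v : ℕ × ℤ) :
    offCoeff (u.1 + 1, u.2) (v.1 + 1, v.2) = offCoeff u v := by
  have h : ∀ u v : ℕ × ℤ, Up (u.1 + 1, u.2) (v.1 + 1, v.2) ↔ Up u v := by
    intro u v
    simp only [Up]
    omega
  have e : (t * (q * wt u) - q * wt v) * (q * wt u - t * (q * wt v)) / (q * wt u - q * wt v) ^ 2
      = (t * wt u - wt v) * (wt u - t * wt v) / (wt u - wt v) ^ 2 := by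
    rw [show (t * (q * wt u) - q * wt v) * (q * wt u - t * (q * wt v)) =
        q ^ 2 * ((t * wt u - wt v) * (wt u - t * wt v)) by ring,
      ← mul_sub, mul_pow, mul_div_mul_left _ _ (pow_ne_zero 2 q_ne_zero)]
  rw [offCoeff, offCoeff, wt_succ_fst, wt_succ_fst, e]
  exact if_congr (h u v) rfl (if_congr (h v u) rfl rfl)

end Scalars

/-! ### The explicit model and its operators -/

/-- The space underlying the explicit model of the induced module. -/
abbrev Model (n : ℕ) (μ : YoungDiagram) : Type := PSYT n μ →₀ K

namespace Model

variable {n : ℕ} {μ : YoungDiagram}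

open Classical in
/-- The basis vector with the given weight exponents, or `0`. -/
def vec (u : Fin n → ℕ × ℤ) : Model n μ :=
  if h : ∃ τ : PSYT n μ, τ.W = u then Finsupp.single h.choose 1 else 0

theorem vec_W (τ : PSYT n μ) : vec τ.W = Finsupp.single τ (1 : K) := by
  have h : ∃ σ : PSYT n μ, σ.W = τ.W := ⟨τ, rfl⟩
  rw [vec, dif_pos h, PSYT.W_injective h.choose_spec]

theorem vec_eq_zero {u : Fin n → ℕ × ℤ} (h : ¬ ∃ τ : PSYT n μ, τ.W = u) :
    (vec u : Model n μ) = 0 := dif_neg h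

theorem hom_ext {M : Type} [AddCommGroup M] [Module K M] {f g : Model n μ →ₗ[K] M}
    (h : ∀ τ : PSYT n μ, f (vec τ.W) = g (vec τ.W)) : f = g := by
  refine Finsupp.lhom_ext' fun τ => LinearMap.ext_ring ?_
  have := h τ
  rwa [vec_W] at this

/-- The linear map with prescribed values on the vectors `vec τ.W`. -/
def ofVec (f : (Fin n → ℕ × ℤ) → Model n μ) : Module.End K (Model n μ) :=
  Finsupp.linearCombination K fun τ : PSYT n μ => f τ.W

/-- Formulas for operators extend to arbitrary weight sequences, with value 0 where no tableau
exists. Relations can then be checked by formal manipulation of sequences, without asking whether a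
swapped sequence comes from a tableau. -/
theorem ofVec_apply (f : (Fin n → ℕ × ℤ) → Model n μ) (u : Fin n → ℕ × ℤ)
    (h : (¬ ∃ τ : PSYT n μ, τ.W = u) → f u = 0) : ofVec f (vec u) = f u := by
  by_cases hu : ∃ τ : PSYT n μ, τ.W = u
  · obtain ⟨τ, rfl⟩ := hu
    rw [vec_W, ofVec, Finsupp.linearCombination_single, one_smul]
  · rw [vec_eq_zero hu, map_zero, h hu]

/-- The interchange of positions `i` and `i + 1`. -/
def sw (i : Fin (n - 1)) (u : Fin n → ℕ × ℤ) : Fin n → ℕ × ℤ := u ∘ Equiv.swap (lo i) (hi i)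

theorem sw_lo (i : Fin (n - 1)) (u : Fin n → ℕ × ℤ) : sw i u (lo i) = u (hi i) := by simp [sw]

theorem sw_hi (i : Fin (n - 1)) (u : Fin n → ℕ × ℤ) : sw i u (hi i) = u (lo i) := by simp [sw]

theorem sw_of_ne (i : Fin (n - 1)) (u : Fin n → ℕ × ℤ) {k : Fin n} (h : k ≠ lo i) (h' : k ≠ hi i) :
    sw i u k = u k := by
  simp [sw, Equiv.swap_apply_of_ne_of_ne h h']

theorem sw_sw (i : Fin (n - 1)) (u : Fin n → ℕ × ℤ) : sw i (sw i u) = u := by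
  funext k
  simp [sw]

def T (i : Fin (n - 1)) : Module.End K (Model n μ) :=
  ofVec fun u => diagCoeff (u (lo i)) (u (hi i)) • vec u +
    offCoeff (u (lo i)) (u (hi i)) • vec (sw i u)

def θ (k : Fin n) : Module.End K (Model n μ) := ofVec fun u => wt (u k) • vec u

/-- The operator `X_n π_n⁻¹`. -/
def Y (hn : 0 < n) : Module.End K (Model n μ) :=
  ofVec fun u => (q ^ (u ⟨0, hn⟩).1)⁻¹ • vec (PSYT.shiftW u)

/-- If u comes from no tableau, its swap might still do so. When the two entries can be
interchanged, swapping back rules this out; otherwise the off-diagonal coefficient is 0. -/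
theorem T_vec (i : Fin (n - 1)) (u : Fin n → ℕ × ℤ) :
    T i (vec u : Model n μ) = diagCoeff (u (lo i)) (u (hi i)) • vec u +
      offCoeff (u (lo i)) (u (hi i)) • vec (sw i u) := by
  refine ofVec_apply _ u fun h => ?_
  rw [vec_eq_zero h, smul_zero, zero_add]
  by_cases h1 : Up (u (lo i)) (u (hi i)) ∨ Up (u (hi i)) (u (lo i))
  · rw [vec_eq_zero, smul_zero]
    rintro ⟨σ, hσ⟩
    have h2 : Up (σ.W (lo i)) (σ.W (hi i)) ∨ Up (σ.W (hi i)) (σ.W (lo i)) := by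
      rw [hσ, sw_lo, sw_hi]
      exact h1.symm
    refine h ⟨σ.swap i h2, ?_⟩
    rw [(σ.isSwap_swap i h2).W, hσ]
    exact sw_sw i u
  · rw [offCoeff_of_not (fun h => h1 (.inl h)) (fun h => h1 (.inr h)), zero_smul]

theorem θ_vec (k : Fin n) (u : Fin n → ℕ × ℤ) :
    θ k (vec u : Model n μ) = wt (u k) • vec u := by
  refine ofVec_apply _ u fun h => ?_
  rw [vec_eq_zero h, smul_zero]

theorem shiftW_injective : Function.Injective (PSYT.shiftW : (Fin n → ℕ × ℤ) → _) := by
  intro u v h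
  funext k
  by_cases hk : k.1 = 0
  · have h1 := congrFun h ⟨n - 1, by have := k.2; omega⟩
    have h2 : ¬ (n - 1 + 1 < n) := by omega
    simp only [PSYT.shiftW, dif_neg h2, Prod.mk.injEq, Nat.add_right_cancel_iff] at h1
    have e : k = ⟨0, k.pos⟩ := Fin.ext hk
    rw [e]
    exact Prod.ext h1.1 h1.2
  · have h1 := congrFun h ⟨k.1 - 1, by have := k.2; omega⟩
    have h2 : k.1 - 1 + 1 < n := by have := k.2; omega
    have e : (⟨k.1 - 1 + 1, h2⟩ : Fin n) = k := Fin.ext (by simp only; omega)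
    simpa only [PSYT.shiftW, dif_pos h2, e] using h1

/-- A tableau with weights `shiftW u` has positive last exponent, hence is some Ψ(τ), and then u
comes from τ. -/
theorem Y_vec (hn : 0 < n) (u : Fin n → ℕ × ℤ) :
    Y hn (vec u : Model n μ) = (q ^ (u ⟨0, hn⟩).1)⁻¹ • vec (PSYT.shiftW u) := by
  refine ofVec_apply _ u fun h => ?_
  rw [vec_eq_zero, smul_zero]
  rintro ⟨σ, hσ⟩
  have hw : 0 < σ.w ⟨n - 1, by omega⟩ := by
    change 0 < (σ.W ⟨n - 1, by omega⟩).1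
    rw [hσ, PSYT.shiftW, dif_neg (by simp only; omega)]
    exact Nat.succ_pos _
  obtain ⟨τ, rfl⟩ := σ.exists_Psi_eq hn hw
  rw [PSYT.W_Psi] at hσ
  exact h ⟨τ, shiftW_injective hσ⟩

theorem T_quad (i : Fin (n - 1)) :
    ((T i : Module.End K (Model n μ)) - 1) * (T i + algebraMap K _ t) = 0 := by
  refine hom_ext fun τ => ?_
  have hne := τ.W_lo_ne_hi i
  have h1 := diagCoeff_add hne
  have h2 := diagCoeff_mul_sub hne
  simp only [Module.End.mul_apply, LinearMap.add_apply, LinearMap.sub_apply, Module.End.one_apply,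
    Module.algebraMap_end_apply, map_add, map_smul, T_vec, sw_lo, sw_hi, sw_sw,
    LinearMap.zero_apply]
  linear_combination (norm := module) (diagCoeff (τ.W (lo i)) (τ.W (hi i)) * h1 - h2) • vec τ.W +
    (offCoeff (τ.W (lo i)) (τ.W (hi i)) * h1) • vec (sw i τ.W)

theorem sw_comm (i j : Fin (n - 1)) (h : i.1 + 1 < j.1 ∨ j.1 + 1 < i.1) (u : Fin n → ℕ × ℤ) :
    sw i (sw j u) = sw j (sw i u) := by
  funext k
  simp only [sw, Function.comp_apply, Equiv.swap_apply_def, Fin.ext_iff]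
  congr 1
  split_ifs <;> simp only [lo_val, hi_val, Fin.ext_iff] at * <;> omega

theorem T_comm (i j : Fin (n - 1)) (h : i.1 + 1 < j.1 ∨ j.1 + 1 < i.1) :
    (T i : Module.End K (Model n μ)) * T j = T j * T i := by
  refine hom_ext fun τ => ?_
  have hne : lo i ≠ lo j ∧ lo i ≠ hi j ∧ hi i ≠ lo j ∧ hi i ≠ hi j := by
    simp only [Ne, Fin.ext_iff, lo_val, hi_val]
    omega
  obtain ⟨n1, n2, n3, n4⟩ := hne
  simp only [Module.End.mul_apply, map_add, map_smul, T_vec, sw_of_ne j _ n1 n2,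
    sw_of_ne j _ n3 n4, sw_of_ne i _ n1.symm n3.symm, sw_of_ne i _ n2.symm n4.symm,
    sw_comm i j h]
  module

theorem T_braid (i j : Fin (n - 1)) (h : i.1 + 1 = j.1) :
    (T i : Module.End K (Model n μ)) * T j * T i = T j * T i * T j := by
  refine hom_ext fun τ => ?_
  have e1 : lo j = hi i := Fin.ext h.symm
  have hne : lo i ≠ hi i ∧ lo i ≠ hi j ∧ hi i ≠ hi j := by
    simp only [Ne, Fin.ext_iff, lo_val, hi_val]
    omega
  obtain ⟨n1, n2, n3⟩ := hne
  -- Only the three consecutive positions moved by T_i and T_j vary; all others keep the weights of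
  -- τ.
  let put (X Y Z : ℕ × ℤ) (k : Fin n) : ℕ × ℤ :=
    if k = lo i then X else if k = hi i then Y else if k = hi j then Z else τ.W k
  have put_lo : ∀ X Y Z, put X Y Z (lo i) = X := fun X Y Z => if_pos rfl
  have put_mid : ∀ X Y Z, put X Y Z (hi i) = Y := fun X Y Z => by simp [put, n1.symm]
  have put_hi : ∀ X Y Z, put X Y Z (hi j) = Z := fun X Y Z => by simp [put, n2.symm, n3.symm]
  have put_self : put (τ.W (lo i)) (τ.W (hi i)) (τ.W (hi j)) = τ.W := by
    funext k
    simp only [put]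
    split_ifs with h1 h2 h3
    · rw [h1]
    · rw [h2]
    · rw [h3]
    · rfl
  have sw_i : ∀ X Y Z, sw i (put X Y Z) = put Y X Z := by
    intro X Y Z
    funext k
    by_cases h1 : k = lo i
    · rw [h1, sw_lo, put_lo, put_mid]
    · by_cases h2 : k = hi i
      · rw [h2, sw_hi, put_lo, put_mid]
      · rw [sw_of_ne i _ h1 h2]
        simp [put, h1, h2]
  have sw_j : ∀ X Y Z, sw j (put X Y Z) = put X Z Y := by
    intro X Y Z
    funext k
    by_cases h1 : k = hi i
    · rw [h1, ← e1, sw_lo, put_hi, e1, put_mid]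
    · by_cases h2 : k = hi j
      · rw [h2, sw_hi, put_hi, e1, put_mid]
      · rw [sw_of_ne j _ (by rwa [e1]) h2]
        simp [put, h1, h2]
  have key := seminormal_braid (T i : Module.End K (Model n μ)) (T j) (τ.W (lo i)) (τ.W (hi i))
    (τ.W (hi j)) (τ.W_lo_ne_hi i) (τ.W_ne_of_add_two (by simp only [lo_val, hi_val]; omega))
    (by rw [← e1]; exact τ.W_lo_ne_hi j) (fun X Y Z => vec (put X Y Z))
    (fun X Y Z => by rw [T_vec, put_lo, put_mid, sw_i])
    (fun X Y Z => by rw [T_vec, e1, put_mid, put_hi, sw_j])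
  simpa only [put_self, Module.End.mul_apply] using key

theorem satHecke : SatHecke (T : Fin (n - 1) → Module.End K (Model n μ)) := by
  intro a b h
  cases h with
  | quad i => exact T_quad i
  | braid i j h => exact T_braid i j h
  | comm i j h => exact T_comm i j h

/-- The recursion for θ_{i+1} in a form free of inverses. It rests on the determinant of T_i and on
the vanishing in `wt_mul_diagCoeff`. -/
theorem T_θ_T (i : Fin (n - 1)) :
    (T i : Module.End K (Model n μ)) * θ (hi i) * T i = t • θ (lo i) := by
  refine hom_ext fun τ => ?_
  have hne := τ.W_lo_ne_hi i
  have h1 := wt_mul_diagCoeff hne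
  have h2 := diagCoeff_mul_sub hne
  simp only [Module.End.mul_apply, LinearMap.smul_apply, map_add, map_smul, T_vec, θ_vec, sw_lo,
    sw_hi, sw_sw]
  linear_combination (norm := module)
    (diagCoeff (τ.W (lo i)) (τ.W (hi i)) * h1 - wt (τ.W (lo i)) * h2) • vec τ.W +
    (offCoeff (τ.W (lo i)) (τ.W (hi i)) * h1) • vec (sw i τ.W)

theorem affineRel (a b : Module.End K (Model n μ)) (h : AffineRel T θ a b) : a = b := by
  cases h with
  | hecke h => exact satHecke _ _ h
  | theta_comm i j =>
    refine hom_ext fun τ => ?_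
    simp only [Module.End.mul_apply, θ_vec, map_smul]
    exact smul_comm _ _ _
  | theta_succ i =>
    have h1 := T_mul_Tinv (satHecke (n := n) (μ := μ)) i
    have h2 := Tinv_mul_T (satHecke (n := n) (μ := μ)) i
    have h3 := T_θ_T (μ := μ) i
    rw [← smul_mul_assoc, ← mul_smul_comm, ← h3]
    simp only [mul_assoc]
    rw [h1, mul_one, ← mul_assoc, h2, one_mul]
  | T_theta i j h h' =>
    refine hom_ext fun τ => ?_
    simp only [Module.End.mul_apply, θ_vec, T_vec, map_smul, map_add, sw_of_ne i _ h h']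
    module

variable (n μ) in
/-- The affine Hecke relations on the model. -/
def affineData (hn : 0 < n) : AffineData (Module.End K (Model n μ)) (n - 1) :=
  AffineData.ofFin hn T θ affineRel

theorem shiftW_of_lt (u : Fin n → ℕ × ℤ) (k : Fin n) (h : k.1 + 1 < n) :
    PSYT.shiftW u k = u ⟨k.1 + 1, h⟩ := dif_pos h

theorem shiftW_last (u : Fin n → ℕ × ℤ) (k : Fin n) (h : k.1 + 1 = n) :
    PSYT.shiftW u k = ((u ⟨0, k.pos⟩).1 + 1, (u ⟨0, k.pos⟩).2) := dif_neg (by omega)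

theorem isUnit_θ (k : Fin n) : IsUnit (θ k : Module.End K (Model n μ)) := by
  let η : Module.End K (Model n μ) := ofVec fun u => (wt (u k))⁻¹ • vec u
  have hη : ∀ u, η (vec u) = (wt (u k))⁻¹ • vec u := by
    intro u
    refine ofVec_apply _ u fun h => ?_
    rw [vec_eq_zero h, smul_zero]
  refine ⟨⟨θ k, η, hom_ext fun τ => ?_, hom_ext fun τ => ?_⟩, rfl⟩
  · simp only [Module.End.mul_apply, hη, θ_vec, map_smul, smul_smul,
      inv_mul_cancel₀ (wt_ne_zero _), one_smul, Module.End.one_apply]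
  · simp only [Module.End.mul_apply, hη, θ_vec, map_smul, smul_smul,
      mul_inv_cancel₀ (wt_ne_zero _), one_smul, Module.End.one_apply]

variable (n μ) in
/-- The shift operator on the model. -/
def shiftData (hn : 0 < n) : ShiftData (affineData n μ hn) where
  Y := Y hn
  Y_theta k hk := by
    change Y hn * natExt θ (k + 1) = natExt θ k * Y hn
    rw [natExt_of_lt _ k (by omega), natExt_of_lt _ (k + 1) (by omega)]
    refine hom_ext fun τ => ?_
    simp only [Module.End.mul_apply, θ_vec, Y_vec, map_smul]
    rw [shiftW_of_lt _ _ (by simp only; omega)]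
    exact smul_comm _ _ _
  theta_Y := by
    change natExt θ (n - 1) * Y hn = q • (Y hn * natExt θ 0)
    rw [natExt_of_lt _ 0 hn, natExt_of_lt _ (n - 1) (by omega)]
    refine hom_ext fun τ => ?_
    simp only [Module.End.mul_apply, LinearMap.smul_apply, θ_vec, Y_vec, map_smul]
    rw [shiftW_last _ _ (by simp only; omega), wt_succ_fst]
    module
  Y_T k hk := by
    change Y hn * natExt T (k + 1) = natExt T k * Y hn
    rw [natExt_of_lt _ k (by omega), natExt_of_lt _ (k + 1) (by omega)]
    refine hom_ext fun τ => ?_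
    have n1 : (⟨0, hn⟩ : Fin n) ≠ lo ⟨k + 1, hk⟩ := by simp [Fin.ext_iff, lo_val]
    have n2 : (⟨0, hn⟩ : Fin n) ≠ hi ⟨k + 1, hk⟩ := by simp [Fin.ext_iff, hi_val]
    have e1 : ∀ u : Fin n → ℕ × ℤ, PSYT.shiftW u (lo ⟨k, by omega⟩) = u (lo ⟨k + 1, hk⟩) :=
      fun u => shiftW_of_lt u _ _
    have e2 : ∀ u : Fin n → ℕ × ℤ, PSYT.shiftW u (hi ⟨k, by omega⟩) = u (hi ⟨k + 1, hk⟩) :=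
      fun u => shiftW_of_lt u _ (by simp only [hi_val]; omega)
    have e3 : PSYT.shiftW (sw ⟨k + 1, hk⟩ τ.W) = sw ⟨k, by omega⟩ (PSYT.shiftW τ.W) := by
      funext j
      by_cases h1 : j = lo ⟨k, by omega⟩
      · rw [h1, e1, sw_lo, sw_lo, e2]
      · by_cases h2 : j = hi ⟨k, by omega⟩
        · rw [h2, e2, sw_hi, sw_hi, e1]
        · rw [sw_of_ne _ _ h1 h2]
          by_cases h3 : j.1 + 1 < n
          · rw [shiftW_of_lt _ _ h3, shiftW_of_lt _ _ h3, sw_of_ne]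
            · simp only [Ne, Fin.ext_iff, lo_val] at *; omega
            · simp only [Ne, Fin.ext_iff, hi_val] at *; omega
          · rw [shiftW_last _ _ (by omega), shiftW_last _ _ (by omega), sw_of_ne _ _ n1 n2]
    simp only [Module.End.mul_apply, T_vec, Y_vec, map_smul, map_add, sw_of_ne _ _ n1 n2, e1, e2,
      e3]
    module
  T_Y_Y M hM := by
    change natExt T M * (Y hn * Y hn) = Y hn * Y hn * natExt T 0
    rw [natExt_of_lt _ 0 (by omega), natExt_of_lt _ M (by omega)]
    refine hom_ext fun τ => ?_
    have e0 : ∀ u : Fin n → ℕ × ℤ, PSYT.shiftW u (lo ⟨0, by omega⟩) = u (hi ⟨0, by omega⟩) :=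
      fun u => shiftW_of_lt u _ (by simp only [lo_val]; omega)
    -- Two shifts move the first two positions to the last two and raise both exponents by one,
    -- which leaves the coefficients of T unchanged.
    have e1 : ∀ u : Fin n → ℕ × ℤ, PSYT.shiftW (PSYT.shiftW u) (lo ⟨M, by omega⟩) =
        ((u (lo ⟨0, by omega⟩)).1 + 1, (u (lo ⟨0, by omega⟩)).2) := by
      intro u
      rw [shiftW_of_lt _ _ (by simp only [lo_val]; omega),
        shiftW_last _ _ (by simp only [lo_val]; omega)]
      rfl
    have e2 : ∀ u : Fin n → ℕ × ℤ, PSYT.shiftW (PSYT.shiftW u) (hi ⟨M, by omega⟩) =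
        ((u (hi ⟨0, by omega⟩)).1 + 1, (u (hi ⟨0, by omega⟩)).2) := by
      intro u
      rw [shiftW_last _ _ (by simp only [hi_val]; omega)]
      exact congrArg (fun x : ℕ × ℤ => (x.1 + 1, x.2)) (e0 u)
    have e3 : PSYT.shiftW (PSYT.shiftW (sw ⟨0, by omega⟩ τ.W)) =
        sw ⟨M, by omega⟩ (PSYT.shiftW (PSYT.shiftW τ.W)) := by
      funext j
      by_cases h1 : j = lo ⟨M, by omega⟩
      · rw [h1, e1, sw_lo, sw_lo, e2]
      · by_cases h2 : j = hi ⟨M, by omega⟩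
        · rw [h2, e2, sw_hi, sw_hi, e1]
        · rw [sw_of_ne _ _ h1 h2]
          have h3 : j.1 + 1 + 1 < n := by
            simp only [Fin.ext_iff, hi_val, lo_val] at h1 h2; omega
          rw [shiftW_of_lt _ _ (by omega), shiftW_of_lt _ _ h3, shiftW_of_lt _ j (by omega),
            shiftW_of_lt _ _ h3, sw_of_ne]
          · simp [Fin.ext_iff, lo_val]
          · simp [Fin.ext_iff, hi_val]
    have e4 : (⟨0, hn⟩ : Fin n) = lo ⟨0, by omega⟩ := rfl
    simp only [Module.End.mul_apply, T_vec, Y_vec, map_smul, map_add, e0, e1, e2, e3, e4, sw_lo,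
      sw_hi, diagCoeff_shift, offCoeff_shift]
    module
  theta_unit := by
    change IsUnit (natExt θ 0)
    rw [natExt_of_lt _ 0 hn]
    exact isUnit_θ _

theorem exists_X : ∃ X : Fin n → Module.End K (Model n μ), (∀ a b, DahaRel T θ X a b → a = b) ∧
    ∀ hn k, X k = (shiftData n μ hn).X k.1 := by
  -- For n = 0 there are no indices, and only the affine relations need an argument.
  rcases Nat.eq_zero_or_pos n with rfl | hn
  · refine ⟨0, fun a b h => ?_, fun hn => absurd hn (lt_irrefl 0)⟩
    cases h with
    | affine h => exact affineRel _ _ h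
    | X_comm i => exact i.elim0
    | X_succ i => exact i.elim0
    | T_X i j => exact j.elim0
    | pi_X hn => exact absurd hn (lt_irrefl 0)
    | pi_X_last hn => exact absurd hn (lt_irrefl 0)
  · exact ⟨fun k => (shiftData n μ hn).X k.1,
      fun a b h => ShiftData.dahaRel hn T θ affineRel (shiftData n μ hn) h, fun _ _ => rfl⟩

end Model

/-! ### Equivariant maps out of quotients and induced modules -/

section Descent

variable {B N P : Type} [Ring B] [Algebra K B] [AddCommGroup N] [Module K N]
  [AddCommGroup P] [Module K P] [Module B P] [IsScalarTower K B P]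

/-- An equivariant map descends to a quotient. -/
theorem exists_descent (ρ : B →ₐ[K] Module.End K N) (L : P →ₗ[K] N)
    (hL : ∀ b x, L (b • x) = ρ b (L x)) (s : Set P) (hs : ∀ x ∈ s, L x = 0) :
    ∃ Φ : (P ⧸ Submodule.span B s) →ₗ[K] N,
      (∀ x, Φ (Submodule.Quotient.mk x) = L x) ∧ ∀ b v, Φ (b • v) = ρ b (Φ v) := by
  have h : (Submodule.span B s).restrictScalars K ≤ LinearMap.ker L := by
    intro x hx
    rw [Submodule.restrictScalars_mem] at hx
    rw [LinearMap.mem_ker]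
    induction hx using Submodule.span_induction with
    | mem x hx => exact hs x hx
    | zero => exact map_zero L
    | add x y _ _ hx hy => rw [map_add, hx, hy, add_zero]
    | smul b x _ hx => rw [hL, hx, map_zero]
  let Φ := ((Submodule.span B s).restrictScalars K).liftQ L h ∘ₗ
    (Submodule.Quotient.restrictScalarsEquiv K (Submodule.span B s)).symm.toLinearMap
  have hΦ : ∀ x, Φ (Submodule.Quotient.mk x) = L x := fun x => rfl
  refine ⟨Φ, hΦ, fun b v => ?_⟩
  obtain ⟨x, rfl⟩ := Submodule.Quotient.mk_surjective _ v
  rw [← Submodule.Quotient.mk_smul, hΦ, hΦ, hL]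

end Descent

section InducedMap

variable {A H B : Type} [Ring A] [Algebra K A] [Ring H] [Algebra K H] [Ring B] [Algebra K B]
  (f : A →ₐ[K] B) (g : A →ₐ[K] H) {M N : Type} [AddCommGroup M] [Module K M] [Module H M]
  [IsScalarTower K H M] [AddCommGroup N] [Module K N]

/-- The class of `1 ⊗ m` in the induced module. -/
def indOne (m : M) : IndPullback f g M := Submodule.Quotient.mk (TensorProduct.tmul K (1 : B) m)

theorem smul_indOne (b : B) (m : M) :
    b • indOne f g m = Submodule.Quotient.mk (TensorProduct.tmul K b m) := by
  rw [indOne, ← Submodule.Quotient.mk_smul, TensorProduct.smul_tmul', smul_eq_mul, mul_one]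

theorem smul_indOne_map (a : A) (m : M) : f a • indOne f g m = indOne f g (g a • m) := by
  rw [smul_indOne, indOne, Submodule.Quotient.eq]
  exact Submodule.subset_span ⟨1, a, m, by rw [one_mul]⟩

theorem indOne_add (m m' : M) : indOne f g (m + m') = indOne f g m + indOne f g m' := by
  rw [indOne, TensorProduct.tmul_add]
  rfl

theorem indOne_smul (c : K) (m : M) : indOne f g (c • m) = c • indOne f g m := by
  rw [indOne, TensorProduct.tmul_smul]
  rfl

/-- The universal property of induction. -/
theorem exists_indLift (ρ : B →ₐ[K] Module.End K N) (φ : M →ₗ[K] N)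
    (hφ : ∀ a m, φ (g a • m) = ρ (f a) (φ m)) :
    ∃ Φ : IndPullback f g M →ₗ[K] N,
      (∀ m, Φ (indOne f g m) = φ m) ∧ ∀ b v, Φ (b • v) = ρ b (Φ v) := by
  let L : TensorProduct K B M →ₗ[K] N :=
    TensorProduct.lift ((LinearMap.lcomp K N φ) ∘ₗ ρ.toLinearMap)
  have hL' : ∀ b m, L (TensorProduct.tmul K b m) = ρ b (φ m) := fun b m => rfl
  have hL : ∀ b x, L (b • x) = ρ b (L x) := by
    intro b x
    induction x using TensorProduct.induction_on with
    | zero => simp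
    | tmul c m => rw [TensorProduct.smul_tmul', hL', hL', smul_eq_mul, map_mul]; rfl
    | add x y hx hy => rw [smul_add, map_add, map_add, map_add, hx, hy]
  obtain ⟨Φ, h1, h2⟩ := exists_descent ρ L hL
    {x : TensorProduct K B M | ∃ (b : B) (a : A) (m : M),
      x = TensorProduct.tmul K (b * f a) m - TensorProduct.tmul K b (g a • m)} (by
    rintro x ⟨b, a, m, rfl⟩
    rw [map_sub, hL', hL', hφ, map_mul]
    exact sub_self _)
  refine ⟨Φ, fun m => ?_, h2⟩
  rw [indOne, h1, hL', map_one]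
  rfl

end InducedMap

section ThetaBar

variable {n : ℕ} {A B : Type} [Ring A] [Algebra K A] [Ring B] [Algebra K B]

theorem map_thetaBarAux (f : A →ₐ[K] B) (T : Fin (n - 1) → A) (k : ℕ) :
    f (thetaBarAux T k) = thetaBarAux (fun j => f (T j)) k := by
  induction k with
  | zero => exact map_one f
  | succ k ih =>
    rw [thetaBarAux, thetaBarAux]
    split_ifs with h
    · rw [map_smul, map_mul, map_mul, map_Tinv, ih]
    · exact map_zero f

theorem map_thetaBar (f : A →ₐ[K] B) (T : Fin (n - 1) → A) (k : Fin n) :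
    f (thetaBar T k) = thetaBar (fun j => f (T j)) k := map_thetaBarAux f T k.1

theorem map_phiBar (f : A →ₐ[K] B) (T : Fin (n - 1) → A) (i : Fin (n - 1)) :
    f (phiBar T i) = phiBar (fun j => f (T j)) i := by
  simp only [phiBar, map_sub, map_mul, map_tTinv, map_thetaBar]

end ThetaBar

/-! ### The map from the induced module to the model -/

namespace Model

variable {n : ℕ} {μ : YoungDiagram}

variable (n μ) in
/-- The span of the standard tableaux. -/
def standard : Submodule K (Model n μ) :=
  Submodule.span K (Set.range fun τ : SYT n μ => vec τ.toPSYT.W)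

theorem vec_mem_standard (τ : SYT n μ) : vec τ.toPSYT.W ∈ standard n μ :=
  Submodule.subset_span ⟨τ, rfl⟩

theorem _root_.VVMac.SYT.exists_swap (τ : SYT n μ) (i : Fin (n - 1))
    (h : Up (τ.toPSYT.W (lo i)) (τ.toPSYT.W (hi i)) ∨
      Up (τ.toPSYT.W (hi i)) (τ.toPSYT.W (lo i))) :
    ∃ σ : SYT n μ, PSYT.IsSwap i τ.toPSYT σ.toPSYT := by
  have h1 := τ.toPSYT.isSwap_swap i h
  obtain ⟨σ, hσ⟩ := (τ.toPSYT.swap i h).exists_toPSYT_eq fun k => by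
    rw [(h1.box k).2, SYT.w_toPSYT]
  exact ⟨σ, by rwa [hσ]⟩

/-- A swap permutes the exponents, so it keeps all of them zero. -/
theorem T_mem_standard (i : Fin (n - 1)) {v : Model n μ} (hv : v ∈ standard n μ) :
    T i v ∈ standard n μ := by
  induction hv using Submodule.span_induction with
  | mem x hx =>
    obtain ⟨τ, rfl⟩ := hx
    simp only [T_vec]
    refine add_mem (Submodule.smul_mem _ _ (vec_mem_standard τ)) ?_
    by_cases h : Up (τ.toPSYT.W (lo i)) (τ.toPSYT.W (hi i)) ∨
      Up (τ.toPSYT.W (hi i)) (τ.toPSYT.W (lo i))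
    · obtain ⟨σ, hσ⟩ := τ.exists_swap i h
      rw [sw, ← hσ.W]
      exact Submodule.smul_mem _ _ (vec_mem_standard σ)
    · rw [offCoeff_of_not (fun h' => h (.inl h')) (fun h' => h (.inr h')), zero_smul]
      exact zero_mem _
  | zero => rw [map_zero]; exact zero_mem _
  | add x y _ _ hx hy => rw [map_add]; exact add_mem hx hy
  | smul c x _ hx => rw [map_smul]; exact Submodule.smul_mem _ _ hx

theorem tTinv_mem_standard (i : Fin (n - 1)) {v : Model n μ} (hv : v ∈ standard n μ) :
    tTinv T i v ∈ standard n μ :=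
  add_mem (T_mem_standard i hv) (Submodule.smul_mem _ _ hv)

theorem Tinv_mem_standard (i : Fin (n - 1)) {v : Model n μ} (hv : v ∈ standard n μ) :
    Tinv T i v ∈ standard n μ :=
  Submodule.smul_mem _ _ (tTinv_mem_standard i hv)

/-- On standard tableaux the label 1 has content and exponent 0, so θ_1 acts as the identity, as
θ̄_1 does; from there both families obey the same recursion, and the span is stable under it. -/
theorem thetaBarAux_apply (k : ℕ) (hk : k < n) {v : Model n μ} (hv : v ∈ standard n μ) :
    thetaBarAux T k v = θ ⟨k, hk⟩ v := by
  induction k generalizing v with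
  | zero =>
    change v = θ ⟨0, hk⟩ v
    induction hv using Submodule.span_induction with
    | mem x hx =>
      obtain ⟨τ, rfl⟩ := hx
      have : wt (τ.toPSYT.W ⟨0, hk⟩) = 1 := by
        simp [PSYT.W, τ.c_zero hk, SYT.w_toPSYT, wt]
      simp only [θ_vec, this, one_smul]
    | zero => rw [map_zero]
    | add x y _ _ hx hy => rw [map_add, ← hx, ← hy]
    | smul c x _ hx => rw [map_smul, ← hx]
  | succ k ih =>
    have h := affineRel (n := n) (μ := μ) _ _ (.theta_succ ⟨k, by omega⟩)
    rw [thetaBarAux_succ k (by omega)]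
    change _ = θ (hi ⟨k, by omega⟩) v
    rw [h]
    simp only [LinearMap.smul_apply, Module.End.mul_apply]
    rw [ih _ (Tinv_mem_standard _ hv)]
    rfl

theorem thetaBar_apply (k : Fin n) {v : Model n μ} (hv : v ∈ standard n μ) :
    thetaBar T k v = θ k v := thetaBarAux_apply k.1 k.2 hv

variable (n μ) in
/-- The action of the finite Hecke algebra on the model. -/
def heckeRep : Hecke n →ₐ[K] Module.End K (Model n μ) := Hecke.lift T satHecke

theorem heckeRep_T (i : Fin (n - 1)) : heckeRep n μ (Hecke.T i) = T i := Hecke.lift_T _ i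

theorem heckeRep_thetaBar (k : Fin n) {v : Model n μ} (hv : v ∈ standard n μ) :
    heckeRep n μ (thetaBar Hecke.T k) v = θ k v := by
  rw [map_thetaBar (B := Module.End K (Model n μ)) (heckeRep n μ) Hecke.T k]
  simp only [heckeRep_T]
  exact thetaBar_apply k hv

theorem heckeRep_mem_standard (h : Hecke n) {v : Model n μ} (hv : v ∈ standard n μ) :
    heckeRep n μ h v ∈ standard n μ := by
  induction h using Presented.induction generalizing v with
  | halg k =>
    rw [AlgHom.commutes]
    exact Submodule.smul_mem _ _ hv
  | hgen i =>
    change heckeRep n μ (Hecke.T i) v ∈ _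
    rw [heckeRep_T]
    exact T_mem_standard i hv
  | hmul a b ha hb => rw [map_mul]; exact ha (hb hv)
  | hadd a b ha hb => rw [map_add]; exact add_mem (ha hv) (hb hv)

theorem θ_vec_standard (k : Fin n) (τ : SYT n μ) :
    θ k (vec τ.toPSYT.W : Model n μ) = (t ^ τ.toPSYT.c k) • vec τ.toPSYT.W := by
  rw [θ_vec]
  simp [PSYT.W, SYT.w_toPSYT, wt]

theorem diagCoeff_row (w : ℕ) (c : ℤ) : diagCoeff (w, c) (w, c + 1) = 1 := by
  have h1 : (1 - t) * wt (w, c) ≠ 0 :=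
    mul_ne_zero (sub_ne_zero.2 t_ne_one.symm) (wt_ne_zero _)
  rw [diagCoeff, wt_succ_snd, show wt (w, c) - t * wt (w, c) = (1 - t) * wt (w, c) by ring,
    div_self h1]

theorem diagCoeff_col (w : ℕ) (c : ℤ) : diagCoeff (w, c + 1) (w, c) = -t := by
  have h := diagCoeff_add (u := (w, c)) (v := (w, c + 1)) (by simp)
  rw [diagCoeff_row] at h
  linear_combination h

/-- The image is kept inside `standard` because θ̄_k has been identified with θ_k only there. -/
theorem exists_spechtMap : ∃ φ : Specht n μ →ₗ[K] Model n μ,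
    (∀ τ, φ (Specht.of τ) = vec τ.toPSYT.W) ∧ (∀ h m, φ (h • m) = heckeRep n μ h (φ m)) ∧
    ∀ m, φ m ∈ standard n μ := by
  let L : (SYT n μ →₀ Hecke n) →ₗ[K] Model n μ := Finsupp.lsum K fun τ : SYT n μ =>
    (LinearMap.applyₗ (vec τ.toPSYT.W : Model n μ)) ∘ₗ (heckeRep n μ).toLinearMap
  have hL' : ∀ τ h, L (Finsupp.single τ h) = heckeRep n μ h (vec τ.toPSYT.W) := by
    intro τ h
    simp [L]
  have hL : ∀ h x, L (h • x) = heckeRep n μ h (L x) := by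
    intro h x
    induction x using Finsupp.induction_linear with
    | zero => simp
    | add x y hx hy => rw [smul_add, map_add, map_add, map_add, hx, hy]
    | single τ k => rw [Finsupp.smul_single, hL', hL', smul_eq_mul, map_mul]; rfl
  have hb : ∀ τ, L (basisVec τ) = vec τ.toPSYT.W := fun τ => by
    rw [basisVec, hL', map_one]; rfl
  have hphi : ∀ i, heckeRep n μ (phiBar Hecke.T i) = phiBar T i := by
    intro i
    rw [map_phiBar (B := Module.End K (Model n μ)) (heckeRep n μ) Hecke.T i]
    simp only [heckeRep_T]
  obtain ⟨φ, h1, h2⟩ := exists_descent (heckeRep n μ) L hL {x | SpechtRel n μ x} (by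
    intro x hx
    cases hx with
    | theta k τ =>
      rw [map_sub, hL, hb, heckeRep_thetaBar k (vec_mem_standard τ), map_smul, hb,
        θ_vec_standard, sub_self]
    -- In the commutator of t T_i⁻¹ with the diagonal θ_i the diagonal part cancels, and the
    -- coefficient 1 of σ gets multiplied by the difference of the two weights.
    | phi i τ σ h hlt =>
      have hup := h.up_of_lt hlt
      have hs : sw i τ.toPSYT.W = σ.toPSYT.W := h.W.symm
      rw [map_sub, hL, hb, map_smul, hb, hphi, phiBar]
      simp only [LinearMap.sub_apply, Module.End.mul_apply]
      rw [thetaBar_apply _ (vec_mem_standard τ), thetaBar_apply _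
        (tTinv_mem_standard i (vec_mem_standard τ))]
      simp only [tTinv, LinearMap.add_apply, Module.algebraMap_end_apply, T_vec, θ_vec, map_add,
        map_smul, offCoeff_of_up hup, hs]
      have e : ∀ k, wt (τ.toPSYT.W k) = t ^ τ.toPSYT.c k := by
        intro k
        simp [PSYT.W, SYT.w_toPSYT, wt]
      have e2 : wt (σ.toPSYT.W (lo i)) = wt (τ.toPSYT.W (hi i)) := by
        rw [← hs, sw_lo]
      simp only [e2, e]
      module
    | row i τ h =>
      have h1 := τ.toPSYT.consecutive_cases i rfl
      have h2 : τ.toPSYT.W (hi i) = ((τ.toPSYT.W (lo i)).1, (τ.toPSYT.W (lo i)).2 + 1) := by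
        simp only [PSYT.W, SYT.w_toPSYT, PSYT.c, content, Prod.mk.injEq, true_and]
        omega
      have h3 : offCoeff (τ.toPSYT.W (lo i)) (τ.toPSYT.W (hi i)) = 0 := by
        rw [h2]
        apply offCoeff_of_not <;> simp [Up]
      have h4 : diagCoeff (τ.toPSYT.W (lo i)) (τ.toPSYT.W (hi i)) = 1 := by
        rw [h2]
        exact diagCoeff_row _ _
      rw [map_sub, hL, hb, heckeRep_T, T_vec, h3, h4, zero_smul, add_zero, one_smul, sub_self]
    | col i τ h =>
      have h1 := τ.toPSYT.consecutive_cases i rfl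
      have h2 : τ.toPSYT.W (lo i) = ((τ.toPSYT.W (hi i)).1, (τ.toPSYT.W (hi i)).2 + 1) := by
        simp only [PSYT.W, SYT.w_toPSYT, PSYT.c, content, Prod.mk.injEq, true_and]
        omega
      have h3 : offCoeff (τ.toPSYT.W (lo i)) (τ.toPSYT.W (hi i)) = 0 := by
        rw [h2]
        apply offCoeff_of_not <;> simp [Up]
      have h4 : diagCoeff (τ.toPSYT.W (lo i)) (τ.toPSYT.W (hi i)) = -t := by
        rw [h2]
        exact diagCoeff_col _ _
      rw [map_add, hL, hb, heckeRep_T, map_smul, hb, T_vec, h3, h4, zero_smul, add_zero]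
      module)
  refine ⟨φ, fun τ => by rw [Specht.of, h1, hb], h2, fun m => ?_⟩
  obtain ⟨x, rfl⟩ := Submodule.Quotient.mk_surjective _ m
  rw [h1]
  induction x using Finsupp.induction_linear with
  | zero => rw [map_zero]; exact zero_mem _
  | add x y hx hy => rw [map_add]; exact add_mem hx hy
  | single τ k => rw [hL']; exact heckeRep_mem_standard k (vec_mem_standard τ)

/-- The model as a quotient of the induced module. -/
theorem exists_map (X : Fin n → Module.End K (Model n μ)) (H : ∀ a b, DahaRel T θ X a b → a = b) :
    ∃ Φ : V n μ →ₗ[K] Model n μ, (∀ τ, Φ (oneTmul τ) = vec τ.toPSYT.W) ∧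
      ∀ b v, Φ (b • v) = Daha.lift T θ X H b (Φ v) := by
  obtain ⟨φ, h1, h2, h3⟩ := exists_spechtMap (n := n) (μ := μ)
  -- On the standard span the affine algebra acts in the same way through ρ_n and through the double
  -- affine algebra, which is the compatibility that induction asks for.
  have key : ∀ a : Affine n, ∀ v ∈ standard n μ,
      heckeRep n μ (rho n a) v = Daha.lift T θ X H (affineToDaha n a) v := by
    intro a
    induction a using Presented.induction with
    | halg k => intro v hv; simp only [AlgHom.commutes]
    | hgen g =>
      intro v hv
      cases g with
      | T i =>
        change heckeRep n μ (rho n (Affine.T i)) v =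
          Daha.lift T θ X H (affineToDaha n (Affine.T i)) v
        rw [rho_T, affineToDaha_T, heckeRep_T, Daha.lift_T]
      | θ k =>
        change heckeRep n μ (rho n (Affine.θ k)) v =
          Daha.lift T θ X H (affineToDaha n (Affine.θ k)) v
        rw [rho_θ, affineToDaha_θ, heckeRep_thetaBar k hv, Daha.lift_θ]
    | hmul a b ha hb =>
      intro v hv
      simp only [map_mul, Module.End.mul_apply]
      rw [ha _ (heckeRep_mem_standard _ hv), hb v hv]
    | hadd a b ha hb =>
      intro v hv
      simp only [map_add, LinearMap.add_apply]
      rw [ha v hv, hb v hv]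
  obtain ⟨Φ, h4, h5⟩ := exists_indLift (affineToDaha n) (rho n) (Daha.lift T θ X H) φ
    (fun a m => by rw [h2, key a _ (h3 m)])
  exact ⟨Φ, fun τ => by rw [← h1]; exact h4 _, h5⟩

end Model

/-! ### The degree filtration of the induced module -/

section Stabilizer

variable {B P : Type} [Ring B] [Algebra K B] [AddCommGroup P] [Module K P] [Module B P]
  [IsScalarTower K B P]

/-- The subalgebra of elements preserving a subspace. -/
def stab (U : Submodule K P) : Subalgebra K B where
  carrier := {b | ∀ v ∈ U, b • v ∈ U}
  mul_mem' ha hb v hv := by rw [mul_smul]; exact ha _ (hb v hv)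
  add_mem' ha hb v hv := by rw [add_smul]; exact add_mem (ha v hv) (hb v hv)
  algebraMap_mem' c v hv := by rw [algebraMap_smul]; exact Submodule.smul_mem _ _ hv

theorem mem_stab_span {s : Set P} {b : B} (h : ∀ v ∈ s, b • v ∈ Submodule.span K s) :
    b ∈ stab (Submodule.span K s) := by
  intro v hv
  induction hv using Submodule.span_induction with
  | mem x hx => exact h x hx
  | zero => rw [smul_zero]; exact zero_mem _
  | add x y _ _ hx hy => rw [smul_add]; exact add_mem hx hy
  | smul c x _ hx => rw [smul_comm]; exact Submodule.smul_mem _ _ hx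

end Stabilizer

namespace V

variable {n : ℕ} {μ : YoungDiagram}

theorem oneTmul_eq (τ : SYT n μ) :
    oneTmul τ = indOne (affineToDaha n) (rho n) (Specht.of τ) := rfl

theorem T_theta_hi {A : Type} [Ring A] [Algebra K A] {T : Fin (n - 1) → A} {θ : Fin n → A}
    (H : ∀ a b, AffineRel T θ a b → a = b) (i : Fin (n - 1)) :
    T i * θ (hi i) = θ (lo i) * tTinv T i := by
  rw [H _ _ (.theta_succ i), mul_smul_comm, ← mul_assoc, ← mul_assoc,
    T_mul_Tinv fun a b h => H a b (.hecke h), one_mul, Tinv, mul_smul_comm, smul_smul,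
    mul_inv_cancel₀ t_ne_zero, one_smul]

theorem theta_smul_oneTmul (k : Fin n) (τ : SYT n μ) :
    (Daha.θ k : Daha n) • (oneTmul τ : V n μ) = wt (τ.toPSYT.W k) • oneTmul τ := by
  have h : thetaBar Hecke.T k • Specht.of τ = (t ^ τ.toPSYT.c k) • Specht.of τ := by
    have := (Submodule.Quotient.mk_eq_zero _).2 (Submodule.subset_span (SpechtRel.theta k τ) :
      _ ∈ Submodule.span (Hecke n) {x | SpechtRel n μ x})
    rw [Submodule.Quotient.mk_sub, sub_eq_zero] at this
    exact this
  rw [oneTmul_eq, ← affineToDaha_θ, smul_indOne_map, rho_θ, h, indOne_smul]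
  congr 1
  simp [wt, PSYT.W, SYT.w_toPSYT]

/-- After θ_i (t T_i⁻¹) is rewritten as T_i θ_{i+1}, the φ̄-relation becomes a linear equation for
T_i (1 ⊗ τ) whose leading coefficient is the nonzero difference of the two weights. -/
theorem T_smul_oneTmul_of_up (i : Fin (n - 1)) {τ σ : SYT n μ}
    (h : PSYT.IsSwap i τ.toPSYT σ.toPSYT) (hup : Up (τ.toPSYT.W (lo i)) (τ.toPSYT.W (hi i))) :
    (Daha.T i : Daha n) • (oneTmul τ : V n μ) =
      diagCoeff (τ.toPSYT.W (lo i)) (τ.toPSYT.W (hi i)) • oneTmul τ + oneTmul σ := by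
  have h1 : phiBar Hecke.T i • Specht.of τ =
      (wt (τ.toPSYT.W (lo i)) - wt (τ.toPSYT.W (hi i))) • Specht.of σ := by
    have := (Submodule.Quotient.mk_eq_zero _).2
      (Submodule.subset_span (SpechtRel.phi i τ σ h (h.lt hup)) :
      _ ∈ Submodule.span (Hecke n) {x | SpechtRel n μ x})
    rw [Submodule.Quotient.mk_sub, sub_eq_zero] at this
    refine Eq.trans this ?_
    have e : ∀ k, wt (τ.toPSYT.W k) = t ^ τ.toPSYT.c k := by
      intro k
      simp [PSYT.W, SYT.w_toPSYT, wt]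
    rw [e, e]
    rfl
  have h2 : rho n (tTinv Affine.T i * Affine.θ (lo i) - Affine.θ (lo i) * tTinv Affine.T i) =
      phiBar Hecke.T i := by
    simp only [map_sub, map_mul, map_tTinv, rho_T, rho_θ, phiBar]
  have h3 : affineToDaha n
      (tTinv Affine.T i * Affine.θ (lo i) - Affine.θ (lo i) * tTinv Affine.T i) =
      tTinv Daha.T i * Daha.θ (lo i) - Daha.T i * Daha.θ (hi i) := by
    rw [T_theta_hi (fun a b h => Daha.affineRel h)]
    simp only [map_sub, map_mul, map_tTinv, affineToDaha_T, affineToDaha_θ]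
  have h4 := smul_indOne_map (affineToDaha n) (rho n)
    (tTinv Affine.T i * Affine.θ (lo i) - Affine.θ (lo i) * tTinv Affine.T i) (Specht.of τ)
  rw [h2, h3, h1, indOne_smul, ← oneTmul_eq, ← oneTmul_eq, sub_smul, mul_smul, mul_smul,
    theta_smul_oneTmul, theta_smul_oneTmul, tTinv, add_smul, algebraMap_smul] at h4
  simp only [smul_comm (Daha.T i : Daha n)] at h4
  have hne : wt (τ.toPSYT.W (lo i)) - wt (τ.toPSYT.W (hi i)) ≠ 0 :=
    sub_ne_zero.2 fun e => τ.toPSYT.W_lo_ne_hi i (wt_injective e)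
  refine smul_right_injective (V n μ) hne ?_
  simp only [smul_add, smul_smul, diagCoeff, mul_div_cancel₀ _ hne, ← h4]
  generalize (Daha.T i : Daha n) • (oneTmul τ : V n μ) = w
  module

theorem T_smul_oneTmul_mem (i : Fin (n - 1)) (τ : SYT n μ) :
    (Daha.T i : Daha n) • (oneTmul τ : V n μ) ∈ Submodule.span K (Set.range oneTmul) := by
  have hmem : ∀ σ : SYT n μ, oneTmul σ ∈ Submodule.span K (Set.range (oneTmul (n := n) (μ := μ))) :=
    fun σ => Submodule.subset_span ⟨σ, rfl⟩
  have hT : ∀ m : Specht n μ, (Daha.T i : Daha n) • indOne (affineToDaha n) (rho n) m =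
      indOne (affineToDaha n) (rho n) ((Hecke.T i : Hecke n) • m) := by
    intro m
    rw [← affineToDaha_T, smul_indOne_map, rho_T]
  rcases τ.toPSYT.up_or_adjacent i with h | h | ⟨-, h | h⟩
  · obtain ⟨σ, hσ⟩ := τ.exists_swap i (.inl h)
    rw [T_smul_oneTmul_of_up i hσ h]
    exact add_mem (Submodule.smul_mem _ _ (hmem τ)) (hmem σ)
  -- Along a descent, τ is T_i σ minus a multiple of σ, so T_i τ follows from the quadratic
  -- relation.
  · obtain ⟨σ, hσ⟩ := τ.exists_swap i (.inr h)
    have h1 := T_smul_oneTmul_of_up i hσ.symm (by rw [hσ.W]; simpa using h)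
    have h2 : oneTmul τ = (Daha.T i : Daha n) • (oneTmul σ : V n μ) -
        diagCoeff (σ.toPSYT.W (lo i)) (σ.toPSYT.W (hi i)) • oneTmul σ := by
      rw [h1]; abel
    have h3 : (Daha.T i : Daha n) • (oneTmul σ : V n μ) ∈
        Submodule.span K (Set.range (oneTmul (n := n) (μ := μ))) := by
      rw [h1]
      exact add_mem (Submodule.smul_mem _ _ (hmem σ)) (hmem τ)
    have h4 : (Daha.T i : Daha n) * Daha.T i =
        algebraMap K _ (1 - t) * Daha.T i + algebraMap K _ t := by
      have h5 := Daha.satHecke n _ _ (.quad i)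
      rw [sub_mul, one_mul, mul_add, ← Algebra.commutes] at h5
      rw [map_sub, map_one, sub_mul, one_mul]
      rw [← sub_eq_zero, ← h5]
      abel
    rw [h2, smul_sub, smul_smul, h4, add_smul, mul_smul, algebraMap_smul, algebraMap_smul,
      smul_comm (Daha.T i : Daha n)]
    exact sub_mem (add_mem (Submodule.smul_mem _ _ h3) (Submodule.smul_mem _ _ (hmem σ)))
      (Submodule.smul_mem _ _ h3)
  · have h1 : (Hecke.T i : Hecke n) • Specht.of τ = Specht.of τ := by
      have := (Submodule.Quotient.mk_eq_zero _).2
        (Submodule.subset_span (SpechtRel.row i τ h.1.symm) :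
        _ ∈ Submodule.span (Hecke n) {x | SpechtRel n μ x})
      rw [Submodule.Quotient.mk_sub, sub_eq_zero] at this
      exact this
    rw [oneTmul_eq, hT, h1]
    exact hmem τ
  · have h1 : (Hecke.T i : Hecke n) • Specht.of τ = -(t • Specht.of τ) := by
      have := (Submodule.Quotient.mk_eq_zero _).2
        (Submodule.subset_span (SpechtRel.col i τ h.1.symm) :
        _ ∈ Submodule.span (Hecke n) {x | SpechtRel n μ x})
      rw [Submodule.Quotient.mk_add] at this
      exact eq_neg_of_add_eq_zero_left this
    rw [oneTmul_eq, hT, h1, ← neg_smul, indOne_smul]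
    exact Submodule.smul_mem _ _ (hmem τ)

/-- The vector `X^s ⊗ τ`. -/
def mono (s : Multiset (Fin n)) (τ : SYT n μ) : V n μ :=
  (s.toList.map Daha.X).prod • oneTmul τ

theorem X_smul_mono (k : Fin n) (s : Multiset (Fin n)) (τ : SYT n μ) :
    (Daha.X k : Daha n) • mono s τ = mono (k ::ₘ s) τ := by
  have hp : (k :: s.toList).Perm (k ::ₘ s).toList := by
    rw [← Multiset.coe_eq_coe, ← Multiset.cons_coe, Multiset.coe_toList, Multiset.coe_toList]
  have h := (hp.map (Daha.X (n := n))).prod_eq' (List.pairwise_map.2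
    (List.pairwise_of_forall fun j k => Daha.rel (.X_comm j k)))
  rw [mono, mono, smul_smul, ← h, List.map_cons, List.prod_cons]

theorem mono_zero (τ : SYT n μ) : mono 0 τ = oneTmul τ := by
  simp [mono]

variable (n μ) in
/-- The part of degree at most `d`. -/
def filt (d : ℕ) : Submodule K (V n μ) :=
  Submodule.span K {v | ∃ s : Multiset (Fin n), s.card ≤ d ∧ ∃ τ : SYT n μ, v = mono s τ}

theorem mono_mem {d : ℕ} {s : Multiset (Fin n)} (h : s.card ≤ d) (τ : SYT n μ) :
    mono s τ ∈ filt n μ d := Submodule.subset_span ⟨s, h, τ, rfl⟩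

theorem filt_mono {d e : ℕ} (h : d ≤ e) : filt n μ d ≤ filt n μ e :=
  Submodule.span_mono fun _ ⟨s, hs, τ, e⟩ => ⟨s, hs.trans h, τ, e⟩

theorem oneTmul_mem (d : ℕ) (τ : SYT n μ) : oneTmul τ ∈ filt n μ d := by
  rw [← mono_zero]
  exact mono_mem (Nat.zero_le _) τ

theorem X_smul_mem (k : Fin n) {d : ℕ} {v : V n μ} (hv : v ∈ filt n μ d) :
    (Daha.X k : Daha n) • v ∈ filt n μ (d + 1) := by
  induction hv using Submodule.span_induction with
  | mem x hx =>
    obtain ⟨s, hs, τ, rfl⟩ := hx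
    rw [X_smul_mono]
    exact mono_mem (by simpa using hs) τ
  | zero => rw [smul_zero]; exact zero_mem _
  | add x y _ _ hx hy => rw [smul_add]; exact add_mem hx hy
  | smul c x _ hx => rw [smul_comm]; exact Submodule.smul_mem _ _ hx

/-- An element preserves the filtration if it preserves its bottom and passes through the `X_k`. -/
theorem mem_stab_filt {b : Daha n}
    (h0 : ∀ τ : SYT n μ, b • (oneTmul τ : V n μ) ∈ filt n μ 0)
    (hX : ∀ d, b ∈ stab (filt n μ d) → ∀ k, ∀ v ∈ filt n μ d,
      b • (Daha.X k : Daha n) • v ∈ filt n μ (d + 1)) (d : ℕ) :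
    b ∈ stab (filt n μ d) := by
  induction d with
  | zero =>
    refine mem_stab_span ?_
    rintro v ⟨s, hs, τ, rfl⟩
    obtain rfl : s = 0 := Multiset.card_eq_zero.1 (Nat.le_zero.1 hs)
    rw [mono_zero]
    exact h0 τ
  | succ d ih =>
    refine mem_stab_span ?_
    rintro v ⟨s, hs, τ, rfl⟩
    induction s using Multiset.induction_on with
    | empty =>
      rw [mono_zero]
      exact filt_mono (Nat.zero_le _) (h0 τ)
    | cons k s _ =>
      rw [← X_smul_mono]
      exact hX d ih k _ (mono_mem (by simpa using hs) τ)

theorem X_hi_mul_T (i : Fin (n - 1)) :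
    (Daha.X (hi i) : Daha n) * Daha.T i = tTinv Daha.T i * Daha.X (lo i) := by
  rw [Daha.rel (.X_succ i), smul_mul_assoc, mul_assoc, Tinv_mul_T (Daha.satHecke n), mul_one,
    Tinv, smul_mul_assoc, smul_smul, mul_inv_cancel₀ t_ne_zero, one_smul]

theorem T_mul_X_hi (i : Fin (n - 1)) :
    (Daha.T i : Daha n) * Daha.X (hi i) = Daha.X (lo i) * tTinv Daha.T i := by
  rw [Daha.rel (.X_succ i), mul_smul_comm, ← mul_assoc, ← mul_assoc,
    T_mul_Tinv (Daha.satHecke n), one_mul, Tinv, mul_smul_comm, smul_smul,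
    mul_inv_cancel₀ t_ne_zero, one_smul]

theorem span_oneTmul_le : Submodule.span K (Set.range (oneTmul (n := n) (μ := μ))) ≤ filt n μ 0 := by
  rw [Submodule.span_le]
  rintro _ ⟨τ, rfl⟩
  exact oneTmul_mem 0 τ

/-- Moving T_i past any X_k leaves one X on the left of each term, followed by 1, T_i or t T_i⁻¹. -/
theorem T_mem_stab (i : Fin (n - 1)) (d : ℕ) : (Daha.T i : Daha n) ∈ stab (filt n μ d) := by
  refine mem_stab_filt (fun τ => span_oneTmul_le (T_smul_oneTmul_mem i τ))
    (fun d hd k v hv => ?_) d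
  have ht : tTinv Daha.T i ∈ stab (filt n μ d) := add_mem hd (Subalgebra.algebraMap_mem _ _)
  by_cases h1 : k = lo i
  · have h2 : (Daha.T i : Daha n) * Daha.X (lo i) =
        Daha.X (hi i) * Daha.T i - algebraMap K _ (t - 1) * Daha.X (lo i) := by
      rw [X_hi_mul_T, tTinv, add_mul]
      abel
    rw [smul_smul, h1, h2, sub_smul, mul_smul, mul_smul, algebraMap_smul]
    exact sub_mem (X_smul_mem _ (hd v hv)) (Submodule.smul_mem _ _ (X_smul_mem _ hv))
  · by_cases h2 : k = hi i
    · rw [smul_smul, h2, T_mul_X_hi, mul_smul]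
      exact X_smul_mem _ (ht v hv)
    · rw [smul_smul, Daha.rel (.T_X i k h1 h2), mul_smul]
      exact X_smul_mem _ (hd v hv)

theorem Tinv_mem_stab (i : Fin (n - 1)) (d : ℕ) :
    (Tinv Daha.T i : Daha n) ∈ stab (filt n μ d) :=
  Subalgebra.smul_mem _ (add_mem (T_mem_stab i d) (Subalgebra.algebraMap_mem _ _)) _

theorem theta_mem_stab_zero (k : Fin n) : (Daha.θ k : Daha n) ∈ stab (filt n μ 0) := by
  refine mem_stab_span ?_
  rintro v ⟨s, hs, τ, rfl⟩
  obtain rfl : s = 0 := Multiset.card_eq_zero.1 (Nat.le_zero.1 hs)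
  rw [mono_zero, theta_smul_oneTmul]
  exact Submodule.smul_mem _ _ (oneTmul_mem 0 τ)

/-- π permutes the X_k cyclically up to the factor q, and at the bottom it is a product of θ_1 and
inverses of the T_i. -/
theorem pi_mem_stab (hn : 0 < n) (d : ℕ) : (Daha.pi hn : Daha n) ∈ stab (filt n μ d) := by
  refine mem_stab_filt (fun τ => ?_) (fun d hd k v hv => ?_) d
  · have h : (Daha.pi hn : Daha n) ∈ stab (filt n μ 0) := by
      refine Subalgebra.smul_mem _ (mul_mem (theta_mem_stab_zero _) (list_prod_mem ?_)) _
      intro x hx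
      obtain ⟨i, rfl⟩ := (List.mem_ofFn' _ _).1 hx
      exact Tinv_mem_stab i 0
    exact h _ (oneTmul_mem 0 τ)
  · rw [smul_smul]
    by_cases h : k.1 + 1 < n
    · have h1 : (Daha.pi hn : Daha n) * Daha.X k =
          Daha.X (hi ⟨k.1, by omega⟩) * Daha.pi hn := Daha.rel (.pi_X hn ⟨k.1, by omega⟩)
      rw [h1, mul_smul]
      exact X_smul_mem _ (hd v hv)
    · have h1 : (Daha.pi hn : Daha n) * Daha.X k = q • (Daha.X ⟨0, hn⟩ * Daha.pi hn) := by
        have e : k = ⟨n - 1, by omega⟩ := Fin.ext (by simp only; omega)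
        rw [e]
        exact Daha.rel (.pi_X_last hn)
      rw [h1, smul_assoc, mul_smul]
      exact Submodule.smul_mem _ _ (X_smul_mem _ (hd v hv))

/-- No defining relation moves a single θ_k directly past an X_j. Instead θ_1 is recovered from π by
multiplying by T's on the right, and the other θ_k follow by their recursion. -/
theorem theta_mem_stab (k : Fin n) (d : ℕ) : (Daha.θ k : Daha n) ∈ stab (filt n μ d) := by
  have hn : 0 < n := k.pos
  let D := AffineData.ofFin hn Daha.T Daha.θ (fun a b h => Daha.affineRel h)
  have hpi : D.pi = Daha.pi hn := AffineData.pi_ofFin hn _ _ _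
  have hT : ∀ j (h : j < n - 1), D.T j = Daha.T ⟨j, h⟩ := fun j h => natExt_of_lt _ j h
  -- Downward from the full product, which is π up to a scalar, each T_m removes one factor R_m.
  have h0 : ∀ m ≤ n - 1, D.θ 0 * D.seg 0 m ∈ stab (filt n μ d) := by
    intro m hm
    refine ShiftData.down_induction (P := fun m => D.θ 0 * D.seg 0 m ∈ stab (filt n μ d))
      ?_ (fun m hm ih => ?_) m hm
    · have h1 := Subalgebra.smul_mem _ (pi_mem_stab (μ := μ) hn d) (t ^ (n - 1))⁻¹
      rwa [← hpi, AffineData.pi, smul_smul, inv_mul_cancel₀ (pow_ne_zero _ t_ne_zero),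
        one_smul] at h1
    · have h1 := mul_mem ih (T_mem_stab (μ := μ) ⟨m, hm⟩ d)
      rwa [AffineData.seg, ← hT m hm, zero_add, mul_assoc, mul_assoc, D.R_T m hm, mul_one] at h1
  have h1 : ∀ j (h : j < n), (Daha.θ ⟨j, h⟩ : Daha n) ∈ stab (filt n μ d) := by
    intro j hj
    induction j with
    | zero =>
      have h2 := h0 0 (Nat.zero_le _)
      rw [AffineData.seg, mul_one] at h2
      convert h2 using 1
      exact (natExt_of_lt _ 0 hn).symm
    | succ j ih =>
      have h2 : (Daha.θ (hi ⟨j, by omega⟩) : Daha n) = _ :=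
        Daha.affineRel (.theta_succ ⟨j, by omega⟩)
      change Daha.θ (hi ⟨j, by omega⟩) ∈ _
      rw [h2]
      exact Subalgebra.smul_mem _ (mul_mem (mul_mem (Tinv_mem_stab _ d) (ih (by omega)))
        (Tinv_mem_stab _ d)) _
  exact h1 k.1 k.2

theorem exists_mem_filt (v : V n μ) : ∃ d, v ∈ filt n μ d := by
  have hdir : Directed (· ≤ ·) (filt n μ) := directed_of_isDirected_le fun _ _ => filt_mono
  rw [← Submodule.mem_iSup_of_directed _ hdir]
  have hall : ∀ b : Daha n, b ∈ stab (⨆ d, filt n μ d) := by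
    intro b
    induction b using Presented.induction with
    | halg k => exact Subalgebra.algebraMap_mem _ _
    | hgen g =>
      intro v hv
      rw [Submodule.mem_iSup_of_directed _ hdir] at hv ⊢
      obtain ⟨d, hd⟩ := hv
      cases g with
      | T i => exact ⟨d, T_mem_stab i d v hd⟩
      | θ k => exact ⟨d, theta_mem_stab k d v hd⟩
      | X k => exact ⟨d + 1, X_smul_mem k hd⟩
    | hmul a b ha hb => exact mul_mem ha hb
    | hadd a b ha hb => exact add_mem ha hb
  -- Surjectivity of ρ_n lets Hecke coefficients of τ be moved to the left tensor factor, so the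
  -- vectors 1 ⊗ τ generate.
  have hrho : ∀ h : Hecke n, ∃ a : Affine n, rho n a = h := by
    intro h
    induction h using Presented.induction with
    | halg k => exact ⟨algebraMap K _ k, AlgHom.commutes _ _⟩
    | hgen i => exact ⟨Affine.T i, rho_T i⟩
    | hmul a b ha hb =>
      obtain ⟨a, rfl⟩ := ha
      obtain ⟨b, rfl⟩ := hb
      exact ⟨a * b, map_mul _ _ _⟩
    | hadd a b ha hb =>
      obtain ⟨a, rfl⟩ := ha
      obtain ⟨b, rfl⟩ := hb
      exact ⟨a + b, map_add _ _ _⟩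
  have hone : ∀ m : Specht n μ, indOne (affineToDaha n) (rho n) m ∈ ⨆ d, filt n μ d := by
    intro m
    obtain ⟨x, rfl⟩ := Submodule.Quotient.mk_surjective _ m
    induction x using Finsupp.induction_linear with
    | zero =>
      have := indOne_smul (affineToDaha n) (rho n) (0 : K) (0 : Specht n μ)
      rw [zero_smul, zero_smul] at this
      rw [Submodule.Quotient.mk_zero, this]
      exact zero_mem _
    | add x y hx hy =>
      rw [Submodule.Quotient.mk_add, indOne_add]
      exact add_mem hx hy
    | single τ h =>
      obtain ⟨a, rfl⟩ := hrho h
      have e : (Submodule.Quotient.mk (Finsupp.single τ (rho n a)) : Specht n μ) =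
          rho n a • Specht.of τ := by
        rw [Specht.of, ← Submodule.Quotient.mk_smul, basisVec, Finsupp.smul_single, smul_eq_mul,
          mul_one]
      rw [e, ← smul_indOne_map]
      exact hall _ _ (Submodule.mem_iSup_of_mem 0 (oneTmul_mem 0 τ))
  obtain ⟨x, rfl⟩ := Submodule.Quotient.mk_surjective _ v
  induction x using TensorProduct.induction_on with
  | zero => exact zero_mem _
  | tmul b m =>
    rw [← smul_indOne]
    exact hall b _ (hone m)
  | add x y hx hy =>
    rw [Submodule.Quotient.mk_add]
    exact add_mem hx hy

end V

/-! ### Bijectivity by counting dimensions -/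

namespace Model

variable {n : ℕ} {μ : YoungDiagram}

theorem mem_of_segT {N : ℕ} {M : Type} [AddCommGroup M] [Module K M]
    (D : AffineData (Module.End K M) N) {U : Submodule K M}
    (hR : ∀ k < N, ∀ v ∈ U, D.R k v ∈ U) (a m : ℕ) (ham : a + m ≤ N) {v : M}
    (hv : D.segT a m v ∈ U) : v ∈ U := by
  induction m generalizing a with
  | zero => exact hv
  | succ m ih =>
    refine ih (a + 1) (by omega) ?_
    have h := hR a (by omega) _ hv
    rwa [AffineData.segT, Module.End.mul_apply, ← Module.End.mul_apply, D.R_T a (by omega)] at h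

variable {X : Fin n → Module.End K (Model n μ)} {H : ∀ a b, DahaRel T θ X a b → a = b}
  {Φ : V n μ →ₗ[K] Model n μ}

/-- Every basis vector of degree at most `d` comes from the `d`-th filtration step. -/
theorem vec_mem_map (hX : ∀ hn k, X k = (shiftData n μ hn).X k.1)
    (h1 : ∀ τ, Φ (oneTmul τ) = vec τ.toPSYT.W)
    (h2 : ∀ b v, Φ (b • v) = Daha.lift T θ X H b (Φ v)) (d : ℕ) (τ : PSYT n μ) (hτ : τ.deg ≤ d) :
    vec τ.W ∈ (V.filt n μ d).map Φ := by
  induction d using Nat.strong_induction_on generalizing τ with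
  | _ d ihd =>
  have hT : ∀ i, ∀ v ∈ (V.filt n μ d).map Φ, T i v ∈ (V.filt n μ d).map Φ := by
    rintro i _ ⟨v, hv, rfl⟩
    exact ⟨(Daha.T i : Daha n) • v, V.T_mem_stab i d v hv, by rw [h2, Daha.lift_T]⟩
  by_cases h0 : ∀ i, τ.w i = 0
  · obtain ⟨σ, rfl⟩ := τ.exists_toPSYT_eq h0
    exact ⟨oneTmul σ, V.oneTmul_mem d σ, h1 σ⟩
  push Not at h0
  obtain ⟨j, hj⟩ := h0
  have hn : 0 < n := j.pos
  -- Inside a fixed degree, induction on the distance from a label with nonzero exponent to the last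
  -- label.
  obtain ⟨m, hm⟩ : ∃ m, j.1 + m = n - 1 := ⟨n - 1 - j.1, by omega⟩
  induction m generalizing τ j with
  | zero =>
    have hj' : 0 < τ.w ⟨n - 1, by omega⟩ := by
      rw [show (⟨n - 1, by omega⟩ : Fin n) = j from Fin.ext hm.symm]
      exact Nat.pos_of_ne_zero hj
    obtain ⟨σ, rfl⟩ := τ.exists_Psi_eq hn hj'
    rw [PSYT.deg_Psi hn] at hτ
    obtain ⟨e, rfl⟩ : ∃ e, d = e + 1 := ⟨d - 1, by omega⟩
    obtain ⟨v, hv, hv'⟩ := ihd e (Nat.lt_succ_self e) σ (by omega)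
    -- Here τ = Ψ(σ) with σ of smaller degree. X_1 equals T_1 ⋯ T_{n-1} Y θ_1, and its value at the
    -- vector of σ lies in the image; stripping off the T's leaves a nonzero multiple of the vector
    -- of τ.
    have h3 : (affineData n μ hn).segT 0 (n - 1) (Y hn (θ ⟨0, hn⟩ (vec σ.W))) ∈
        (V.filt n μ (e + 1)).map Φ := by
      refine ⟨(Daha.X ⟨0, hn⟩ : Daha n) • v, V.X_smul_mem _ hv, ?_⟩
      rw [h2, Daha.lift_X, hv', hX hn, ShiftData.X_zero]
      change (_ * Y hn * natExt θ 0 : Module.End K (Model n μ)) (vec σ.W) = _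
      rw [natExt_of_lt _ 0 hn]
      rfl
    have h4 := mem_of_segT (affineData n μ hn) (U := (V.filt n μ (e + 1)).map Φ) (fun k hk => by
      rintro _ ⟨w, hw, rfl⟩
      refine ⟨Tinv Daha.T ⟨k, hk⟩ • w, V.Tinv_mem_stab _ _ w hw, ?_⟩
      rw [h2, map_Tinv (B := Module.End K (Model n μ)) (Daha.lift T θ X H)]
      simp only [Daha.lift_T]
      exact congrArg (fun x : Module.End K (Model n μ) => x (Φ w))
        (natExt_of_lt (Tinv T) k hk).symm) 0 (n - 1) (by omega) h3
    rw [θ_vec, map_smul, Y_vec, ← PSYT.W_Psi, smul_smul] at h4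
    exact (Submodule.smul_mem_iff _ (mul_ne_zero (wt_ne_zero _)
      (inv_ne_zero (pow_ne_zero _ q_ne_zero)))).1 h4
  | succ m ihm =>
    let i : Fin (n - 1) := ⟨j.1, by omega⟩
    have hlo : lo i = j := rfl
    by_cases h3 : τ.w (hi i) = 0
    -- The next exponent is 0, so swapping moves the nonzero one closer to the end. The pair then
    -- ascends back to τ with coefficient 1, and T_i recovers the vector of τ.
    · have hup : Up (τ.W (hi i)) (τ.W (lo i)) := by
        refine .inl ?_
        change τ.w (hi i) < τ.w (lo i)
        rw [h3, hlo]
        exact Nat.pos_of_ne_zero hj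
      have hs := τ.isSwap_swap i (.inr hup)
      have h4 := ihm (τ.swap i (.inr hup)) (by rwa [hs.deg]) (hi i)
        (by rwa [(hs.box _).2, Equiv.swap_apply_right, hlo]) (by change j.1 + 1 + m = n - 1; omega)
      have hup' : Up ((τ.swap i (.inr hup)).W (lo i)) ((τ.swap i (.inr hup)).W (hi i)) := by
        rw [hs.W]
        simpa using hup
      have h5 : sw i (τ.swap i (.inr hup)).W = τ.W := by
        rw [hs.W]
        exact sw_sw i τ.W
      have h6 := T_vec (μ := μ) i (τ.swap i (.inr hup)).W
      rw [offCoeff_of_up hup', one_smul, h5, ← sub_eq_iff_eq_add'] at h6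
      rw [← h6]
      exact sub_mem (hT i _ h4) (Submodule.smul_mem _ _ h4)
    · exact ihm τ hτ (hi i) h3 (by change j.1 + 1 + m = n - 1; omega)

theorem finite_deg_le (d : ℕ) : Finite {τ : PSYT n μ // τ.deg ≤ d} := by
  let g : {τ : PSYT n μ // τ.deg ≤ d} → (μ.cells → Fin n × Fin (d + 1)) := fun τ b =>
    ((τ.1.label b).1, ⟨(τ.1.label b).2, by
      have h1 : τ.1.w (τ.1.label b).1 ≤ τ.1.deg :=
        Finset.single_le_sum (f := τ.1.w) (fun _ _ => Nat.zero_le _) (Finset.mem_univ _)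
      rw [τ.1.w_label] at h1
      have := τ.2
      omega⟩)
  refine Finite.of_injective g fun τ σ h => Subtype.ext (PSYT.ext (funext fun b => ?_))
  have h1 := congrFun h b
  simp only [g, Prod.mk.injEq, Fin.mk.injEq] at h1
  exact Prod.ext h1.1 h1.2

/-- On each filtration step the number of spanning monomials is at most the number of independent
vectors reached in the image, so rank–nullity leaves no kernel. -/
theorem map_injective (hX : ∀ hn k, X k = (shiftData n μ hn).X k.1)
    (h1 : ∀ τ, Φ (oneTmul τ) = vec τ.toPSYT.W)
    (h2 : ∀ b v, Φ (b • v) = Daha.lift T θ X H b (Φ v)) : Function.Injective Φ := by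
  rw [injective_iff_map_eq_zero]
  intro v hv
  obtain ⟨d, hd⟩ := V.exists_mem_filt v
  have := finite_deg_le (n := n) (μ := μ) d
  let J := {τ : PSYT n μ // τ.deg ≤ d}
  let I := {s : Multiset (Fin n) // s.card ≤ d} × SYT n μ
  -- The multiplicities of s become the exponents of the inflated tableau, so the degree of the
  -- monomial is its total exponent.
  let g : I → J := fun x => ⟨x.2.inflate fun j => x.1.1.count j, by
    rw [PSYT.deg, SYT.w_inflate, Multiset.sum_count_eq_card fun _ _ => Finset.mem_univ _]
    exact x.1.2⟩
  have hg : Function.Injective g := by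
    rintro ⟨⟨s, hs⟩, τ⟩ ⟨⟨s', hs'⟩, τ'⟩ h
    obtain ⟨e1, e2⟩ := SYT.inflate_injective (congrArg Subtype.val h)
    have e3 : s = s' := Multiset.ext.2 (congrFun e1)
    subst e3 e2
    rfl
  have : Finite I := Finite.of_injective g hg
  let _ := Fintype.ofFinite I
  let _ := Fintype.ofFinite J
  have hspan : V.filt n μ d = Submodule.span K (Set.range fun x : I => V.mono x.1.1 x.2) := by
    rw [V.filt]
    congr 1
    ext v
    constructor
    · rintro ⟨s, hs, τ, rfl⟩
      exact ⟨(⟨s, hs⟩, τ), rfl⟩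
    · rintro ⟨⟨⟨s, hs⟩, τ⟩, rfl⟩
      exact ⟨s, hs, τ, rfl⟩
  have hfin : FiniteDimensional K (V.filt n μ d) := by
    rw [hspan]
    exact FiniteDimensional.span_of_finite K (Set.finite_range _)
  have hle : Module.finrank K (V.filt n μ d) ≤ Fintype.card J := by
    rw [hspan]
    exact (finrank_range_le_card _).trans (Fintype.card_le_of_injective g hg)
  have hli : LinearIndependent K fun τ : J => (vec τ.1.W : Model n μ) := by
    simp only [vec_W]
    exact (Finsupp.basisSingleOne.linearIndependent (R := K) (ι := PSYT n μ)).comp _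
      Subtype.val_injective
  have hge : Fintype.card J ≤ Module.finrank K ((V.filt n μ d).map Φ) := by
    rw [← finrank_span_eq_card hli]
    refine Submodule.finrank_mono ?_
    rw [Submodule.span_le]
    rintro _ ⟨τ, rfl⟩
    exact vec_mem_map hX h1 h2 d τ.1 τ.2
  have hrank := LinearMap.finrank_range_add_finrank_ker (Φ.domRestrict (V.filt n μ d))
  rw [LinearMap.range_domRestrict] at hrank
  have hker : LinearMap.ker (Φ.domRestrict (V.filt n μ d)) = ⊥ :=
    Submodule.finrank_eq_zero.1 (by omega)
  have hz : (⟨v, hd⟩ : V.filt n μ d) ∈ LinearMap.ker (Φ.domRestrict (V.filt n μ d)) := hv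
  rw [hker, Submodule.mem_bot] at hz
  exact congrArg Subtype.val hz

theorem map_surjective (hX : ∀ hn k, X k = (shiftData n μ hn).X k.1)
    (h1 : ∀ τ, Φ (oneTmul τ) = vec τ.toPSYT.W)
    (h2 : ∀ b v, Φ (b • v) = Daha.lift T θ X H b (Φ v)) : Function.Surjective Φ := by
  rw [← LinearMap.range_eq_top, eq_top_iff, ← Finsupp.basisSingleOne.span_eq, Submodule.span_le]
  rintro _ ⟨τ, rfl⟩
  obtain ⟨v, -, hv⟩ := vec_mem_map hX h1 h2 τ.deg τ le_rfl
  refine ⟨v, ?_⟩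
  rw [hv, vec_W]
  rfl

variable (n μ) in
/-- The induced module is isomorphic to the explicit model. -/
theorem exists_equiv : ∃ (X : Fin n → Module.End K (Model n μ))
    (H : ∀ a b, DahaRel T θ X a b → a = b) (Φ : V n μ ≃ₗ[K] Model n μ),
    (∀ hn k, X k = (shiftData n μ hn).X k.1) ∧ (∀ τ, Φ (oneTmul τ) = vec τ.toPSYT.W) ∧
      ∀ b v, Φ (b • v) = Daha.lift T θ X H b (Φ v) := by
  obtain ⟨X, H, hX⟩ := exists_X (n := n) (μ := μ)
  obtain ⟨Φ, h1, h2⟩ := exists_map X H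
  exact ⟨X, H, LinearEquiv.ofBijective Φ ⟨map_injective hX h1 h2, map_surjective hX h1 h2⟩, hX,
    h1, h2⟩

/-! ### Transport of the basis and its formulas to the induced module -/

section Basis

variable {X : Fin n → Module.End K (Model n μ)} {H : ∀ a b, DahaRel T θ X a b → a = b}
  {Φ : V n μ ≃ₗ[K] Model n μ} {F : PSYT n μ → V n μ}

theorem theta_smul_basis (h2 : ∀ b v, Φ (b • v) = Daha.lift T θ X H b (Φ v))
    (hF : ∀ τ, Φ (F τ) = vec τ.W) (τ : PSYT n μ) (i : Fin n) :
    (Daha.θ i : Daha n) • F τ = wt (τ.W i) • F τ := by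
  apply Φ.injective
  rw [h2, Daha.lift_θ, hF, θ_vec, map_smul, hF]

theorem tTinv_smul_basis (h2 : ∀ b v, Φ (b • v) = Daha.lift T θ X H b (Φ v))
    (hF : ∀ τ, Φ (F τ) = vec τ.W) (i : Fin (n - 1)) {τ σ : PSYT n μ} (h : PSYT.IsSwap i τ σ)
    (hup : Up (τ.W (lo i)) (τ.W (hi i))) :
    (Daha.tTinv i : Daha n) • F τ + ((t - 1) * wt (τ.W (hi i)) /
      (wt (τ.W (lo i)) - wt (τ.W (hi i)))) • F τ = F σ := by
  have hs : sw i τ.W = σ.W := h.W.symm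
  have hne : wt (τ.W (lo i)) - wt (τ.W (hi i)) ≠ 0 :=
    sub_ne_zero.2 fun e => τ.W_lo_ne_hi i (wt_injective e)
  -- The added scalar is chosen to cancel the diagonal coefficient of t T_i⁻¹, so only the
  -- off-diagonal term, with coefficient 1, survives.
  have e : (1 - t) * wt (τ.W (lo i)) / (wt (τ.W (lo i)) - wt (τ.W (hi i))) + (t - 1) +
      (t - 1) * wt (τ.W (hi i)) / (wt (τ.W (lo i)) - wt (τ.W (hi i))) = 0 := by
    field_simp
    ring
  apply Φ.injective
  rw [map_add, h2, map_smul, hF, hF, Daha.tTinv, VVMac.tTinv, map_add, Daha.lift_T,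
    AlgHom.commutes, LinearMap.add_apply, T_vec, Module.algebraMap_end_apply,
    offCoeff_of_up hup, hs, one_smul, diagCoeff]
  linear_combination (norm := module) e • vec τ.W

theorem lift_pi (hn : 0 < n) : Daha.lift T θ X H (Daha.pi hn) = (affineData n μ hn).pi := by
  rw [Daha.pi, map_piElt (B := Module.End K (Model n μ)) (Daha.lift T θ X H)]
  simp only [Daha.lift_T, Daha.lift_θ]
  exact (AffineData.pi_ofFin hn _ _ _).symm

variable (n μ) in
theorem exists_piEquiv (hn : 0 < n) :
    ∃ Q : Model n μ ≃ₗ[K] Model n μ, ∀ v, Q v = (affineData n μ hn).pi v := by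
  obtain ⟨u, hu⟩ := (shiftData n μ hn).isUnit_pi
  exact ⟨LinearMap.GeneralLinearGroup.toLinearEquiv u, fun v => by rw [← hu]; rfl⟩

/-- Since the last X is Y π, applying it to a π-preimage of a vector amounts to applying Y; the
power of q undoes the normalization of Y. -/
theorem X_smul_of_pi (hX : ∀ hn k, X k = (shiftData n μ hn).X k.1)
    (h2 : ∀ b v, Φ (b • v) = Daha.lift T θ X H b (Φ v)) (hF : ∀ τ, Φ (F τ) = vec τ.W)
    (hn : 0 < n) (τ : PSYT n μ) {w : V n μ} (hw : (affineData n μ hn).pi (Φ w) = vec τ.W) :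
    F τ.Psi = q ^ τ.w ⟨0, hn⟩ • ((Daha.X ⟨n - 1, Nat.sub_lt hn Nat.one_pos⟩ : Daha n) • w) := by
  apply Φ.injective
  rw [hF, map_smul, h2, Daha.lift_X, hX hn, ShiftData.X_last, Module.End.mul_apply, hw]
  change _ = _ • Y hn _
  rw [Y_vec, smul_smul, PSYT.W_Psi]
  change _ = (q ^ τ.w ⟨0, hn⟩ * (q ^ τ.w ⟨0, hn⟩)⁻¹) • _
  rw [mul_inv_cancel₀ (pow_ne_zero _ q_ne_zero), one_smul]

theorem exists_pi_inverse (hX : ∀ hn k, X k = (shiftData n μ hn).X k.1)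
    (h2 : ∀ b v, Φ (b • v) = Daha.lift T θ X H b (Φ v)) (hF : ∀ τ, Φ (F τ) = vec τ.W)
    (hn : 0 < n) :
    ∃ P : V n μ ≃ₗ[K] V n μ, (∀ v, P v = (Daha.pi hn : Daha n) • v) ∧ ∀ τ, F τ.Psi =
      q ^ τ.w ⟨0, hn⟩ • ((Daha.X ⟨n - 1, Nat.sub_lt hn Nat.one_pos⟩ : Daha n) • P.symm (F τ)) := by
  obtain ⟨Q, hQ⟩ := exists_piEquiv n μ hn
  have hP : ∀ v, Φ (Φ.symm (Q (Φ v))) = Φ ((Daha.pi hn : Daha n) • v) := by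
    intro v
    rw [h2, lift_pi, LinearEquiv.apply_symm_apply, hQ]
  refine ⟨Φ.trans (Q.trans Φ.symm), fun v => Φ.injective (hP v), fun τ => ?_⟩
  refine X_smul_of_pi hX h2 hF hn τ ?_
  change (affineData n μ hn).pi (Φ (Φ.symm (Q.symm (Φ (F τ))))) = _
  rw [LinearEquiv.apply_symm_apply, hF, ← hQ, LinearEquiv.apply_symm_apply]

theorem exists_basis (Φ : V n μ ≃ₗ[K] Model n μ) :
    ∃ F : Module.Basis (PSYT n μ) K (V n μ), ∀ τ, Φ (F τ) = vec τ.W := by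
  refine ⟨Finsupp.basisSingleOne.map Φ.symm, fun τ => ?_⟩
  rw [Module.Basis.map_apply, LinearEquiv.apply_symm_apply, vec_W]
  rfl

end Basis

end Model

end

end VVMac

theorem mainTheorem9 (n : ℕ) (μ : YoungDiagram) (hμ : μ.card = n) :
    ∃ F : Module.Basis (VVMac.PSYT n μ) VVMac.K (VVMac.V n μ),
      -- weight vectors with the given weights
      (∀ (τ : VVMac.PSYT n μ) (i : Fin n),
        VVMac.Daha.θ i • F τ = (VVMac.q ^ τ.w i * VVMac.t ^ τ.c i) • F τ) ∧
      -- distinct tableaux have distinct weights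
      Function.Injective (fun (τ : VVMac.PSYT n μ) (i : Fin n) =>
        VVMac.q ^ τ.w i * VVMac.t ^ τ.c i) ∧
      -- normalization on standard tableaux
      (∀ τ : VVMac.SYT n μ, F τ.toPSYT = VVMac.oneTmul τ) ∧
      -- intertwiner relations
      (∀ (i : Fin (n - 1)) (τ σ : VVMac.PSYT n μ), VVMac.PSYT.IsSwap i τ σ →
        VVMac.PSYT.Lt τ σ →
        VVMac.Daha.tTinv i • F τ
          + ((VVMac.t - 1) * τ.weight (VVMac.hi i) /
              (τ.weight (VVMac.lo i) - τ.weight (VVMac.hi i))) • F τ = F σ) ∧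
      -- `π_n` acts invertibly, and the shift relation holds
      (∀ hn : 0 < n, ∃ P : VVMac.V n μ ≃ₗ[VVMac.K] VVMac.V n μ,
        (∀ v, P v = VVMac.Daha.pi hn • v) ∧
        ∀ τ : VVMac.PSYT n μ,
          F τ.Psi = VVMac.q ^ τ.w ⟨0, hn⟩ •
            (VVMac.Daha.X ⟨n - 1, Nat.sub_lt hn Nat.one_pos⟩ • P.symm (F τ))) := by
  obtain ⟨X, H, Φ, hX, h1, h2⟩ := VVMac.Model.exists_equiv n μ
  obtain ⟨F, hF⟩ := VVMac.Model.exists_basis Φ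
  exact ⟨F, VVMac.Model.theta_smul_basis h2 hF,
    fun τ σ h => VVMac.PSYT.W_injective (funext fun i => VVMac.wt_injective (congrFun h i)),
    fun τ => Φ.injective ((hF _).trans (h1 τ).symm),
    fun i τ σ h hlt => VVMac.Model.tTinv_smul_basis h2 hF i h (h.up_of_lt hlt),
    VVMac.Model.exists_pi_inverse hX h2 hF⟩
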